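/- **Setting.** Let $D\subset\mathbb R^2$ be a bounded open set with $\operatorname{int}\overline D=D$ (for example, with Lipschitz boundary). Let $\Gamma=\prod_{i=1}^N\Gamma_i$ be a product of bounded intervals and let $\rho\ge 0$ be a probability density on $\Gamma$. Write $\langle g\rangle=\int_\Gamma g\,\rho\,d\xi$. Let $\psi_0,\dots,\psi_{P-1}$, $P=\frac{(N+Q)!}{N!\,Q!}$, be polynomials in $\xi$ of degree at most $Q$ with $\langle\psi_0\rangle=1$, $\langle\psi_i\rangle=0$ for $i>0$, $\langle\psi_i\psi_j\rangle=0$ for $i\ne j$ and $\langle\psi_i^2\rangle>0$, and let $\mathcal Y=\operatorname{span}\{\psi_0,\dots,\psi_{P-1}\}$. Let $a$ be a measurable scalar and $\mathbf b$ a measurable $\mathbb R^2$-valued random field on $\overline D\times\Gamma$. Assume that, for almost every $\xi$ (with respect to $\rho\,d\xi$), $0<a_{\min}\le a(x,\xi)\le a_{\max}<\infty$ for all $x\in\overline D$, and that $\mathbf b$ is uniformly bounded, continuous in $x\in\overline D$ and satisfies $\nabla\cdot\mathbf b(\cdot,\xi)=0$ in $D$ in the sense of distributions. Let $T>0$, $\ell\in\mathbb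 N_0$ and $\kappa>0$. **Discretization.** Let $\mathcal T_h$ be a conforming triangulation of $\overline D$ into closed triangles $K$ (no hanging nodes) that is shape regular with constant $\kappa$: each $K$ contains a disc of radius $r$ with $\operatorname{diam}K\le\kappa r$. Let $\mathcal E_h^0$, $\mathcal E_h^\partial$ be its interior and boundary edges, $h_E$ the length of $E$, $\mathbf n_K$ the outward unit normal of $K$, $\partial K^-=\{x\in\partial K:\mathbf b\cdot\mathbf n_K<0\}$. Let $V_h$ be the space of functions on $D$ that are polynomials of degree at most $\ell$ on each $K$. On an edge $E$ shared by $K$ and $K^e$, with traces $u$ from $K$ and $u^e$ from $K^e$, put $[\![u]\!]=u\,\mathbf n_K+u^e\mathbf n_{K^e}$ and let $\{\!\{\cdot\}\!\}$ be the mean of the two traces; on a boundary edge $[\![u]\!]=u\,\mathbf n$ and $\{\!\{\cdot\}\!\}$ is the trace itself. For $\sigma>0$ let $$\begin{aligned}a_h(u,v,\xi)={}&\sum_K\int_K a\nabla u\cdot\nabla v\,dx-\sum_{E\in\mathcal E_h^0\cup\mathcal E_h^\partial}\int_E\big(\{\!\{a\nabla u\}\!\}\cdot[\![v]\!]+\{\!\{a\nabla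 v\}\!\}\cdot[\![u]\!]\big)ds+\sum_{E\in\mathcal E_h^0\cup\mathcal E_h^\partial}\frac{\sigma}{h_E}\int_E[\![u]\!]\cdot[\![v]\!]\,ds\\&+\sum_K\int_K\mathbf b\cdot\nabla u\,v\,dx+\sum_K\int_{\partial K^-\setminus\partial D}\mathbf b\cdot\mathbf n_K(u^e-u)v\,ds-\sum_K\int_{\partial K^-\cap\partial D}\mathbf b\cdot\mathbf n_K\,u\,v\,ds,\end{aligned}$$ $$\|u\|_e^2=\sum_K\int_K a|\nabla u|^2dx+\sum_{E\in\mathcal E_h^0\cup\mathcal E_h^\partial}\frac{\sigma}{h_E}\int_E|[\![u]\!]|^2ds+\frac12\sum_{E\in\mathcal E_h^\partial}\int_E|\mathbf b\cdot\mathbf n_E|\,u^2ds+\frac12\sum_{E\in\mathcal E_h^0}\int_E|\mathbf b\cdot\mathbf n_E|\,(u^e-u)^2ds,$$ where $a,\mathbf b$ are taken at $\xi$, and set $a_\xi(u,v)=\langle a_h(u,v,\cdot)\rangle$, $\|u\|_\xi^2=\langle\|u\|_e^2\rangle$, $\|u\|_{L^2(L^2(D);\Gamma)}^2=\langle\|u\|_{L^2(D)}^2\rangle$.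 Let $\Delta t=T/N_t$ with an integer $N_t\ge1$, and $t_n=n\Delta t$. Let $f^n=f(\cdot,t_n)\in L^2(D)$ for $1\le n\le N_t$, let $u^0\in L^2(L^2(D);\Gamma)$ (for example $u^0\in L^2(D)$, deterministic), and let $u^1,\dots,u^{N_t}\in V_h\otimes\mathcal Y$ satisfy, for $0\le n<N_t$, $$\frac1{\Delta t}\int_\Gamma\int_D(u^{n+1}-u^n)\,v\,dx\,\rho\,d\xi+a_\xi(u^{n+1},v)=\int_\Gamma\int_D f^{n+1}v\,dx\,\rho\,d\xi\qquad\forall v\in V_h\otimes\mathcal Y .$$ **Theorem.** There is $\sigma_0>0$, independent of the mesh and of $\Delta t$, such that for every penalty parameter $\sigma\ge\sigma_0$ there is a constant $C$, independent of the mesh (in particular of $h=\max_K\operatorname{diam}K$), of $\Delta t$, of $f$, of $u^0$ and of the solution, such that for all $1\le m\le N_t$ $$\|u^m\|^2_{L^2(L^2(D);\Gamma)}+\Delta t\sum_{n=1}^m\|u^n\|_\xi^2\le C\Big(\|u^0\|^2_{L^2(L^2(D);\Gamma)}+\Delta t\sum_{n=1}^m\|f^n\|^2_{L^2(L^2(D);\Gamma)}\Big).$$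 -/

import Mathlib

open MeasureTheory Set

open scoped Gradient ContDiff

noncomputable section

namespace SDG

/-- The Euclidean plane. -/
abbrev Plane : Type := EuclideanSpace ℝ (Fin 2)

/-- The values of a random vector with `N` real components. -/
abbrev Noise (N : ℕ) : Type := Fin N → ℝ

/-! ### Triangulations -/

/-- A conforming triangulation of `closure D` by finitely many closed nondegenerate triangles:
distinct triangles meet in the convex hull of their common vertices, that is, the intersection is
empty, a common vertex or a common edge (no hanging nodes). -/
structure Triangulation (D : Set Plane) where
  /-- the number of triangles -/
  card : ℕ
  /-- the vertices of each triangle -/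
  vert : Fin card → Fin 3 → Plane
  affineIndependent : ∀ K, AffineIndependent ℝ (vert K)
  distinct : ∀ K K', range (vert K) = range (vert K') → K = K'
  conforming : ∀ K K', K ≠ K' →
    convexHull ℝ (range (vert K)) ∩ convexHull ℝ (range (vert K')) =
      convexHull ℝ (range (vert K) ∩ range (vert K'))
  cover : closure D = ⋃ K, convexHull ℝ (range (vert K))

namespace Triangulation

variable {D : Set Plane} (𝒯 : Triangulation D)

/-- The closed triangle with index `K`. -/
def elem (K : Fin 𝒯.card) : Set Plane := convexHull ℝ (range (𝒯.vert K))

/-- Shape regularity with constant `κ`: the diameter of each triangle is at most `κ` times the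
radius of some disc inscribed in it. -/
def IsShapeRegular (κ : ℝ) : Prop :=
  ∀ K, ∃ (c : Plane) (r : ℝ), 0 < r ∧ Metric.closedBall c r ⊆ 𝒯.elem K ∧
    Metric.diam (𝒯.elem K) ≤ κ * r

/-- A triangle together with one of its edges: `(K, i)` stands for the edge of the triangle `K`
opposite to the vertex `i`. -/
abbrev Side : Type := Fin 𝒯.card × Fin 3

/-- First end point of the edge of a side. -/
def fst (e : 𝒯.Side) : Plane := 𝒯.vert e.1 (e.2 + 1)

/-- Second end point of the edge of a side. -/
def snd (e : 𝒯.Side) : Plane := 𝒯.vert e.1 (e.2 + 2)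

/-- The edge of a side, as a closed segment. -/
def edge (e : 𝒯.Side) : Set Plane := segment ℝ (𝒯.fst e) (𝒯.snd e)

/-- The length `h_E` of the edge. -/
def edgeLength (e : 𝒯.Side) : ℝ := dist (𝒯.fst e) (𝒯.snd e)

/-- The unit normal to the edge `e` that points out of the triangle `e.1`: the edge vector is
turned by a right angle, normalized, and given the sign that makes it point away from the vertex
opposite to the edge. -/
def normal (e : 𝒯.Side) : Plane :=
  (Real.sign (inner ℝ (!₂[(𝒯.snd e - 𝒯.fst e) 1, -(𝒯.snd e - 𝒯.fst e) 0] : Plane)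
      (𝒯.fst e - 𝒯.vert e.1 e.2)) * (𝒯.edgeLength e)⁻¹) •
    (!₂[(𝒯.snd e - 𝒯.fst e) 1, -(𝒯.snd e - 𝒯.fst e) 0] : Plane)

open Classical in
/-- The pairs of sides of two different triangles that share the same edge. Each interior edge
occurs twice, once seen from either of its two triangles. -/
def adjacentSides : Finset (𝒯.Side × 𝒯.Side) :=
  Finset.univ.filter fun p => p.1.1 ≠ p.2.1 ∧
    ({𝒯.fst p.1, 𝒯.snd p.1} : Set Plane) = {𝒯.fst p.2, 𝒯.snd p.2}

/-- The interior edges, each listed exactly once, together with the two triangles sharing it. -/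
def interiorEdges : Finset (𝒯.Side × 𝒯.Side) :=
  𝒯.adjacentSides.filter fun p => p.1.1 < p.2.1

open Classical in
/-- The boundary edges: the edges that belong to one triangle only. -/
def boundaryEdges : Finset 𝒯.Side :=
  Finset.univ.filter fun e => ∀ e' : 𝒯.Side, e'.1 ≠ e.1 →
    ({𝒯.fst e', 𝒯.snd e'} : Set Plane) ≠ {𝒯.fst e, 𝒯.snd e}

/-- The integral of `g` over the edge `e` with respect to arc length. -/
def edgeIntegral (e : 𝒯.Side) (g : Plane → ℝ) : ℝ :=
  ∫ x in 𝒯.edge e, g x ∂(Measure.hausdorffMeasure 1 : Measure Plane)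

/-- The part of the edge `e` on which the field `β` flows into the triangle `e.1`. -/
def inflow (β : Plane → Plane) (e : 𝒯.Side) : Set Plane :=
  {x | x ∈ 𝒯.edge e ∧ inner ℝ (β x) (𝒯.normal e) < 0}

/-- The integral of `g` over the inflow part of the edge `e` with respect to arc length. -/
def inflowIntegral (β : Plane → Plane) (e : 𝒯.Side) (g : Plane → ℝ) : ℝ :=
  ∫ x in 𝒯.inflow β e, g x ∂(Measure.hausdorffMeasure 1 : Measure Plane)

/-! ### Functions that are discontinuous across edges

A function on `D` that is piecewise smooth with respect to the triangulation is given by one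
function for each triangle `K`; its trace on an edge of `K` from inside `K` is the restriction to
the edge of the function that belongs to `K`. -/

/-- A deterministic piecewise given function. -/
abbrev PwFun : Type := Fin 𝒯.card → Plane → ℝ

/-- A random piecewise given function. -/
abbrev RandomPwFun (N : ℕ) : Type := Fin 𝒯.card → Plane → Noise N → ℝ

/-- The jump across an interior edge. -/
def jump (u : 𝒯.PwFun) (p : 𝒯.Side × 𝒯.Side) (x : Plane) : Plane :=
  u p.1.1 x • 𝒯.normal p.1 + u p.2.1 x • 𝒯.normal p.2

/-- The jump on a boundary edge. -/
def bdryJump (u : 𝒯.PwFun) (e : 𝒯.Side) (x : Plane) : Plane :=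
  u e.1 x • 𝒯.normal e

/-- The average of the flux `α ∇u` across an interior edge. -/
def avgFlux (α : Plane → ℝ) (u : 𝒯.PwFun) (p : 𝒯.Side × 𝒯.Side) (x : Plane) : Plane :=
  (1 / 2 : ℝ) • (α x • ∇ (u p.1.1) x + α x • ∇ (u p.2.1) x)

/-- The flux `α ∇u` on a boundary edge. -/
def bdryFlux (α : Plane → ℝ) (u : 𝒯.PwFun) (e : 𝒯.Side) (x : Plane) : Plane :=
  α x • ∇ (u e.1) x

/-- The symmetric interior penalty form with upwinding, for one realization `α`, `β` of the
diffusivity and of the velocity. -/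
def sipgForm (σ : ℝ) (α : Plane → ℝ) (β : Plane → Plane) (u v : 𝒯.PwFun) : ℝ :=
  (∑ K, ∫ x in 𝒯.elem K, α x * inner ℝ (∇ (u K) x) (∇ (v K) x))
  - ((∑ p ∈ 𝒯.interiorEdges, 𝒯.edgeIntegral p.1 fun x =>
        inner ℝ (𝒯.avgFlux α u p x) (𝒯.jump v p x))
      + ∑ e ∈ 𝒯.boundaryEdges, 𝒯.edgeIntegral e fun x =>
        inner ℝ (𝒯.bdryFlux α u e x) (𝒯.bdryJump v e x))
  - ((∑ p ∈ 𝒯.interiorEdges, 𝒯.edgeIntegral p.1 fun x =>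
        inner ℝ (𝒯.avgFlux α v p x) (𝒯.jump u p x))
      + ∑ e ∈ 𝒯.boundaryEdges, 𝒯.edgeIntegral e fun x =>
        inner ℝ (𝒯.bdryFlux α v e x) (𝒯.bdryJump u e x))
  + ((∑ p ∈ 𝒯.interiorEdges, σ / 𝒯.edgeLength p.1 * 𝒯.edgeIntegral p.1 fun x =>
        inner ℝ (𝒯.jump u p x) (𝒯.jump v p x))
      + ∑ e ∈ 𝒯.boundaryEdges, σ / 𝒯.edgeLength e * 𝒯.edgeIntegral e fun x =>
        inner ℝ (𝒯.bdryJump u e x) (𝒯.bdryJump v e x))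
  + (∑ K, ∫ x in 𝒯.elem K, inner ℝ (β x) (∇ (u K) x) * v K x)
  + (∑ p ∈ 𝒯.adjacentSides, 𝒯.inflowIntegral β p.1 fun x =>
        inner ℝ (β x) (𝒯.normal p.1) * (u p.2.1 x - u p.1.1 x) * v p.1.1 x)
  - ∑ e ∈ 𝒯.boundaryEdges, 𝒯.inflowIntegral β e fun x =>
        inner ℝ (β x) (𝒯.normal e) * u e.1 x * v e.1 x

/-- The energy norm on `D` for one realization `α`, `β` of the coefficients. -/
def energyNorm (σ : ℝ) (α : Plane → ℝ) (β : Plane → Plane) (u : 𝒯.PwFun) : ℝ :=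
  Real.sqrt (
    (∑ K, ∫ x in 𝒯.elem K, α x * ‖∇ (u K) x‖ ^ 2)
    + ((∑ p ∈ 𝒯.interiorEdges, σ / 𝒯.edgeLength p.1 * 𝒯.edgeIntegral p.1 fun x =>
          ‖𝒯.jump u p x‖ ^ 2)
        + ∑ e ∈ 𝒯.boundaryEdges, σ / 𝒯.edgeLength e * 𝒯.edgeIntegral e fun x =>
          ‖𝒯.bdryJump u e x‖ ^ 2)
    + (1 / 2) * (∑ e ∈ 𝒯.boundaryEdges, 𝒯.edgeIntegral e fun x =>
          |inner ℝ (β x) (𝒯.normal e)| * u e.1 x ^ 2)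
    + (1 / 2) * ∑ p ∈ 𝒯.interiorEdges, 𝒯.edgeIntegral p.1 fun x =>
          |inner ℝ (β x) (𝒯.normal p.1)| * (u p.2.1 x - u p.1.1 x) ^ 2)

/-! ### Stochastic versions; `ν` is the law of the random vector -/

/-- The `L²(D)` inner product, averaged over the noise. -/
def l2Inner {N : ℕ} (ν : Measure (Noise N)) (u v : 𝒯.RandomPwFun N) : ℝ :=
  ∫ ξ, (∑ K, ∫ x in 𝒯.elem K, u K x ξ * v K x ξ) ∂ν

/-- The norm of `L²(L²(D); Γ)`. -/
def l2Norm {N : ℕ} (ν : Measure (Noise N)) (u : 𝒯.RandomPwFun N) : ℝ :=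
  Real.sqrt (∫ ξ, (∑ K, ∫ x in 𝒯.elem K, u K x ξ ^ 2) ∂ν)

/-- Membership in `L²(L²(D); Γ)`. -/
def IsL2 {N : ℕ} (ν : Measure (Noise N)) (u : 𝒯.RandomPwFun N) : Prop :=
  ∀ K, MemLp (fun z : Plane × Noise N => u K z.1 z.2) 2 ((volume.restrict (𝒯.elem K)).prod ν)

/-- The bilinear form `a_ξ` of the stochastic discontinuous Galerkin method. -/
def stochForm {N : ℕ} (ν : Measure (Noise N)) (σ : ℝ) (a : Plane → Noise N → ℝ)
    (b : Plane → Noise N → Plane) (u v : 𝒯.RandomPwFun N) : ℝ :=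
  ∫ ξ, 𝒯.sipgForm σ (fun x => a x ξ) (fun x => b x ξ) (fun K x => u K x ξ)
    (fun K x => v K x ξ) ∂ν

/-- The linear form `l_ξ`, for a deterministic source `g` and zero Dirichlet boundary data. -/
def stochLoad {N : ℕ} (ν : Measure (Noise N)) (g : Plane → ℝ) (v : 𝒯.RandomPwFun N) : ℝ :=
  ∫ ξ, (∑ K, ∫ x in 𝒯.elem K, g x * v K x ξ) ∂ν

/-- The energy norm `‖·‖_ξ` on `D × Γ`. -/
def stochEnergyNorm {N : ℕ} (ν : Measure (Noise N)) (σ : ℝ) (a : Plane → Noise N → ℝ)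
    (b : Plane → Noise N → Plane) (u : 𝒯.RandomPwFun N) : ℝ :=
  Real.sqrt (∫ ξ, 𝒯.energyNorm σ (fun x => a x ξ) (fun x => b x ξ) (fun K x => u K x ξ) ^ 2 ∂ν)

/-- The space `V_h` of piecewise polynomials of degree at most `ℓ`. -/
def dgSpace (ℓ : ℕ) : Set 𝒯.PwFun :=
  {v | ∀ K, ∃ p : MvPolynomial (Fin 2) ℝ, p.totalDegree ≤ ℓ ∧
    ∀ x : Plane, v K x = MvPolynomial.eval (fun i => x i) p}

/-- The space `V_h ⊗ Y`, as a space of functions of `(x, ξ)`. -/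
def tensorSpace {N : ℕ} (ℓ : ℕ) (Y : Submodule ℝ (Noise N → ℝ)) :
    Submodule ℝ (𝒯.RandomPwFun N) :=
  Submodule.span ℝ {w | ∃ v ∈ 𝒯.dgSpace ℓ, ∃ y ∈ Y, w = fun K x ξ => v K x * y ξ}

/-- `u 0, …, u Nt` is a solution of the fully discrete problem: backward Euler with the time step
`T / Nt` on `[0, T]`, combined with the stochastic discontinuous Galerkin method. -/
def IsBackwardEulerSolution {N : ℕ} (ν : Measure (Noise N)) (σ : ℝ) (a : Plane → Noise N → ℝ)
    (b : Plane → Noise N → Plane) (ℓ : ℕ) (Y : Submodule ℝ (Noise N → ℝ)) (T : ℝ) (Nt : ℕ)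
    (f : ℝ → Plane → ℝ) (u : ℕ → 𝒯.RandomPwFun N) : Prop :=
  𝒯.IsL2 ν (u 0) ∧
  (∀ n, 1 ≤ n → n ≤ Nt → u n ∈ 𝒯.tensorSpace ℓ Y) ∧
  ∀ n < Nt, ∀ v ∈ 𝒯.tensorSpace ℓ Y,
    1 / (T / Nt) * 𝒯.l2Inner ν (u (n + 1) - u n) v + 𝒯.stochForm ν σ a b (u (n + 1)) v =
      𝒯.stochLoad ν (f ((n + 1 : ℕ) * (T / Nt))) v

end Triangulation

/-! ### Noise and coefficients -/

/-- The probability law `ρ(ξ) dξ` on the box `Γ = ∏ Γ i`. -/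
def noiseLaw {N : ℕ} (Γ : Fin N → Set ℝ) (ρ : Noise N → ℝ) : Measure (Noise N) :=
  (volume.restrict (univ.pi Γ)).withDensity fun ξ => ENNReal.ofReal (ρ ξ)

/-- `ρ` is a probability density on `Γ = ∏ Γ i`, a product of bounded intervals. -/
structure IsNoiseDensity {N : ℕ} (Γ : Fin N → Set ℝ) (ρ : Noise N → ℝ) : Prop where
  interval : ∀ i, (Γ i).OrdConnected
  bounded : ∀ i, Bornology.IsBounded (Γ i)
  measurable : Measurable ρ
  nonneg : ∀ ξ ∈ univ.pi Γ, 0 ≤ ρ ξ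
  integral_eq_one : ∫ ξ in univ.pi Γ, ρ ξ = 1

/-- The number `(N + Q)! / (N! Q!)` of polynomial chaos basis functions of degree at most `Q`
in `N` variables. -/
def chaosCard (N Q : ℕ) : ℕ := (N + Q).choose Q

/-- `ψ 0, …, ψ (P - 1)`, with `P = chaosCard N Q`, are orthogonal polynomials of degree at most
`Q` with respect to the law `ν`, normalized as in a polynomial chaos expansion. -/
structure IsChaosBasis {N : ℕ} (ν : Measure (Noise N)) (Q : ℕ)
    (ψ : ℕ → MvPolynomial (Fin N) ℝ) : Prop where
  degree_le : ∀ i < chaosCard N Q, (ψ i).totalDegree ≤ Q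
  mean_zero : ∫ ξ, MvPolynomial.eval ξ (ψ 0) ∂ν = 1
  mean_pos : ∀ i < chaosCard N Q, 0 < i → ∫ ξ, MvPolynomial.eval ξ (ψ i) ∂ν = 0
  orthogonal : ∀ i < chaosCard N Q, ∀ j < chaosCard N Q, i ≠ j →
    ∫ ξ, MvPolynomial.eval ξ (ψ i) * MvPolynomial.eval ξ (ψ j) ∂ν = 0
  norm_pos : ∀ i < chaosCard N Q, 0 < ∫ ξ, MvPolynomial.eval ξ (ψ i) ^ 2 ∂ν

/-- The stochastic space spanned by the polynomial chaos basis. -/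
def chaosSpace {N : ℕ} (Q : ℕ) (ψ : ℕ → MvPolynomial (Fin N) ℝ) : Submodule ℝ (Noise N → ℝ) :=
  Submodule.span ℝ {y | ∃ i < chaosCard N Q, y = fun ξ => MvPolynomial.eval ξ (ψ i)}

/-- The field `β` has divergence zero in `D` in the sense of distributions. -/
def IsDivFree (D : Set Plane) (β : Plane → Plane) : Prop :=
  ∀ φ : Plane → ℝ, ContDiff ℝ ∞ φ → HasCompactSupport φ → tsupport φ ⊆ D →
    ∫ x in D, inner ℝ (β x) (∇ φ x) = 0

/-- The assumptions on the diffusivity: it is measurable, and almost surely bounded between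
`amin` and `amax`. -/
structure IsDiffusivity {N : ℕ} (D : Set Plane) (ν : Measure (Noise N)) (amin amax : ℝ)
    (a : Plane → Noise N → ℝ) : Prop where
  measurable : Measurable fun z : Plane × Noise N => a z.1 z.2
  bounds : ∀ᵐ ξ ∂ν, ∀ x ∈ closure D, amin ≤ a x ξ ∧ a x ξ ≤ amax

/-- The assumptions on the velocity: it is measurable, uniformly bounded, almost surely
continuous in space up to the boundary, and almost surely divergence free. -/
structure IsVelocity {N : ℕ} (D : Set Plane) (ν : Measure (Noise N))
    (b : Plane → Noise N → Plane) : Prop where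
  measurable : Measurable fun z : Plane × Noise N => b z.1 z.2
  bounded : ∃ B : ℝ, ∀ᵐ ξ ∂ν, ∀ x ∈ closure D, ‖b x ξ‖ ≤ B
  continuous : ∀ᵐ ξ ∂ν, ContinuousOn (fun x => b x ξ) (closure D)
  divFree : ∀ᵐ ξ ∂ν, IsDivFree D fun x => b x ξ

end SDG

end

noncomputable section

namespace SDG

/-! The estimate is an energy argument: the scheme at step `n` is tested with `u (n + 1)`. The time
difference yields half the difference of the squared norms (`l2Inner_sub_self_ge`), the form yields
half the squared energy norm (`stochForm_coercive`), and the load is split by Young's inequality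
with weight `(2 * T)⁻¹` (`l2Inner_le`). After summation the squared norms on the right enter with
total weight at most `1 / 2`, because `m * τ ≤ T`; half of their maximum absorbs them
(`discrete_stability`). Neither a Poincaré inequality nor a restriction on the time step is needed.

The substance is coercivity with mesh-independent constants, proved for almost every realization
(`sipgForm_coercive`) and then integrated over the noise. The convective terms need no estimate: the
divergence theorem on each triangle, applied to the square of `u`, turns them exactly into the
upwind part of the energy (`convection_eq`). As the velocity is merely continuous and divergence
free in the sense of distributions, that theorem is obtained by testing with smooth cutoffs of a
triangle whose transition layers shrink to its sides (`integral_inner_gradient`). Cancellation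
across an interior edge relies on opposite normals, which conformity of the triangulation provides
(`normal_neg_of_adjacent`).

The consistency terms of the penalty method are split by Young's inequality with a weight
proportional to the edge length. The jumps go into the penalty, which is why `σ` must be large; the
fluxes go into the diffusion through an inverse trace inequality
(`edgeIntegral_sq_norm_gradient_le`). The latter has an explicit constant: differences of order `ℓ +
1` annihilate polynomials of degree at most `ℓ`, so the gradient at a point is a fixed combination
of gradients at equidistant points of any segment issuing from it. Averaging over the spacing bounds
a point value by a line integral, and integration along the edge gives an area integral.

Integration over the noise is harmless because the parameter box is bounded: discrete functions are
jointly smooth, hence bounded almost surely together with their gradients. -/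

/-! ### Integrals over the plane in affine coordinates -/

/-- The determinant of two plane vectors. -/
def cross (U V : Plane) : ℝ := U 0 * V 1 - U 1 * V 0

/-- The affine chart of the plane with origin `A` and axes `U`, `V`. -/
def chart (A U V : Plane) (z : ℝ × ℝ) : Plane := A + z.1 • U + z.2 • V

@[fun_prop]
lemma continuous_chart (A U V : Plane) : Continuous (chart A U V) := by
  unfold chart; fun_prop

/-- The linear map that sends the standard basis of the plane to `U`, `V`. -/
def frameMap (U V : Plane) : Plane →ₗ[ℝ] Plane where
  toFun x := x 0 • U + x 1 • V
  map_add' x y := by simp only [PiLp.add_apply]; module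
  map_smul' c x := by simp only [PiLp.smul_apply, smul_eq_mul, RingHom.id_apply]; module

lemma det_frameMap (U V : Plane) : LinearMap.det (frameMap U V) = cross U V := by
  rw [← LinearMap.det_toMatrix (EuclideanSpace.basisFun (Fin 2) ℝ).toBasis, Matrix.det_fin_two]
  simp [LinearMap.toMatrix_apply, frameMap, cross]
  ring

lemma measurableEmbedding_frameMap {U V : Plane} (h : cross U V ≠ 0) :
    MeasurableEmbedding (frameMap U V) := by
  let e := (LinearEquiv.ofIsUnitDet (f := frameMap U V)
    (v := (EuclideanSpace.basisFun (Fin 2) ℝ).toBasis)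
    (v' := (EuclideanSpace.basisFun (Fin 2) ℝ).toBasis)
    (by rw [LinearMap.det_toMatrix, det_frameMap]; exact h.isUnit)).toContinuousLinearEquiv
  exact e.toHomeomorph.measurableEmbedding

/-- The chart of the plane scales areas by the determinant of its axes. -/
lemma map_chart (A U V : Plane) (h : cross U V ≠ 0) :
    MeasurableEmbedding (chart A U V) ∧
      Measure.map (chart A U V) volume = ENNReal.ofReal |cross U V|⁻¹ • volume := by
  have hdet : LinearMap.det (frameMap U V) ≠ 0 := by rwa [det_frameMap]
  let e : ℝ × ℝ ≃ᵐ Plane :=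
    MeasurableEquiv.finTwoArrow.symm.trans (MeasurableEquiv.toLp 2 (Fin 2 → ℝ))
  have he : MeasurePreserving e volume volume :=
    (EuclideanSpace.volume_preserving_symm_measurableEquiv_toLp (Fin 2)).symm.comp
      (volume_preserving_finTwoArrow ℝ).symm
  have hf := measurableEmbedding_frameMap h
  have ht : MeasurableEmbedding fun x : Plane => A + x :=
    (Homeomorph.addLeft A).measurableEmbedding
  have hc : chart A U V = (fun x => A + x) ∘ frameMap U V ∘ e := by
    ext1 z
    simp [chart, frameMap, e, MeasurableEquiv.finTwoArrow, add_assoc]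
  refine ⟨hc ▸ ht.comp (hf.comp e.measurableEmbedding), ?_⟩
  rw [hc, ← Measure.map_map ht.measurable (hf.measurable.comp e.measurable),
    ← Measure.map_map hf.measurable e.measurable, he.map_eq,
    Measure.map_linearMap_addHaar_eq_smul_addHaar _ hdet, Measure.map_smul,
    map_add_left_eq_self, det_frameMap, abs_inv]

/-- No integrability of `F` is required, since the chart is a measurable embedding. -/
lemma integral_chart (A U V : Plane) (h : cross U V ≠ 0) (F : Plane → ℝ) :
    ∫ x, F x = |cross U V| * ∫ z, F (chart A U V z) := by
  obtain ⟨he, hm⟩ := map_chart A U V h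
  rw [← he.integral_map, hm, integral_smul_measure, ENNReal.toReal_ofReal (by positivity),
    smul_eq_mul, mul_inv_cancel_left₀ (abs_ne_zero.mpr h)]

lemma integrable_chart {A U V : Plane} (h : cross U V ≠ 0) {F : Plane → ℝ} (hF : Integrable F) :
    Integrable fun z => F (chart A U V z) := by
  obtain ⟨he, hm⟩ := map_chart A U V h
  have : Integrable F (Measure.map (chart A U V) volume) := by
    rw [hm]; exact hF.smul_measure ENNReal.ofReal_ne_top
  exact he.integrable_map_iff.mp this

/-! ### Integrals over segments -/

/-- The unit speed parametrization is an isometry, so it carries Lebesgue measure on the line to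
one-dimensional Hausdorff measure on its image; rescaling to the unit interval produces the length.
-/
lemma setIntegral_segment (x y : Plane) (hxy : x ≠ y) (g : Plane → ℝ) :
    ∫ z in segment ℝ x y, g z ∂(Measure.hausdorffMeasure 1 : Measure Plane) =
      dist x y * ∫ s in (0 : ℝ)..1, g (x + s • (y - x)) := by
  have hL : 0 < dist x y := dist_pos.mpr hxy
  set L := dist x y with hLdef
  have hLn : L = ‖y - x‖ := by rw [hLdef, dist_comm, dist_eq_norm]
  let f : ℝ → Plane := fun t => x + t • (L⁻¹ • (y - x))
  have hf : Isometry f := by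
    refine Isometry.of_dist_eq fun s t => ?_
    have hw : ‖L⁻¹ • (y - x)‖ = 1 := by
      rw [norm_smul, ← hLn, norm_inv, Real.norm_of_nonneg hL.le, inv_mul_cancel₀ hL.ne']
    simp only [f, dist_add_left]
    rw [dist_eq_norm, ← sub_smul, norm_smul, hw, mul_one, Real.dist_eq, Real.norm_eq_abs]
  have hseg : segment ℝ x y = f '' Icc 0 L := by
    rw [segment_eq_image']
    ext z
    simp only [mem_image, mem_Icc, f]
    constructor
    · rintro ⟨t, ⟨h0, h1⟩, rfl⟩
      refine ⟨t * L, ⟨by positivity, by nlinarith⟩, ?_⟩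
      rw [smul_smul, mul_assoc, mul_inv_cancel₀ hL.ne', mul_one]
    · rintro ⟨t, ⟨h0, h1⟩, rfl⟩
      refine ⟨t * L⁻¹, ⟨by positivity, ?_⟩, ?_⟩
      · rw [← div_eq_mul_inv]; exact (div_le_one hL).mpr h1
      · rw [smul_smul]
  have hemb : MeasurableEmbedding f := hf.isClosedEmbedding.measurableEmbedding
  have hmap := hf.map_hausdorffMeasure (d := 1) (Or.inl zero_le_one)
  rw [hausdorffMeasure_real] at hmap
  have h1 : (Measure.hausdorffMeasure 1 : Measure Plane).restrict (segment ℝ x y)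
      = (Measure.map f volume).restrict (segment ℝ x y) := by
    rw [hmap, Measure.restrict_restrict]
    · congr 1
      rw [hseg]
      exact (inter_eq_left.mpr (image_subset_range _ _)).symm
    · rw [hseg]
      exact (isCompact_Icc.image hf.continuous).measurableSet
  rw [h1, hemb.setIntegral_map, hseg, preimage_image_eq _ hf.injective,
    integral_Icc_eq_integral_Ioc, ← intervalIntegral.integral_of_le hL.le]
  have := intervalIntegral.integral_comp_mul_left (a := 0) (b := 1) (fun t => g (f t)) hL.ne'
  rw [mul_zero, mul_one] at this
  have h2 : ∀ s : ℝ, g (f (L * s)) = g (x + s • (y - x)) := by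
    intro s
    simp only [f]
    rw [smul_smul, mul_comm L, mul_assoc, mul_inv_cancel₀ hL.ne', mul_one]
  simp only [h2] at this
  rw [this, smul_eq_mul, mul_inv_cancel_left₀ hL.ne']

lemma hausdorffMeasure_segment_lt_top (x y : Plane) :
    (Measure.hausdorffMeasure 1 : Measure Plane) (segment ℝ x y) < ⊤ := by
  rw [hausdorffMeasure_segment]
  exact edist_lt_top _ _

/-! ### Finite differences of polynomials -/

/-- Along a line `p` is a univariate polynomial of degree at most `ℓ`, which the forward difference
of order `ℓ + 1` annihilates. -/
lemma fwdDiff_eval_eq_zero {ι : Type*} {ℓ : ℕ} (p : MvPolynomial ι ℝ) (hp : p.totalDegree ≤ ℓ)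
    (x d : ι → ℝ) :
    ∑ k ∈ Finset.range (ℓ + 2), ((-1 : ℝ) ^ (ℓ + 1 - k) * ((ℓ + 1).choose k : ℝ)) *
      MvPolynomial.eval (fun i => x i + k * d i) p = 0 := by
  let r : Polynomial ℝ :=
    MvPolynomial.aeval (fun i => Polynomial.C (d i) * Polynomial.X + Polynomial.C (x i)) p
  have hr : r.natDegree < ℓ + 1 := by
    have := MvPolynomial.aeval_natDegree_le p hp
      (fun i => Polynomial.C (d i) * Polynomial.X + Polynomial.C (x i)) (n := 1)
      (fun i => Polynomial.natDegree_linear_le)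
    rw [mul_one] at this
    exact Nat.lt_succ_of_le this
  have hev : ∀ t : ℝ, r.eval t = MvPolynomial.eval (fun i => x i + t * d i) p := by
    intro t
    have : (Polynomial.evalRingHom t).comp
        (MvPolynomial.aeval
          (fun i => Polynomial.C (d i) * Polynomial.X + Polynomial.C (x i))).toRingHom
        = MvPolynomial.eval (fun i => x i + t * d i) := by
      refine MvPolynomial.ringHom_ext (fun c => ?_) fun i => ?_
      · simp
      · simp; ring
    exact congrArg (fun f => f p) this
  have h0 := congrFun (Polynomial.fwdDiff_iter_eq_zero_of_degree_lt hr) 0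
  rw [fwdDiff_iter_eq_sum_shift] at h0
  simp only [zero_add, nsmul_eq_mul, mul_one, Pi.zero_apply] at h0
  rw [← h0]
  refine Finset.sum_congr rfl fun k _ => ?_
  rw [hev]
  simp

/-- A function on the plane that is smooth and annihilated by the differences of order `ℓ + 1`;
the polynomials of degree at most `ℓ` are of this kind. -/
structure IsPolyLike (ℓ : ℕ) (f : Plane → ℝ) : Prop where
  smooth : ContDiff ℝ ∞ f
  fwdDiff : ∀ x d : Plane, ∑ k ∈ Finset.range (ℓ + 2),
    ((-1 : ℝ) ^ (ℓ + 1 - k) * ((ℓ + 1).choose k : ℝ)) * f (x + (k : ℝ) • d) = 0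

lemma contDiff_eval {ι E : Type*} [NormedAddCommGroup E] [NormedSpace ℝ E]
    (p : MvPolynomial ι ℝ) {g : ι → E → ℝ} (hg : ∀ i, ContDiff ℝ ∞ (g i)) :
    ContDiff ℝ ∞ fun x => MvPolynomial.eval (fun i => g i x) p := by
  induction p using MvPolynomial.induction_on with
  | C c => simpa using contDiff_const
  | add p q hp hq => simpa using hp.add hq
  | mul_X p i hp => simpa using hp.mul (hg i)

lemma isPolyLike_eval {ℓ : ℕ} (p : MvPolynomial (Fin 2) ℝ) (hp : p.totalDegree ≤ ℓ) :
    IsPolyLike ℓ fun x => MvPolynomial.eval (fun i => x i) p where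
  smooth := contDiff_eval p fun i => contDiff_piLp_apply 2
  fwdDiff x d := by
    simpa using fwdDiff_eval_eq_zero p hp (fun i => x i) (fun i => d i)

lemma continuous_gradient {f : Plane → ℝ} (hf : ContDiff ℝ ∞ f) : Continuous (∇ f) := by
  unfold gradient
  exact (LinearIsometryEquiv.continuous _).comp (hf.continuous_fderiv (by simp))

/-- The sum of the squares of the coefficients of the difference of order `ℓ + 1`. -/
def diffConst (ℓ : ℕ) : ℝ := ∑ k ∈ Finset.range (ℓ + 1), ((ℓ + 1).choose (k + 1) : ℝ) ^ 2

lemma diffConst_pos (ℓ : ℕ) : 0 < diffConst ℓ := by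
  refine Finset.sum_pos (fun k hk => ?_) ⟨0, by simp⟩
  have : 0 < (ℓ + 1).choose (k + 1) := Nat.choose_pos (by simp at hk; omega)
  positivity

/-- Differentiating the vanishing difference in `x` gives a linear relation between gradients. The
coefficient at `k = 0` is `±1`, so the relation can be solved for the gradient at `x`;
Cauchy–Schwarz does the rest. -/
lemma IsPolyLike.sq_norm_gradient_le {ℓ : ℕ} {f : Plane → ℝ} (hf : IsPolyLike ℓ f) (x d : Plane) :
    ‖∇ f x‖ ^ 2 ≤ diffConst ℓ *
      ∑ k ∈ Finset.range (ℓ + 1), ‖∇ f (x + ((k : ℝ) + 1) • d)‖ ^ 2 := by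
  set c : ℕ → ℝ := fun k => (-1 : ℝ) ^ (ℓ + 1 - k) * ((ℓ + 1).choose k : ℝ) with hc
  have hd : ∀ y, HasFDerivAt f (fderiv ℝ f y) y := fun y =>
    (hf.smooth.differentiable (by simp) y).hasFDerivAt
  have h1 : HasFDerivAt (fun y => ∑ k ∈ Finset.range (ℓ + 2), c k * f (y + (k : ℝ) • d))
      (∑ k ∈ Finset.range (ℓ + 2), c k • fderiv ℝ f (x + (k : ℝ) • d)) x := by
    refine HasFDerivAt.fun_sum fun k _ => ?_
    exact ((hasFDerivAt_comp_add_right ((k : ℝ) • d)).mpr (hd (x + (k : ℝ) • d))).const_mul (c k)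
  have h2 : (∑ k ∈ Finset.range (ℓ + 2), c k • fderiv ℝ f (x + (k : ℝ) • d)) = 0 := by
    have : (fun y => ∑ k ∈ Finset.range (ℓ + 2), c k * f (y + (k : ℝ) • d)) = fun _ => 0 :=
      funext fun y => hf.fwdDiff y d
    rw [this] at h1
    exact h1.unique (hasFDerivAt_const _ _)
  rw [Finset.sum_range_succ'] at h2
  have hn : ∀ y, ‖∇ f y‖ = ‖fderiv ℝ f y‖ := fun y => by simp [gradient]
  have h3 : ‖fderiv ℝ f x‖ ≤
      ∑ k ∈ Finset.range (ℓ + 1), ((ℓ + 1).choose (k + 1) : ℝ) *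
        ‖fderiv ℝ f (x + ((k : ℝ) + 1) • d)‖ := by
    have h4 : ‖c 0 • fderiv ℝ f (x + ((0 : ℕ) : ℝ) • d)‖ = ‖fderiv ℝ f x‖ := by
      simp [hc, norm_smul]
    rw [← h4, eq_neg_of_add_eq_zero_right h2, norm_neg]
    refine (norm_sum_le _ _).trans (Finset.sum_le_sum fun k _ => ?_)
    simp [hc, norm_smul]
  simp only [hn]
  refine (pow_le_pow_left₀ (norm_nonneg _) h3 2).trans ?_
  exact Finset.sum_mul_sq_le_sq_mul_sq _ _ _

/-- The constant of the inverse trace inequality along segments. -/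
def traceConst (ℓ : ℕ) : ℝ := 2 * (ℓ + 1) ^ 2 * diffConst ℓ

lemma traceConst_pos (ℓ : ℕ) : 0 < traceConst ℓ := by
  have := diffConst_pos ℓ
  unfold traceConst
  positivity

/-- The preceding bound holds for every multiple `t • d` of the direction; averaging over `t`
replaces the sum of point values by a line integral. -/
lemma IsPolyLike.sq_norm_gradient_le_integral {ℓ : ℕ} {f : Plane → ℝ} (hf : IsPolyLike ℓ f)
    (x d : Plane) :
    ‖∇ f x‖ ^ 2 ≤ traceConst ℓ * ∫ t in (0 : ℝ)..(1 / 2), ‖∇ f (x + t • d)‖ ^ 2 := by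
  have hcont : Continuous fun y => ‖∇ f y‖ ^ 2 := (continuous_gradient hf.smooth).norm.pow 2
  set G : ℝ → ℝ := fun t => ‖∇ f (x + t • d)‖ ^ 2 with hG
  have hGc : Continuous G := hcont.comp (by fun_prop)
  have hG0 : ∀ t, 0 ≤ G t := fun t => by positivity
  set n : ℝ := (ℓ : ℝ) + 1 with hn
  have hn0 : 0 < n := by positivity
  -- With `t` at most `1 / (2 * n)`, `n = ℓ + 1`, all the nodes `(k + 1) * t` remain in `[0, 1 /
  -- 2]`. The average has total length `1 / (2 * n)`, whence one factor `2 * n` of `traceConst`; the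
  -- other `n` counts the nodes.
  have h1 : ∫ _t in (0 : ℝ)..(1 / (2 * n)), ‖∇ f x‖ ^ 2 ≤
      ∫ t in (0 : ℝ)..(1 / (2 * n)), diffConst ℓ *
        ∑ k ∈ Finset.range (ℓ + 1), G (((k : ℝ) + 1) * t) := by
    refine intervalIntegral.integral_mono_on (by positivity) (by simp)
      (Continuous.intervalIntegrable (by fun_prop) _ _) fun t _ => ?_
    have := hf.sq_norm_gradient_le x (t • d)
    simpa only [smul_smul, hG] using this
  rw [intervalIntegral.integral_const, intervalIntegral.integral_const_mul,
    intervalIntegral.integral_finsetSum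
      (fun k _ => Continuous.intervalIntegrable (by fun_prop) _ _)] at h1
  have h2 : ∀ k ∈ Finset.range (ℓ + 1),
      ∫ t in (0 : ℝ)..(1 / (2 * n)), G (((k : ℝ) + 1) * t) ≤ ∫ t in (0 : ℝ)..(1 / 2), G t := by
    intro k hk
    have hk' : (k : ℝ) + 1 ≤ n := by
      have : k + 1 ≤ ℓ + 1 := by simp at hk; omega
      rw [hn]; exact_mod_cast this
    have hk0 : (1 : ℝ) ≤ (k : ℝ) + 1 := by simp
    rw [intervalIntegral.integral_comp_mul_left G (by positivity), mul_zero, smul_eq_mul]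
    have h3 : ((k : ℝ) + 1) * (1 / (2 * n)) ≤ 1 / 2 := by
      rw [mul_one_div, div_le_div_iff₀ (by positivity) (by positivity)]; linarith
    have h4 : ∫ t in (0 : ℝ)..((k : ℝ) + 1) * (1 / (2 * n)), G t ≤ ∫ t in (0 : ℝ)..(1 / 2), G t :=
      intervalIntegral.integral_mono_interval le_rfl (by positivity) h3
        (Filter.Eventually.of_forall hG0) (hGc.intervalIntegrable _ _)
    have h5 : 0 ≤ ∫ t in (0 : ℝ)..((k : ℝ) + 1) * (1 / (2 * n)), G t :=
      intervalIntegral.integral_nonneg (by positivity) fun t _ => hG0 t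
    exact (mul_le_of_le_one_left h5 (inv_le_one_of_one_le₀ hk0)).trans h4
  have h3 := Finset.sum_le_sum h2
  rw [Finset.sum_const, Finset.card_range, nsmul_eq_mul] at h3
  push_cast at h3
  rw [← hn] at h3
  have h6 : (1 / (2 * n)) * ‖∇ f x‖ ^ 2 ≤
      diffConst ℓ * (n * ∫ t in (0 : ℝ)..(1 / 2), G t) := by
    refine le_trans (le_of_eq ?_) (h1.trans (mul_le_mul_of_nonneg_left h3 (diffConst_pos ℓ).le))
    rw [sub_zero, smul_eq_mul]
  have h7 : ‖∇ f x‖ ^ 2 = 2 * n * ((1 / (2 * n)) * ‖∇ f x‖ ^ 2) := by field_simp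
  rw [h7]
  refine (mul_le_mul_of_nonneg_left h6 (by positivity)).trans (le_of_eq ?_)
  unfold traceConst
  ring

namespace Triangulation

variable {D : Set Plane} (𝒯 : Triangulation D)

/-! ### Geometry of the sides of a triangle -/

/-- The vertices of a triangle, as an affine basis of the plane. -/
def affBasis (K : Fin 𝒯.card) : AffineBasis (Fin 3) ℝ Plane where
  toFun := 𝒯.vert K
  ind' := 𝒯.affineIndependent K
  tot' := by
    rw [(𝒯.affineIndependent K).affineSpan_eq_top_iff_card_eq_finrank_add_one]
    simp

@[simp] lemma affBasis_apply (K : Fin 𝒯.card) (i : Fin 3) : 𝒯.affBasis K i = 𝒯.vert K i := rfl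

lemma mem_elem_iff (K : Fin 𝒯.card) (x : Plane) :
    x ∈ 𝒯.elem K ↔ ∀ i, 0 ≤ (𝒯.affBasis K).coord i x := by
  have : 𝒯.elem K = convexHull ℝ (range (𝒯.affBasis K)) := rfl
  rw [this, AffineBasis.convexHull_eq_nonneg_coord]
  rfl

/-- The edge vector of a side. -/
def tan (e : 𝒯.Side) : Plane := 𝒯.snd e - 𝒯.fst e

/-- The vector from the first end point of a side to the opposite vertex. -/
def apx (e : 𝒯.Side) : Plane := 𝒯.vert e.1 e.2 - 𝒯.fst e

/-- The Jacobian of the chart of a side, twice the area of its triangle. -/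
def jac (e : 𝒯.Side) : ℝ := |cross (𝒯.tan e) (𝒯.apx e)|

/-- The affine coordinates of the plane that belong to a side. -/
def sideChart (e : 𝒯.Side) (z : ℝ × ℝ) : Plane := chart (𝒯.fst e) (𝒯.tan e) (𝒯.apx e) z

lemma sideChart_eq (e : 𝒯.Side) (s t : ℝ) :
    𝒯.sideChart e (s, t) = 𝒯.fst e + s • 𝒯.tan e + t • 𝒯.apx e := rfl

/-- Barycentric coordinates are affine with Kronecker values at the vertices. In this chart the
triangle becomes the reference triangle, with the side on the axis `t = 0`. -/
lemma coord_sideChart (e : 𝒯.Side) (s t : ℝ) :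
    (𝒯.affBasis e.1).coord e.2 (𝒯.sideChart e (s, t)) = t ∧
    (𝒯.affBasis e.1).coord (e.2 + 2) (𝒯.sideChart e (s, t)) = s ∧
    (𝒯.affBasis e.1).coord (e.2 + 1) (𝒯.sideChart e (s, t)) = 1 - s - t := by
  obtain ⟨K, i⟩ := e
  have key : ∀ j, (𝒯.affBasis K).coord j (𝒯.sideChart (K, i) (s, t)) =
      (𝒯.affBasis K).coord j (𝒯.vert K (i + 1))
      + s * ((𝒯.affBasis K).coord j (𝒯.vert K (i + 2))
        - (𝒯.affBasis K).coord j (𝒯.vert K (i + 1)))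
      + t * ((𝒯.affBasis K).coord j (𝒯.vert K i)
        - (𝒯.affBasis K).coord j (𝒯.vert K (i + 1))) := by
    intro j
    set c := (𝒯.affBasis K).coord j
    have hsub : ∀ x y : Plane, c.linear (x - y) = c x - c y := fun x y => c.linearMap_vsub x y
    have : 𝒯.sideChart (K, i) (s, t) =
        (s • 𝒯.tan (K, i) + t • 𝒯.apx (K, i)) +ᵥ 𝒯.vert K (i + 1) := by
      rw [sideChart_eq, vadd_eq_add]; simp only [fst]; abel
    rw [this, c.map_vadd, map_add, map_smul, map_smul]
    simp only [tan, apx, fst, snd, hsub, vadd_eq_add, smul_eq_mul]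
    ring
  have hb : ∀ j k, (𝒯.affBasis K).coord j (𝒯.vert K k) = if j = k then 1 else 0 :=
    fun j k => (𝒯.affBasis K).coord_apply j k
  simp only [key, hb]
  fin_cases i <;> simp <;> ring

lemma sideChart_mem_elem_iff (e : 𝒯.Side) (s t : ℝ) :
    𝒯.sideChart e (s, t) ∈ 𝒯.elem e.1 ↔ 0 ≤ s ∧ 0 ≤ t ∧ s + t ≤ 1 := by
  obtain ⟨h0, h2, h1⟩ := 𝒯.coord_sideChart e s t
  rw [mem_elem_iff]
  constructor
  · intro h
    have a0 := h e.2
    have a1 := h (e.2 + 1)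
    have a2 := h (e.2 + 2)
    rw [h0] at a0; rw [h1] at a1; rw [h2] at a2
    exact ⟨a2, a0, by linarith⟩
  · rintro ⟨hs, ht, hst⟩ i
    have : i = e.2 ∨ i = e.2 + 1 ∨ i = e.2 + 2 := by
      generalize e.2 = k
      fin_cases k <;> fin_cases i <;> decide
    rcases this with rfl | rfl | rfl
    · rw [h0]; exact ht
    · rw [h1]; linarith
    · rw [h2]; exact hs

lemma sideChart_coord (e : 𝒯.Side) (x : Plane) :
    𝒯.sideChart e ((𝒯.affBasis e.1).coord (e.2 + 2) x, (𝒯.affBasis e.1).coord e.2 x) = x := by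
  obtain ⟨K, i⟩ := e
  have h := (𝒯.affBasis K).linear_combination_coord_eq_self x
  have h1 := (𝒯.affBasis K).sum_coord_apply_eq_one x
  rw [Fin.sum_univ_three] at h h1
  simp only [affBasis_apply] at h
  set c := fun j => (𝒯.affBasis K).coord j x
  have hc : c 0 + c 1 + c 2 = 1 := h1
  have h' : c 0 • 𝒯.vert K 0 + c 1 • 𝒯.vert K 1 + c 2 • 𝒯.vert K 2 = x := h
  change 𝒯.sideChart (K, i) (c (i + 2), c i) = x
  rw [sideChart_eq, ← h']
  simp only [tan, apx, fst, snd]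
  fin_cases i
  · have : c 1 = 1 - c 0 - c 2 := by linarith
    simp [this]; module
  · have : c 2 = 1 - c 0 - c 1 := by linarith
    simp [this]; module
  · have : c 0 = 1 - c 1 - c 2 := by linarith
    simp [this]; module

/-- If the determinant vanished, `V j • U - U j • V` would be zero, so the chart would send `(V j,
-U j)` and the origin to the same point. The second coordinate is recovered from that point, so `U =
0`; then `(1, 0)` and the origin would also be identified. -/
lemma cross_ne_zero (e : 𝒯.Side) : cross (𝒯.tan e) (𝒯.apx e) ≠ 0 := by
  intro h
  set U := 𝒯.tan e with hU
  set V := 𝒯.apx e with hV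
  have h1 : ∀ j : Fin 2, V j • U - U j • V = 0 := by
    intro j
    ext k
    unfold cross at h
    fin_cases j <;> fin_cases k <;> simp <;> linarith
  have h2 : ∀ j : Fin 2, U j = 0 := by
    intro j
    have e1 : 𝒯.sideChart e (V j, -U j) = 𝒯.sideChart e (0, 0) := by
      rw [sideChart_eq, sideChart_eq]
      have := h1 j
      rw [← hU, ← hV, zero_smul, zero_smul, neg_smul, add_assoc, ← sub_eq_add_neg, this]
      simp
    have e2 := (𝒯.coord_sideChart e (V j) (-U j)).1
    rw [e1, (𝒯.coord_sideChart e 0 0).1] at e2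
    linarith
  have hU0 : U = 0 := by ext j; simpa using h2 j
  have e1 : 𝒯.sideChart e (1, 0) = 𝒯.sideChart e (0, 0) := by
    rw [sideChart_eq, sideChart_eq, ← hU, hU0]; simp
  have e2 := (𝒯.coord_sideChart e 1 0).2.1
  rw [e1, (𝒯.coord_sideChart e 0 0).2.1] at e2
  exact zero_ne_one e2

lemma jac_pos (e : 𝒯.Side) : 0 < 𝒯.jac e := abs_pos.mpr (𝒯.cross_ne_zero e)

lemma tan_ne_zero (e : 𝒯.Side) : 𝒯.tan e ≠ 0 := by
  intro h
  apply 𝒯.cross_ne_zero e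
  simp [h, cross]

lemma fst_ne_snd (e : 𝒯.Side) : 𝒯.fst e ≠ 𝒯.snd e := fun h => 𝒯.tan_ne_zero e (by simp [tan, h])

lemma edgeLength_pos (e : 𝒯.Side) : 0 < 𝒯.edgeLength e := dist_pos.mpr (𝒯.fst_ne_snd e)

lemma edgeLength_eq (e : 𝒯.Side) : 𝒯.edgeLength e = ‖𝒯.tan e‖ := by
  rw [edgeLength, tan, dist_comm, dist_eq_norm]

/-- A plane vector turned by a right angle. -/
def turn (U : Plane) : Plane := !₂[U 1, -U 0]

lemma inner_turn (U V : Plane) : inner ℝ (turn U) V = -cross U V := by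
  simp [turn, cross, PiLp.inner_apply, Fin.sum_univ_two]; ring

lemma norm_turn (U : Plane) : ‖turn U‖ = ‖U‖ := by
  simp [EuclideanSpace.norm_eq, turn, Fin.sum_univ_two, add_comm]

lemma normal_eq (e : 𝒯.Side) : 𝒯.normal e =
    (Real.sign (cross (𝒯.tan e) (𝒯.apx e)) * (𝒯.edgeLength e)⁻¹) • turn (𝒯.tan e) := by
  have h : inner ℝ (turn (𝒯.tan e)) (𝒯.fst e - 𝒯.vert e.1 e.2) = cross (𝒯.tan e) (𝒯.apx e) := by
    have : 𝒯.fst e - 𝒯.vert e.1 e.2 = -𝒯.apx e := by simp [apx]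
    rw [this, inner_neg_right, inner_turn, neg_neg]
  rw [← h]
  rfl

lemma abs_sign {c : ℝ} (hc : c ≠ 0) : |Real.sign c| = 1 := by
  rcases Real.sign_apply_eq_of_ne_zero c hc with h | h <;> simp [h]

lemma norm_normal (e : 𝒯.Side) : ‖𝒯.normal e‖ = 1 := by
  rw [normal_eq, norm_smul, norm_turn, ← edgeLength_eq, norm_mul, Real.norm_eq_abs,
    abs_sign (𝒯.cross_ne_zero e), one_mul, norm_inv, Real.norm_of_nonneg (𝒯.edgeLength_pos e).le,
    inv_mul_cancel₀ (𝒯.edgeLength_pos e).ne']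

lemma inner_normal_tan (e : 𝒯.Side) : inner ℝ (𝒯.normal e) (𝒯.tan e) = 0 := by
  have : cross (𝒯.tan e) (𝒯.tan e) = 0 := by unfold cross; ring
  rw [normal_eq, real_inner_smul_left, inner_turn, this, neg_zero, mul_zero]

/-- The quotient is the height of the triangle over the side; the sign says that the normal points
away from the opposite vertex. -/
lemma inner_normal_apx (e : 𝒯.Side) :
    inner ℝ (𝒯.normal e) (𝒯.apx e) = -(𝒯.jac e / 𝒯.edgeLength e) := by
  rw [normal_eq, real_inner_smul_left, inner_turn, jac]
  have : Real.sign (cross (𝒯.tan e) (𝒯.apx e)) * cross (𝒯.tan e) (𝒯.apx e)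
      = |cross (𝒯.tan e) (𝒯.apx e)| := by
    rcases lt_or_gt_of_ne (𝒯.cross_ne_zero e) with h | h
    · rw [Real.sign_of_neg h, abs_of_neg h]; ring
    · rw [Real.sign_of_pos h, abs_of_pos h]; ring
  rw [← this]; ring

/-- The coordinate that belongs to the vertex opposite to a side is the normalized distance to the
line through the edge. -/
lemma coord_eq (e : 𝒯.Side) (x : Plane) :
    (𝒯.affBasis e.1).coord e.2 x =
      -(𝒯.edgeLength e / 𝒯.jac e) * inner ℝ (𝒯.normal e) (x - 𝒯.fst e) := by
  have hx := 𝒯.sideChart_coord e x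
  set s := (𝒯.affBasis e.1).coord (e.2 + 2) x
  set t := (𝒯.affBasis e.1).coord e.2 x
  have : x - 𝒯.fst e = s • 𝒯.tan e + t • 𝒯.apx e := by
    rw [← hx, sideChart_eq]; abel
  rw [this, inner_add_right, real_inner_smul_right, real_inner_smul_right, inner_normal_tan,
    inner_normal_apx]
  have := (𝒯.jac_pos e).ne'
  have := (𝒯.edgeLength_pos e).ne'
  field_simp
  ring

lemma isCompact_elem (K : Fin 𝒯.card) : IsCompact (𝒯.elem K) :=
  (finite_range _).isCompact_convexHull ℝ

lemma measurableSet_elem (K : Fin 𝒯.card) : MeasurableSet (𝒯.elem K) :=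
  (𝒯.isCompact_elem K).measurableSet

lemma convex_elem (K : Fin 𝒯.card) : Convex ℝ (𝒯.elem K) := convex_convexHull ℝ _

lemma elem_subset_closure (K : Fin 𝒯.card) : 𝒯.elem K ⊆ closure D := by
  rw [𝒯.cover]; exact subset_iUnion (fun K => convexHull ℝ (range (𝒯.vert K))) K

lemma vert_mem_elem (K : Fin 𝒯.card) (i : Fin 3) : 𝒯.vert K i ∈ 𝒯.elem K :=
  subset_convexHull ℝ _ (mem_range_self i)

lemma edge_subset_elem (e : 𝒯.Side) : 𝒯.edge e ⊆ 𝒯.elem e.1 :=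
  (𝒯.convex_elem e.1).segment_subset (𝒯.vert_mem_elem _ _) (𝒯.vert_mem_elem _ _)

lemma isCompact_edge (e : 𝒯.Side) : IsCompact (𝒯.edge e) := by
  rw [edge, segment_eq_image']
  exact isCompact_Icc.image (by fun_prop)

lemma measurableSet_edge (e : 𝒯.Side) : MeasurableSet (𝒯.edge e) :=
  (𝒯.isCompact_edge e).measurableSet

/-- Arc length on an edge. -/
def edgeMeasure (e : 𝒯.Side) : Measure Plane := (Measure.hausdorffMeasure 1).restrict (𝒯.edge e)

instance (e : 𝒯.Side) : IsFiniteMeasure (𝒯.edgeMeasure e) :=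
  ⟨by rw [edgeMeasure, Measure.restrict_apply_univ]; exact hausdorffMeasure_segment_lt_top _ _⟩

instance (K : Fin 𝒯.card) : IsFiniteMeasure (volume.restrict (𝒯.elem K)) :=
  ⟨by rw [Measure.restrict_apply_univ]; exact (𝒯.isCompact_elem K).measure_lt_top⟩

lemma edgeIntegral_eq (e : 𝒯.Side) (g : Plane → ℝ) :
    𝒯.edgeIntegral e g = 𝒯.edgeLength e * ∫ s in (0 : ℝ)..1, g (𝒯.sideChart e (s, 0)) := by
  rw [edgeIntegral, edge, setIntegral_segment _ _ (𝒯.fst_ne_snd e)]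
  simp [sideChart_eq, edgeLength, tan]

lemma setIntegral_elem (e : 𝒯.Side) (F : Plane → ℝ) :
    ∫ x in 𝒯.elem e.1, F x =
      𝒯.jac e * ∫ z, (𝒯.elem e.1).indicator F (𝒯.sideChart e z) := by
  rw [← integral_indicator (𝒯.measurableSet_elem _), integral_chart _ _ _ (𝒯.cross_ne_zero e)]
  rfl

/-- Shape regularity bounds the squared length of an edge by the area of the triangle. -/
lemma sq_edgeLength_le {κ : ℝ} (hκ : 𝒯.IsShapeRegular κ) (e : 𝒯.Side) :
    𝒯.edgeLength e ^ 2 ≤ κ ^ 2 * 𝒯.jac e := by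
  obtain ⟨c, r, hr, hball, hdiam⟩ := hκ e.1
  have h1 : 𝒯.edgeLength e ≤ κ * r :=
    (Metric.dist_le_diam_of_mem (𝒯.isCompact_elem _).isBounded (𝒯.vert_mem_elem _ _)
      (𝒯.vert_mem_elem _ _)).trans hdiam
  -- The reference triangle lies in the unit square; the exact factor `1 / 2` is not needed.
  have h2 : (volume (𝒯.elem e.1)).toReal ≤ 𝒯.jac e := by
    have := 𝒯.setIntegral_elem e fun _ => 1
    rw [setIntegral_const, smul_eq_mul, mul_one] at this
    change (volume.real (𝒯.elem e.1)) ≤ _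
    rw [this]
    refine mul_le_of_le_one_right (𝒯.jac_pos e).le ?_
    have h3 : (fun z => (𝒯.elem e.1).indicator (fun _ => (1 : ℝ)) (𝒯.sideChart e z)) ≤
        (Icc (0 : ℝ) 1 ×ˢ Icc (0 : ℝ) 1).indicator fun _ => (1 : ℝ) := by
      rintro ⟨s, t⟩
      by_cases hz : 𝒯.sideChart e (s, t) ∈ 𝒯.elem e.1
      · have hz' := (𝒯.sideChart_mem_elem_iff e s t).mp hz
        have hb : (s, t) ∈ Icc (0 : ℝ) 1 ×ˢ Icc (0 : ℝ) 1 :=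
          ⟨⟨hz'.1, by linarith⟩, ⟨hz'.2.1, by linarith⟩⟩
        simp only [indicator_of_mem hz, indicator_of_mem hb, le_refl]
      · simp only [indicator_of_notMem hz]
        exact indicator_nonneg (fun _ _ => zero_le_one) _
    have hv : volume (Icc (0 : ℝ) 1 ×ˢ Icc (0 : ℝ) 1) = 1 := by
      rw [Measure.volume_eq_prod, Measure.prod_prod]; simp
    have hm : MeasurableSet (Icc (0 : ℝ) 1 ×ˢ Icc (0 : ℝ) 1) := by measurability
    refine (integral_mono_of_nonneg (Filter.Eventually.of_forall fun z =>
      indicator_nonneg (fun _ _ => zero_le_one) _) ?_ (Filter.Eventually.of_forall h3)).trans ?_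
    · exact (integrable_indicator_iff hm).mpr (integrableOn_const (by rw [hv]; simp))
    · rw [integral_indicator hm, setIntegral_const, Measure.real, hv]; simp
  -- The inscribed disc has area `π * r ^ 2`; the factor `π` is given away.
  have h4 : r ^ 2 ≤ (volume (𝒯.elem e.1)).toReal := by
    have h5 : (volume (Metric.ball c r)).toReal ≤ (volume (𝒯.elem e.1)).toReal :=
      ENNReal.toReal_mono (𝒯.isCompact_elem _).measure_lt_top.ne
        (measure_mono (Metric.ball_subset_closedBall.trans hball))
    rw [EuclideanSpace.volume_ball_fin_two] at h5
    simp only [ENNReal.toReal_mul, ENNReal.toReal_pow, ENNReal.toReal_ofReal hr.le,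
      ENNReal.toReal_ofReal Real.pi_pos.le] at h5
    nlinarith [Real.pi_gt_three, sq_nonneg r]
  have h6 := 𝒯.edgeLength_pos e
  calc 𝒯.edgeLength e ^ 2 ≤ (κ * r) ^ 2 := pow_le_pow_left₀ h6.le h1 2
    _ = κ ^ 2 * r ^ 2 := by ring
    _ ≤ _ := mul_le_mul_of_nonneg_left (h4.trans h2) (sq_nonneg _)

end Triangulation

/-! ### The inverse trace inequality -/

/-- From each point `A + s • U` the line bound is applied in the direction `V`. Integration in `s`
then covers the image of a square that lies in `K`, and the chart turns this into an area integral.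
-/
lemma IsPolyLike.integral_segment_le {ℓ : ℕ} {f : Plane → ℝ} (hf : IsPolyLike ℓ f)
    {A U V : Plane} (hUV : cross U V ≠ 0) {K : Set Plane} (hK : IsCompact K)
    (hsub : ∀ s ∈ Icc (0 : ℝ) (1 / 2), ∀ t ∈ Icc (0 : ℝ) (1 / 2), chart A U V (s, t) ∈ K) :
    |cross U V| * ∫ s in (0 : ℝ)..(1 / 2), ‖∇ f (A + s • U)‖ ^ 2 ≤
      traceConst ℓ * ∫ x in K, ‖∇ f x‖ ^ 2 := by
  set G : Plane → ℝ := fun y => ‖∇ f y‖ ^ 2 with hG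
  have hGc : Continuous G := (continuous_gradient hf.smooth).norm.pow 2
  have hG0 : ∀ y, 0 ≤ G y := fun y => by positivity
  set R : Set (ℝ × ℝ) := Icc (0 : ℝ) (1 / 2) ×ˢ Icc (0 : ℝ) (1 / 2) with hR
  have hRc : IsCompact R := isCompact_Icc.prod isCompact_Icc
  have hcont : Continuous fun z => G (chart A U V z) := hGc.comp (by fun_prop)
  have h1 : ∫ s in (0 : ℝ)..(1 / 2), G (A + s • U) ≤ ∫ s in (0 : ℝ)..(1 / 2),
      traceConst ℓ * ∫ t in (0 : ℝ)..(1 / 2), G (chart A U V (s, t)) := by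
    refine intervalIntegral.integral_mono_on (by positivity)
      (Continuous.intervalIntegrable (by fun_prop) _ _)
      (Continuous.intervalIntegrable ?_ _ _) fun s _ => ?_
    · refine continuous_const.mul ?_
      exact intervalIntegral.continuous_parametric_intervalIntegral_of_continuous' (by fun_prop) _ _
    · exact hf.sq_norm_gradient_le_integral _ _
  rw [intervalIntegral.integral_const_mul] at h1
  have h2 : ∫ s in (0 : ℝ)..(1 / 2), ∫ t in (0 : ℝ)..(1 / 2), G (chart A U V (s, t)) =
      ∫ z in R, G (chart A U V z) := by
    rw [hR, Measure.volume_eq_prod, setIntegral_prod _ ?_]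
    · simp only [intervalIntegral.integral_of_le (show (0 : ℝ) ≤ 1 / 2 by norm_num),
        integral_Icc_eq_integral_Ioc]
    · rw [← Measure.volume_eq_prod]
      exact hcont.continuousOn.integrableOn_compact hRc
  have h3 : ∫ z in R, G (chart A U V z) ≤ ∫ z, K.indicator G (chart A U V z) := by
    rw [← integral_indicator hRc.measurableSet]
    have hle : ∀ z, R.indicator (fun z => G (chart A U V z)) z ≤
        K.indicator G (chart A U V z) := by
      rintro ⟨s, t⟩
      by_cases hz : (s, t) ∈ R
      · rw [indicator_of_mem hz, indicator_of_mem (hsub s hz.1 t hz.2)]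
      · rw [indicator_of_notMem hz]
        exact indicator_nonneg (fun _ _ => hG0 _) _
    have hKi : Integrable (K.indicator G) :=
      (integrable_indicator_iff hK.measurableSet).mpr (hGc.continuousOn.integrableOn_compact hK)
    refine integral_mono_of_nonneg (Filter.Eventually.of_forall fun z =>
      indicator_nonneg (fun _ _ => hG0 _) _) ?_ (Filter.Eventually.of_forall hle)
    exact integrable_chart hUV hKi
  have h4 := integral_chart A U V hUV (K.indicator G)
  rw [integral_indicator hK.measurableSet] at h4
  rw [h4]
  calc |cross U V| * ∫ s in (0 : ℝ)..(1 / 2), G (A + s • U)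
      ≤ |cross U V| * (traceConst ℓ * ∫ z, K.indicator G (chart A U V z)) :=
        mul_le_mul_of_nonneg_left (h1.trans (mul_le_mul_of_nonneg_left (h2.trans_le h3)
          (traceConst_pos ℓ).le)) (abs_nonneg _)
    _ = _ := by ring

namespace Triangulation

variable {D : Set Plane} (𝒯 : Triangulation D)

/-- A square of side `1 / 2` at a corner of the reference triangle reaches only half of the side, so
each end point serves its own half; this is the factor `2`. Shape regularity enters only in trading
the squared edge length for the area. -/
lemma edgeIntegral_sq_norm_gradient_le {κ : ℝ} (hκ : 𝒯.IsShapeRegular κ) {ℓ : ℕ} (e : 𝒯.Side)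
    {f : Plane → ℝ} (hf : IsPolyLike ℓ f) :
    𝒯.edgeLength e * 𝒯.edgeIntegral e (fun x => ‖∇ f x‖ ^ 2) ≤
      2 * traceConst ℓ * κ ^ 2 * ∫ x in 𝒯.elem e.1, ‖∇ f x‖ ^ 2 := by
  have hGc : Continuous fun y => ‖∇ f y‖ ^ 2 := (continuous_gradient hf.smooth).norm.pow 2
  set I := ∫ x in 𝒯.elem e.1, ‖∇ f x‖ ^ 2 with hI
  have hI0 : 0 ≤ I := integral_nonneg fun x => by positivity
  have h1 : 𝒯.jac e * ∫ s in (0 : ℝ)..(1 / 2), ‖∇ f (𝒯.sideChart e (s, 0))‖ ^ 2 ≤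
      traceConst ℓ * I := by
    have := hf.integral_segment_le (𝒯.cross_ne_zero e) (A := 𝒯.fst e) (𝒯.isCompact_elem e.1) ?_
    · simp only [sideChart_eq, zero_smul, add_zero]
      exact this
    · rintro s ⟨hs0, hs1⟩ t ⟨ht0, ht1⟩
      exact (𝒯.sideChart_mem_elem_iff e s t).mpr ⟨hs0, ht0, by linarith⟩
  -- The same argument from the other end point, with axes towards the two remaining vertices; the
  -- determinant only changes sign.
  have h2 : 𝒯.jac e * ∫ s in (1 / 2 : ℝ)..1, ‖∇ f (𝒯.sideChart e (s, 0))‖ ^ 2 ≤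
      traceConst ℓ * I := by
    have hc : cross (-𝒯.tan e) (𝒯.apx e - 𝒯.tan e) = -cross (𝒯.tan e) (𝒯.apx e) := by
      simp [cross]; ring
    have hp : ∀ s t : ℝ, chart (𝒯.snd e) (-𝒯.tan e) (𝒯.apx e - 𝒯.tan e) (s, t) =
        𝒯.sideChart e (1 - s - t, t) := by
      intro s t
      rw [sideChart_eq, chart]
      have : 𝒯.snd e = 𝒯.fst e + 𝒯.tan e := by simp [tan]
      rw [this]
      module
    have := hf.integral_segment_le (A := 𝒯.snd e) (U := -𝒯.tan e) (V := 𝒯.apx e - 𝒯.tan e)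
      (by rw [hc]; exact neg_ne_zero.mpr (𝒯.cross_ne_zero e)) (𝒯.isCompact_elem e.1) ?_
    · rw [hc, abs_neg] at this
      have hq : ∀ s : ℝ, 𝒯.snd e + s • -𝒯.tan e = 𝒯.sideChart e (1 - s, 0) := by
        intro s
        have := hp s 0
        simpa [chart] using this
      simp only [hq] at this
      have hsub := intervalIntegral.integral_comp_sub_left (a := 0) (b := 1 / 2)
        (fun s => ‖∇ f (𝒯.sideChart e (s, 0))‖ ^ 2) 1
      rw [hsub] at this
      norm_num at this ⊢
      exact this
    · rintro s ⟨hs0, hs1⟩ t ⟨ht0, ht1⟩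
      rw [hp, sideChart_mem_elem_iff]
      exact ⟨by linarith, ht0, by linarith⟩
  have hci : ∀ a b : ℝ, IntervalIntegrable
      (fun s => ‖∇ f (𝒯.sideChart e (s, 0))‖ ^ 2) volume a b := by
    intro a b
    refine Continuous.intervalIntegrable ?_ _ _
    simp only [sideChart_eq]
    exact hGc.comp (by fun_prop)
  have h3 := intervalIntegral.integral_add_adjacent_intervals (hci 0 (1 / 2)) (hci (1 / 2) 1)
  rw [edgeIntegral_eq]
  set X := ∫ s in (0 : ℝ)..1, ‖∇ f (𝒯.sideChart e (s, 0))‖ ^ 2 with hX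
  have hX0 : 0 ≤ X := intervalIntegral.integral_nonneg zero_le_one fun s _ => by positivity
  have h4 : 𝒯.jac e * X ≤ 2 * traceConst ℓ * I := by rw [← h3]; linarith
  calc 𝒯.edgeLength e * (𝒯.edgeLength e * X) = 𝒯.edgeLength e ^ 2 * X := by ring
    _ ≤ (κ ^ 2 * 𝒯.jac e) * X := mul_le_mul_of_nonneg_right (𝒯.sq_edgeLength_le hκ e) hX0
    _ = κ ^ 2 * (𝒯.jac e * X) := by ring
    _ ≤ κ ^ 2 * (2 * traceConst ℓ * I) := mul_le_mul_of_nonneg_left h4 (sq_nonneg _)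
    _ = _ := by ring

end Triangulation

/-! ### The divergence theorem on a triangle -/

/-- A smooth step from `0` on `(-∞, 1]` to `1` on `[2, ∞)`. -/
def step (y : ℝ) : ℝ := Real.smoothTransition (y - 1)

lemma contDiff_step : ContDiff ℝ ∞ step :=
  Real.smoothTransition.contDiff.comp (contDiff_id.sub contDiff_const)

lemma step_of_le {y : ℝ} (h : y ≤ 1) : step y = 0 :=
  Real.smoothTransition.zero_of_nonpos (by linarith)

lemma step_of_ge {y : ℝ} (h : 2 ≤ y) : step y = 1 :=
  Real.smoothTransition.one_of_one_le (by linarith)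

lemma step_nonneg (y : ℝ) : 0 ≤ step y := Real.smoothTransition.nonneg _

lemma step_le_one (y : ℝ) : step y ≤ 1 := Real.smoothTransition.le_one _

lemma continuous_deriv_step : Continuous (deriv step) := contDiff_step.continuous_deriv (by simp)

lemma hasDerivAt_step (y : ℝ) : HasDerivAt step (deriv step y) y :=
  (contDiff_step.differentiable (by simp) y).hasDerivAt

lemma deriv_step_of_le {y : ℝ} (h : y ≤ 1) : deriv step y = 0 := by
  have h1 : EqOn (deriv step) (fun _ => 0) (Iio 1) := fun z hz => by
    have : step =ᶠ[nhds z] fun _ => 0 := by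
      filter_upwards [Iio_mem_nhds hz] with w hw using step_of_le (le_of_lt hw)
    rw [this.deriv_eq, deriv_const]
  have h2 := h1.closure continuous_deriv_step continuous_const
  rw [closure_Iio] at h2
  exact h2 h

lemma deriv_step_of_ge {y : ℝ} (h : 2 ≤ y) : deriv step y = 0 := by
  have h1 : EqOn (deriv step) (fun _ => 0) (Ioi 2) := fun z hz => by
    have : step =ᶠ[nhds z] fun _ => 1 := by
      filter_upwards [Ioi_mem_nhds hz] with w hw using step_of_ge (le_of_lt hw)
    rw [this.deriv_eq, deriv_const]
  have h2 := h1.closure continuous_deriv_step continuous_const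
  rw [closure_Ioi] at h2
  exact h2 h

lemma integral_deriv_step : ∫ y, deriv step y = 1 := by
  have h0 : ∀ y ∉ Ioc (1 : ℝ) 2, deriv step y = 0 := by
    intro y hy
    rcases le_or_gt y 1 with h | h
    · exact deriv_step_of_le h
    · exact deriv_step_of_ge (le_of_lt (not_le.mp fun h2 => hy ⟨h, h2⟩))
  rw [← setIntegral_eq_integral_of_forall_compl_eq_zero h0,
    ← intervalIntegral.integral_of_le (by norm_num),
    intervalIntegral.integral_deriv_eq_sub
      (fun y _ => (hasDerivAt_step y).differentiableAt)
      (continuous_deriv_step.intervalIntegrable _ _), step_of_ge le_rfl, step_of_le le_rfl, sub_zero]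

lemma exists_abs_deriv_step_le : ∃ M : ℝ, ∀ y, |deriv step y| ≤ M := by
  obtain ⟨M, hM⟩ := isCompact_Icc.exists_bound_of_continuousOn (s := Icc (1 : ℝ) 2)
    continuous_deriv_step.continuousOn
  refine ⟨max M 0, fun y => ?_⟩
  by_cases hy : y ∈ Icc (1 : ℝ) 2
  · exact (hM y hy).trans (le_max_left _ _)
  · have : deriv step y = 0 := by
      rcases le_or_gt y 1 with h | h
      · exact deriv_step_of_le h
      · exact deriv_step_of_ge (le_of_lt (not_le.mp fun h2 => hy ⟨h.le, h2⟩))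
    rw [this, abs_zero]
    exact le_max_right _ _

lemma inner_gradient_right {f : Plane → ℝ} (x v : Plane) :
    inner ℝ v (∇ f x) = fderiv ℝ f x v := by
  rw [real_inner_comm, gradient, InnerProductSpace.toDual_symm_apply]

namespace Triangulation

variable {D : Set Plane} (𝒯 : Triangulation D)

/-- The barycentric coordinate of a triangle that belongs to the vertex opposite to a side. -/
def bary (e : 𝒯.Side) (x : Plane) : ℝ := (𝒯.affBasis e.1).coord e.2 x

lemma bary_eq (e : 𝒯.Side) (x : Plane) : 𝒯.bary e x =
    -(𝒯.edgeLength e / 𝒯.jac e) * inner ℝ (𝒯.normal e) (x - 𝒯.fst e) := 𝒯.coord_eq e x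

lemma contDiff_bary (e : 𝒯.Side) : ContDiff ℝ ∞ (𝒯.bary e) := by
  have : 𝒯.bary e = fun x =>
      -(𝒯.edgeLength e / 𝒯.jac e) * inner ℝ (𝒯.normal e) (x - 𝒯.fst e) := funext (𝒯.bary_eq e)
  rw [this]
  exact contDiff_const.mul (contDiff_const.inner ℝ (contDiff_id.sub contDiff_const))

lemma continuous_bary (e : 𝒯.Side) : Continuous (𝒯.bary e) := (𝒯.contDiff_bary e).continuous

lemma fderiv_bary (e : 𝒯.Side) (x v : Plane) : fderiv ℝ (𝒯.bary e) x v =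
    -(𝒯.edgeLength e / 𝒯.jac e) * inner ℝ (𝒯.normal e) v := by
  have : 𝒯.bary e = fun x => -(𝒯.edgeLength e / 𝒯.jac e) *
      (innerSL ℝ (𝒯.normal e)) (x - 𝒯.fst e) := funext (𝒯.bary_eq e)
  have h : HasFDerivAt (𝒯.bary e)
      (-(𝒯.edgeLength e / 𝒯.jac e) • (innerSL ℝ (𝒯.normal e))) x := by
    rw [this]
    exact (((innerSL ℝ (𝒯.normal e)).hasFDerivAt).comp x
      ((hasFDerivAt_id x).sub_const _)).const_mul _
  rw [h.fderiv]
  simp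

lemma interior_elem (K : Fin 𝒯.card) : interior (𝒯.elem K) = {x | ∀ i, 0 < 𝒯.bary (K, i) x} :=
  (𝒯.affBasis K).interior_convexHull

/-- The triangles cover the closure of `D` and may a priori meet its boundary in their interior, for
instance along a slit. The regularity `interior (closure D) = D` excludes this. -/
lemma interior_elem_subset (hD : interior (closure D) = D) (K : Fin 𝒯.card) :
    interior (𝒯.elem K) ⊆ D :=
  (interior_mono (𝒯.elem_subset_closure K)).trans hD.subset

lemma elem_ae_eq_interior (K : Fin 𝒯.card) :
    (interior (𝒯.elem K) : Set Plane) =ᵐ[volume] 𝒯.elem K :=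
  interior_ae_eq_of_null_frontier ((𝒯.convex_elem K).addHaar_frontier volume)

lemma ae_mem_interior (K : Fin 𝒯.card) :
    ∀ᵐ x ∂(volume.restrict (𝒯.elem K)), x ∈ interior (𝒯.elem K) := by
  rw [← Measure.restrict_congr_set (𝒯.elem_ae_eq_interior K)]
  exact ae_restrict_mem isOpen_interior.measurableSet

/-- A smooth cutoff function of a triangle that vanishes near its boundary. -/
def cutoff (K : Fin 𝒯.card) (δ : ℝ) (x : Plane) : ℝ := ∏ i, step (𝒯.bary (K, i) x / δ)

lemma contDiff_cutoff (K : Fin 𝒯.card) (δ : ℝ) : ContDiff ℝ ∞ (𝒯.cutoff K δ) := by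
  unfold cutoff
  exact contDiff_prod fun i _ => contDiff_step.comp ((𝒯.contDiff_bary (K, i)).div_const δ)

lemma fderiv_cutoff (K : Fin 𝒯.card) (δ : ℝ) (x v : Plane) :
    fderiv ℝ (𝒯.cutoff K δ) x v = ∑ i, (∏ j ∈ Finset.univ.erase i, step (𝒯.bary (K, j) x / δ)) *
      (deriv step (𝒯.bary (K, i) x / δ) * (δ⁻¹ *
        (-(𝒯.edgeLength (K, i) / 𝒯.jac (K, i)) * inner ℝ (𝒯.normal (K, i)) v))) := by
  have h : HasFDerivAt (𝒯.cutoff K δ)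
      (∑ i, (∏ j ∈ Finset.univ.erase i, step (𝒯.bary (K, j) x / δ)) •
        (deriv step (𝒯.bary (K, i) x / δ) • (δ⁻¹ • fderiv ℝ (𝒯.bary (K, i)) x))) x := by
    unfold cutoff
    refine HasFDerivAt.finsetProd fun i _ => ?_
    refine (hasDerivAt_step _).comp_hasFDerivAt x ?_
    have := ((𝒯.contDiff_bary (K, i)).differentiable (by simp) x).hasFDerivAt.const_mul δ⁻¹
    simpa only [div_eq_inv_mul] using this
  rw [h.fderiv]
  simp [fderiv_bary]

lemma cutoff_nonneg (K : Fin 𝒯.card) (δ : ℝ) (x : Plane) : 0 ≤ 𝒯.cutoff K δ x :=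
  Finset.prod_nonneg fun _ _ => step_nonneg _

lemma cutoff_le_one (K : Fin 𝒯.card) (δ : ℝ) (x : Plane) : 𝒯.cutoff K δ x ≤ 1 :=
  Finset.prod_le_one (fun _ _ => step_nonneg _) fun _ _ => step_le_one _

lemma tsupport_cutoff_subset (K : Fin 𝒯.card) {δ : ℝ} (hδ : 0 < δ) :
    tsupport (𝒯.cutoff K δ) ⊆ {x | ∀ i, δ ≤ 𝒯.bary (K, i) x} := by
  refine closure_minimal (fun x hx i => ?_) ?_
  · by_contra! h
    apply hx
    exact Finset.prod_eq_zero (Finset.mem_univ i) (step_of_le ((div_le_one hδ).mpr h.le))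
  · simp only [ofPred_forall]
    exact isClosed_iInter fun i => isClosed_le continuous_const (𝒯.continuous_bary _)

/-- The product of `w` and the cutoff has compact support inside the triangle, hence is an
admissible test function for the distributional divergence. The product rule separates the bulk term
from one layer term for each side. -/
lemma integral_inner_gradient_mul_cutoff (hD : interior (closure D) = D) {β : Plane → Plane}
    (hdiv : IsDivFree D β) {w : Plane → ℝ} (hw : ContDiff ℝ ∞ w) (K : Fin 𝒯.card) {δ : ℝ}
    (hδ : 0 < δ) :
    ∫ x in 𝒯.elem K, (𝒯.cutoff K δ x * inner ℝ (β x) (∇ w x) +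
      ∑ i, (∏ j ∈ Finset.univ.erase i, step (𝒯.bary (K, j) x / δ)) *
        (deriv step (𝒯.bary (K, i) x / δ) * (δ⁻¹ *
          (-(𝒯.edgeLength (K, i) / 𝒯.jac (K, i)) *
            (inner ℝ (β x) (𝒯.normal (K, i)) * w x))))) = 0 := by
  set φ : Plane → ℝ := fun x => w x * 𝒯.cutoff K δ x with hφ
  have hφs : ContDiff ℝ ∞ φ := hw.mul (𝒯.contDiff_cutoff K δ)
  have hsub : tsupport φ ⊆ {x | ∀ i, δ ≤ 𝒯.bary (K, i) x} :=
    (tsupport_mul_subset_right).trans (𝒯.tsupport_cutoff_subset K hδ)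
  have hK : tsupport φ ⊆ interior (𝒯.elem K) := by
    rw [interior_elem]
    exact hsub.trans fun x hx i => hδ.trans_le (hx i)
  have hc : HasCompactSupport φ :=
    (𝒯.isCompact_elem K).of_isClosed_subset (isClosed_tsupport φ) (hK.trans interior_subset)
  have hDφ : tsupport φ ⊆ D := hK.trans (𝒯.interior_elem_subset hD K)
  have h0 := hdiv φ hφs hc hDφ
  have hz : ∀ x ∉ tsupport φ, inner ℝ (β x) (∇ φ x) = 0 := by
    intro x hx
    have : fderiv ℝ φ x = 0 := by
      by_contra h
      exact hx (support_fderiv_subset ℝ h)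
    rw [inner_gradient_right, this, zero_apply]
  -- The integrand vanishes off the support of the test function, which lies both in `D` and in the
  -- triangle, so the domain of integration may be exchanged.
  rw [setIntegral_eq_integral_of_forall_compl_eq_zero fun x hx => hz x fun h => hx (hDφ h)] at h0
  rw [← h0, ← setIntegral_eq_integral_of_forall_compl_eq_zero (s := 𝒯.elem K)
    fun x hx => hz x fun h => hx (interior_subset (hK h))]
  congr 1
  ext x
  have hd : HasFDerivAt φ (w x • fderiv ℝ (𝒯.cutoff K δ) x + 𝒯.cutoff K δ x • fderiv ℝ w x) x :=
    (hw.differentiable (by simp) x).hasFDerivAt.mul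
      ((𝒯.contDiff_cutoff K δ).differentiable (by simp) x).hasFDerivAt
  rw [inner_gradient_right, inner_gradient_right, hd.fderiv]
  simp only [add_apply, smul_apply, smul_eq_mul]
  rw [fderiv_cutoff, Finset.mul_sum, add_comm]
  congr 1
  refine Finset.sum_congr rfl fun i _ => ?_
  rw [real_inner_comm (β x)]
  ring

/-- At an interior point the cutoff equals `1` once `δ` is small, and the boundary of the triangle
is a null set. -/
lemma tendsto_integral_cutoff_mul (K : Fin 𝒯.card) {g : Plane → ℝ}
    (hg : IntegrableOn g (𝒯.elem K)) :
    Filter.Tendsto (fun δ => ∫ x in 𝒯.elem K, 𝒯.cutoff K δ x * g x) (nhdsWithin 0 (Ioi 0))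
      (nhds (∫ x in 𝒯.elem K, g x)) := by
  refine tendsto_integral_filter_of_dominated_convergence (fun x => ‖g x‖) ?_ ?_ hg.norm ?_
  · refine Filter.Eventually.of_forall fun δ => ?_
    exact (𝒯.contDiff_cutoff K δ).continuous.aestronglyMeasurable.mul hg.aestronglyMeasurable
  · refine Filter.Eventually.of_forall fun δ => Filter.Eventually.of_forall fun x => ?_
    rw [norm_mul, Real.norm_of_nonneg (𝒯.cutoff_nonneg K δ x)]
    exact mul_le_of_le_one_left (norm_nonneg _) (𝒯.cutoff_le_one K δ x)
  · filter_upwards [𝒯.ae_mem_interior K] with x hx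
    rw [interior_elem] at hx
    refine tendsto_const_nhds.congr' ?_
    have h1 : ∀ i, ∀ᶠ δ in nhdsWithin (0 : ℝ) (Ioi 0), step (𝒯.bary (K, i) x / δ) = 1 := by
      intro i
      have hpos : 0 < 𝒯.bary (K, i) x / 2 := half_pos (hx i)
      filter_upwards [Ioo_mem_nhdsGT hpos] with δ hδ
      refine step_of_ge ?_
      rw [le_div_iff₀ hδ.1]
      linarith [hδ.2]
    filter_upwards [Filter.eventually_all.mpr h1] with δ hδ
    simp [cutoff, hδ]

lemma prod_step_erase (K : Fin 𝒯.card) (i : Fin 3) (δ : ℝ) (s t : ℝ) :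
    (∏ j ∈ Finset.univ.erase i, step (𝒯.bary (K, j) (𝒯.sideChart (K, i) (s, t)) / δ)) =
      step (s / δ) * step ((1 - s - t) / δ) := by
  have h : Finset.univ.erase i = {i + 2, i + 1} := by
    fin_cases i <;> decide
  obtain ⟨-, h2, h1⟩ := 𝒯.coord_sideChart (K, i) s t
  rw [h, Finset.prod_pair (by fin_cases i <;> decide)]
  congr 3

/-- The derivative of the step lives in a layer of width proportional to `δ` along the side.
Stretching the transversal coordinate by `δ` absorbs the factor `δ⁻¹`; in the limit `q` is evaluated
on the side and the transversal profile `deriv step` has integral `1`. -/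
lemma tendsto_integral_side (K : Fin 𝒯.card) (i : Fin 3) {q : Plane → ℝ} (hq : Measurable q)
    (hqc : ContinuousOn q (𝒯.elem K)) :
    Filter.Tendsto (fun δ => ∫ x in 𝒯.elem K,
        (∏ j ∈ Finset.univ.erase i, step (𝒯.bary (K, j) x / δ)) *
          (deriv step (𝒯.bary (K, i) x / δ) * (δ⁻¹ * q x))) (nhdsWithin 0 (Ioi 0))
      (nhds (𝒯.jac (K, i) * ∫ s in (0 : ℝ)..1, q (𝒯.sideChart (K, i) (s, 0)))) := by
  set e : 𝒯.Side := (K, i) with he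
  let P : ℝ → ℝ × ℝ → Plane := fun δ z => 𝒯.sideChart e (z.1, δ * z.2)
  let F : ℝ → ℝ × ℝ → ℝ := fun δ z => (𝒯.elem K).indicator q (P δ z) *
    (deriv step z.2 * (step (z.1 / δ) * step ((1 - z.1 - δ * z.2) / δ)))
  have hF : ∀ δ ∈ Ioi (0 : ℝ), 𝒯.jac e * ∫ z, F δ z = ∫ x in 𝒯.elem K,
      (∏ j ∈ Finset.univ.erase i, step (𝒯.bary (K, j) x / δ)) *
          (deriv step (𝒯.bary (K, i) x / δ) * (δ⁻¹ * q x)) := by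
    intro δ hδ
    have hδ' : (δ : ℝ) ≠ 0 := ne_of_gt hδ
    -- Putting `δ` into the second axis of the chart makes the stretching part of the Jacobian.
    have hc : cross (𝒯.tan e) (δ • 𝒯.apx e) = δ * cross (𝒯.tan e) (𝒯.apx e) := by
      simp [cross]; ring
    have hP : ∀ z, chart (𝒯.fst e) (𝒯.tan e) (δ • 𝒯.apx e) z = P δ z := by
      intro z
      simp only [P, chart, sideChart, smul_smul, mul_comm]
    rw [← integral_indicator (𝒯.measurableSet_elem K),
      integral_chart (𝒯.fst e) (𝒯.tan e) (δ • 𝒯.apx e)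
        (by rw [hc]; exact mul_ne_zero hδ' (𝒯.cross_ne_zero e)),
      hc, abs_mul, abs_of_pos hδ, mul_comm δ, mul_assoc, ← integral_const_mul δ]
    rw [jac]
    congr 2
    ext z
    rw [hP]
    by_cases hz : P δ z ∈ 𝒯.elem K
    · have hb : 𝒯.bary (K, i) (P δ z) = δ * z.2 := (𝒯.coord_sideChart e z.1 (δ * z.2)).1
      have hp := 𝒯.prod_step_erase K i δ z.1 (δ * z.2)
      simp only [F]
      rw [indicator_of_mem hz, indicator_of_mem hz, hb, hp, mul_div_cancel_left₀ _ hδ']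
      field_simp
    · simp only [F]
      rw [indicator_of_notMem hz, indicator_of_notMem hz, zero_mul, mul_zero]
  -- The end points of the side are left out: for `z.1` outside the open interval the two remaining
  -- step factors vanish in the relevant range `1 < z.2`.
  let F0 : ℝ × ℝ → ℝ := fun z =>
    (Ioo (0 : ℝ) 1).indicator (fun s => q (𝒯.sideChart e (s, 0))) z.1 * deriv step z.2
  have hF0 : 𝒯.jac e * ∫ z, F0 z = 𝒯.jac e * ∫ s in (0 : ℝ)..1, q (𝒯.sideChart e (s, 0)) := by
    congr 1
    simp only [F0]
    rw [Measure.volume_eq_prod, integral_prod_mul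
      (f := (Ioo (0 : ℝ) 1).indicator (fun s => q (𝒯.sideChart e (s, 0)))) (g := deriv step),
      integral_deriv_step, mul_one, integral_indicator measurableSet_Ioo,
      intervalIntegral.integral_of_le zero_le_one, integral_Ioc_eq_integral_Ioo]
  rw [← hF0]
  refine Filter.Tendsto.congr' (eventually_nhdsWithin_of_forall hF)
    (Filter.Tendsto.const_mul _ ?_)
  obtain ⟨M, hM⟩ := (𝒯.isCompact_elem K).exists_bound_of_continuousOn hqc
  obtain ⟨M', hM'⟩ := exists_abs_deriv_step_le
  have hM0 : 0 ≤ M := (norm_nonneg _).trans (hM _ (𝒯.vert_mem_elem K 0))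
  have hM'0 : 0 ≤ M' := (abs_nonneg _).trans (hM' 0)
  -- The profile is supported in `1 ≤ z.2 ≤ 2` and the triangle confines `z.1` to `[0, 1]`, so one
  -- rectangle carries the majorant for all `δ`.
  set R : Set (ℝ × ℝ) := Icc (0 : ℝ) 1 ×ˢ Icc (1 : ℝ) 2 with hR
  have hRc : IsCompact R := isCompact_Icc.prod isCompact_Icc
  have hmem : ∀ δ z, P δ z ∈ 𝒯.elem K ↔ 0 ≤ z.1 ∧ 0 ≤ δ * z.2 ∧ z.1 + δ * z.2 ≤ 1 :=
    fun δ z => 𝒯.sideChart_mem_elem_iff e z.1 (δ * z.2)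
  refine tendsto_integral_filter_of_dominated_convergence
    (R.indicator fun _ => M * M') ?_ ?_ ?_ ?_
  · refine Filter.Eventually.of_forall fun δ => Measurable.aestronglyMeasurable ?_
    have h1 : Measurable fun z => (𝒯.elem K).indicator q (P δ z) := by
      refine (hq.indicator (𝒯.measurableSet_elem K)).comp (Continuous.measurable ?_)
      exact (continuous_chart _ _ _).comp (by fun_prop)
    have h2 := continuous_deriv_step
    have h3 := contDiff_step.continuous
    exact h1.mul (Continuous.measurable (by fun_prop))
  · refine eventually_nhdsWithin_of_forall fun δ hδ => Filter.Eventually.of_forall fun z => ?_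
    by_cases hz : P δ z ∈ 𝒯.elem K
    swap
    · simp only [F]
      rw [indicator_of_notMem hz, zero_mul, norm_zero]
      exact indicator_nonneg (fun _ _ => by positivity) _
    by_cases hz2 : z.2 ∈ Icc (1 : ℝ) 2
    swap
    · have : deriv step z.2 = 0 := by
        rcases le_or_gt z.2 1 with h | h
        · exact deriv_step_of_le h
        · exact deriv_step_of_ge (le_of_lt (not_le.mp fun h2 => hz2 ⟨h.le, h2⟩))
      simp only [F]
      rw [this, zero_mul, mul_zero, norm_zero]
      exact indicator_nonneg (fun _ _ => by positivity) _
    have hz' := (hmem δ z).mp hz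
    have hzR : z ∈ R := ⟨⟨hz'.1, by linarith [hz'.2.1, hz'.2.2]⟩, hz2⟩
    simp only [F]
    rw [indicator_of_mem hz, indicator_of_mem hzR, norm_mul, norm_mul]
    refine mul_le_mul (hM _ hz) ?_ (by positivity) hM0
    refine (mul_le_of_le_one_right (norm_nonneg _) ?_).trans (hM' z.2)
    rw [norm_mul, Real.norm_of_nonneg (step_nonneg _), Real.norm_of_nonneg (step_nonneg _)]
    exact mul_le_one₀ (step_le_one _) (step_nonneg _) (step_le_one _)
  · refine (integrable_indicator_iff hRc.measurableSet).mpr (integrableOn_const ?_)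
    exact hRc.measure_lt_top.ne
  · refine Filter.Eventually.of_forall fun z => ?_
    rcases le_or_gt z.2 1 with hz2 | hz2
    · have hd := deriv_step_of_le hz2
      simp only [F, F0, hd, zero_mul, mul_zero]
      exact tendsto_const_nhds
    by_cases hz1 : z.1 ∈ Ioo (0 : ℝ) 1
    swap
    · refine tendsto_const_nhds.congr' ?_
      refine eventually_nhdsWithin_of_forall fun δ hδ => ?_
      have hδ' : (0 : ℝ) < δ := hδ
      have : step (z.1 / δ) * step ((1 - z.1 - δ * z.2) / δ) = 0 := by
        rcases le_or_gt z.1 0 with h | h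
        · rw [step_of_le ((div_nonpos_of_nonpos_of_nonneg h hδ'.le).trans zero_le_one), zero_mul]
        · have h1 : 1 ≤ z.1 := not_lt.mp fun h2 => hz1 ⟨h, h2⟩
          have h2 : 1 - z.1 - δ * z.2 ≤ 0 := by
            have := mul_pos hδ' (zero_lt_one.trans hz2)
            linarith
          rw [step_of_le ((div_nonpos_of_nonpos_of_nonneg h2 hδ'.le).trans zero_le_one), mul_zero]
      simp only [F, F0]
      rw [this, mul_zero, mul_zero, indicator_of_notMem hz1, zero_mul]
    · have hz20 : 0 < z.2 := zero_lt_one.trans hz2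
      have hev : ∀ᶠ δ in nhdsWithin (0 : ℝ) (Ioi 0), q (P δ z) * deriv step z.2 = F δ z ∧
          P δ z ∈ 𝒯.elem K := by
        -- These two thresholds ensure `2 * δ ≤ z.1` and `2 * δ ≤ 1 - z.1 - δ * z.2`, where both
        -- steps have reached the value `1`.
        have h1 : 0 < z.1 / 2 := half_pos hz1.1
        have h2 : 0 < (1 - z.1) / (2 + z.2) := div_pos (by linarith [hz1.2]) (by linarith)
        filter_upwards [Ioo_mem_nhdsGT h1, Ioo_mem_nhdsGT h2] with δ hδ1 hδ2
        have hδ := hδ1.1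
        have h4 : δ * (2 + z.2) < 1 - z.1 := (lt_div_iff₀ (by linarith)).mp hδ2.2
        have h5 : 0 < δ * z.2 := mul_pos hδ hz20
        have hin : P δ z ∈ 𝒯.elem K := (hmem δ z).mpr ⟨hz1.1.le, h5.le, by nlinarith⟩
        refine ⟨?_, hin⟩
        have s1 : step (z.1 / δ) = 1 := step_of_ge (by rw [le_div_iff₀ hδ]; linarith [hδ1.2])
        have s2 : step ((1 - z.1 - δ * z.2) / δ) = 1 :=
          step_of_ge (by rw [le_div_iff₀ hδ]; linarith)
        simp only [F]
        rw [indicator_of_mem hin, s1, s2, mul_one, mul_one]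
      refine Filter.Tendsto.congr' (hev.mono fun δ h => h.1) ?_
      simp only [F0]
      rw [indicator_of_mem hz1]
      refine Filter.Tendsto.mul_const _ ?_
      have hmem0 : 𝒯.sideChart e (z.1, 0) ∈ 𝒯.elem K :=
        (𝒯.sideChart_mem_elem_iff e z.1 0).mpr ⟨hz1.1.le, le_rfl, by linarith [hz1.2]⟩
      -- Since `q` is continuous only relative to the triangle, the approximating points must be
      -- known to lie in it; the second half of `hev` records this.
      refine (hqc _ hmem0).tendsto.comp (tendsto_nhdsWithin_iff.mpr ⟨?_, hev.mono fun δ h => h.2⟩)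
      have hc : Continuous fun δ => P δ z := (continuous_chart _ _ _).comp (by fun_prop)
      have := hc.tendsto 0
      simp only [P, zero_mul] at this
      exact this.mono_left nhdsWithin_le_nhds

/-- The divergence theorem on a triangle, for a continuous field whose divergence vanishes in the
sense of distributions. -/
lemma integral_inner_gradient (hD : interior (closure D) = D) {β : Plane → Plane}
    (hβm : Measurable β) (hβc : ContinuousOn β (closure D))
    (hdiv : IsDivFree D β) {w : Plane → ℝ} (hw : ContDiff ℝ ∞ w) (K : Fin 𝒯.card) :
    ∫ x in 𝒯.elem K, inner ℝ (β x) (∇ w x) =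
      ∑ i, 𝒯.edgeIntegral (K, i) fun x => inner ℝ (β x) (𝒯.normal (K, i)) * w x := by
  have hβK : ContinuousOn β (𝒯.elem K) := hβc.mono (𝒯.elem_subset_closure K)
  have hg : IntegrableOn (fun x => inner ℝ (β x) (∇ w x)) (𝒯.elem K) :=
    (hβK.inner (continuous_gradient hw).continuousOn).integrableOn_compact (𝒯.isCompact_elem K)
  set c : Fin 3 → ℝ := fun i => -(𝒯.edgeLength (K, i) / 𝒯.jac (K, i)) with hc
  set q : Fin 3 → Plane → ℝ := fun i x => c i * (inner ℝ (β x) (𝒯.normal (K, i)) * w x) with hqdef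
  have hqm : ∀ i, Measurable (q i) := fun i =>
    ((hβm.inner_const).mul hw.continuous.measurable).const_mul _
  have hqc : ∀ i, ContinuousOn (q i) (𝒯.elem K) := fun i =>
    ((hβK.inner continuousOn_const).mul hw.continuous.continuousOn).const_smul (c i)
  have h1 := (𝒯.tendsto_integral_cutoff_mul K hg).add
    (tendsto_finsetSum Finset.univ fun i _ => 𝒯.tendsto_integral_side K i (hqm i) (hqc i))
  -- Bulk and layer terms add up to zero for every positive `δ`, hence so do their limits.
  have h2 : ∀ δ ∈ Ioi (0 : ℝ), (0 : ℝ) =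
      (∫ x in 𝒯.elem K, 𝒯.cutoff K δ x * inner ℝ (β x) (∇ w x)) +
      ∑ i, ∫ x in 𝒯.elem K, (∏ j ∈ Finset.univ.erase i, step (𝒯.bary (K, j) x / δ)) *
          (deriv step (𝒯.bary (K, i) x / δ) * (δ⁻¹ * q i x)) := by
    intro δ hδ
    have hcont : ∀ i, ContinuousOn (fun x =>
        (∏ j ∈ Finset.univ.erase i, step (𝒯.bary (K, j) x / δ)) *
          (deriv step (𝒯.bary (K, i) x / δ) * (δ⁻¹ * q i x))) (𝒯.elem K) := by
      intro i
      have h3 := contDiff_step.continuous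
      have h4 := continuous_deriv_step
      have h5 := fun j => 𝒯.continuous_bary (K, j)
      refine ContinuousOn.mul (Continuous.continuousOn ?_)
        (ContinuousOn.mul (Continuous.continuousOn ?_) (continuousOn_const.mul (hqc i)))
      · exact continuous_finsetProd _ fun j _ => h3.comp ((h5 j).div_const δ)
      · exact h4.comp ((h5 i).div_const δ)
    rw [← integral_finsetSum _ fun i _ => (hcont i).integrableOn_compact (𝒯.isCompact_elem K),
      ← integral_add, 𝒯.integral_inner_gradient_mul_cutoff hD hdiv hw K hδ]
    · exact ((𝒯.contDiff_cutoff K δ).continuous.continuousOn.mul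
        (hβK.inner (continuous_gradient hw).continuousOn)).integrableOn_compact
          (𝒯.isCompact_elem K)
    · exact integrable_finsetSum _ fun i _ =>
        (hcont i).integrableOn_compact (𝒯.isCompact_elem K)
  have h3 := tendsto_nhds_unique (h1.congr' (eventually_nhdsWithin_of_forall
    fun δ hδ => (h2 δ hδ).symm)) tendsto_const_nhds
  rw [eq_neg_of_add_eq_zero_left h3, ← Finset.sum_neg_distrib]
  refine Finset.sum_congr rfl fun i _ => ?_
  rw [edgeIntegral_eq]
  simp only [hqdef, hc]
  rw [intervalIntegral.integral_const_mul]
  have := (𝒯.jac_pos (K, i)).ne'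
  field_simp

/-! ### Adjacent triangles -/

lemma mem_adjacentSides {e e' : 𝒯.Side} : (e, e') ∈ 𝒯.adjacentSides ↔
    e.1 ≠ e'.1 ∧ ({𝒯.fst e, 𝒯.snd e} : Set Plane) = {𝒯.fst e', 𝒯.snd e'} := by
  simp [adjacentSides]

lemma swap_mem_adjacentSides {e e' : 𝒯.Side} (h : (e, e') ∈ 𝒯.adjacentSides) :
    (e', e) ∈ 𝒯.adjacentSides := by
  rw [mem_adjacentSides] at h ⊢
  exact ⟨h.1.symm, h.2.symm⟩

lemma vert_injective (K : Fin 𝒯.card) : Function.Injective (𝒯.vert K) :=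
  (𝒯.affineIndependent K).injective

lemma range_vert (e : 𝒯.Side) :
    range (𝒯.vert e.1) = {𝒯.fst e, 𝒯.snd e, 𝒯.vert e.1 e.2} := by
  obtain ⟨K, i⟩ := e
  ext x
  simp only [mem_range, mem_insert_iff, mem_singleton_iff, fst, snd]
  constructor
  · rintro ⟨j, rfl⟩
    have : j = i + 1 ∨ j = i + 2 ∨ j = i := by
      fin_cases i <;> fin_cases j <;> decide
    rcases this with h | h | h <;> simp [h]
  · rintro (h | h | h)
    · exact ⟨_, h.symm⟩
    · exact ⟨_, h.symm⟩
    · exact ⟨_, h.symm⟩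

lemma endpoints_eq {e e' : 𝒯.Side}
    (h : ({𝒯.fst e, 𝒯.snd e} : Set Plane) = {𝒯.fst e', 𝒯.snd e'}) :
    (𝒯.fst e = 𝒯.fst e' ∧ 𝒯.snd e = 𝒯.snd e') ∨ (𝒯.fst e = 𝒯.snd e' ∧ 𝒯.snd e = 𝒯.fst e') :=
  pair_eq_pair_iff.mp h

lemma edge_eq_of_adjacent {e e' : 𝒯.Side} (h : (e, e') ∈ 𝒯.adjacentSides) :
    𝒯.edge e = 𝒯.edge e' := by
  rcases 𝒯.endpoints_eq (𝒯.mem_adjacentSides.mp h).2 with ⟨h1, h2⟩ | ⟨h1, h2⟩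
  · rw [edge, edge, h1, h2]
  · rw [edge, edge, h1, h2, segment_symm]

lemma edgeLength_eq_of_adjacent {e e' : 𝒯.Side} (h : (e, e') ∈ 𝒯.adjacentSides) :
    𝒯.edgeLength e = 𝒯.edgeLength e' := by
  rcases 𝒯.endpoints_eq (𝒯.mem_adjacentSides.mp h).2 with ⟨h1, h2⟩ | ⟨h1, h2⟩
  · rw [edgeLength, edgeLength, h1, h2]
  · rw [edgeLength, edgeLength, h1, h2, dist_comm]

/-- At the midpoint two barycentric coordinates equal `1 / 2` and stay positive under small
displacements, while the third increases from zero against the outward normal. -/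
lemma eventually_sub_normal_mem_elem (e : 𝒯.Side) :
    ∀ᶠ ε in nhdsWithin (0 : ℝ) (Ioi 0),
      𝒯.sideChart e (1 / 2, 0) - ε • 𝒯.normal e ∈ 𝒯.elem e.1 := by
  obtain ⟨h0, h2, h1⟩ := 𝒯.coord_sideChart e (1 / 2) 0
  have hcont : ∀ j, Continuous fun ε : ℝ =>
      𝒯.bary (e.1, j) (𝒯.sideChart e (1 / 2, 0) - ε • 𝒯.normal e) :=
    fun j => (𝒯.continuous_bary _).comp (by fun_prop)
  have hev : ∀ j, 0 < 𝒯.bary (e.1, j) (𝒯.sideChart e (1 / 2, 0)) →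
      ∀ᶠ ε in nhdsWithin (0 : ℝ) (Ioi 0),
        0 ≤ 𝒯.bary (e.1, j) (𝒯.sideChart e (1 / 2, 0) - ε • 𝒯.normal e) := by
    intro j hj
    have := (hcont j).tendsto 0
    simp only [zero_smul, sub_zero] at this
    exact ((this.mono_left nhdsWithin_le_nhds).eventually (lt_mem_nhds hj)).mono fun _ h => h.le
  have e1 := hev (e.2 + 1) (by rw [bary, h1]; norm_num)
  have e2 := hev (e.2 + 2) (by rw [bary, h2]; norm_num)
  filter_upwards [e1, e2, self_mem_nhdsWithin] with ε k1 k2 hε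
  have hε' : (0 : ℝ) < ε := hε
  rw [mem_elem_iff]
  intro i
  have : i = e.2 ∨ i = e.2 + 1 ∨ i = e.2 + 2 := by
    generalize e.2 = k
    fin_cases k <;> fin_cases i <;> decide
  rcases this with rfl | rfl | rfl
  · rw [coord_eq]
    have : 𝒯.sideChart e (1 / 2, 0) - ε • 𝒯.normal e - 𝒯.fst e =
        (1 / 2 : ℝ) • 𝒯.tan e - ε • 𝒯.normal e := by
      rw [sideChart_eq, zero_smul]; abel
    rw [this, inner_sub_right, real_inner_smul_right, real_inner_smul_right, inner_normal_tan,
      real_inner_self_eq_norm_sq, norm_normal]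
    have := 𝒯.jac_pos e
    have := 𝒯.edgeLength_pos e
    have : 0 ≤ 𝒯.edgeLength e / 𝒯.jac e * ε := by positivity
    linarith
  · exact k1
  · exact k2

/-- Both normals are unit multiples of the same edge vector turned by a right angle. -/
lemma normal_eq_or_neg {e e' : 𝒯.Side}
    (h : ({𝒯.fst e, 𝒯.snd e} : Set Plane) = {𝒯.fst e', 𝒯.snd e'}) :
    𝒯.normal e' = 𝒯.normal e ∨ 𝒯.normal e' = -𝒯.normal e := by
  have hr : ∃ r : ℝ, 𝒯.normal e' = r • 𝒯.normal e := by
    obtain ⟨s, hs⟩ : ∃ s : ℝ, turn (𝒯.tan e') = s • turn (𝒯.tan e) := by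
      rcases 𝒯.endpoints_eq h with ⟨h1, h2⟩ | ⟨h1, h2⟩
      · exact ⟨1, by rw [tan, tan, h1, h2, one_smul]⟩
      · refine ⟨-1, ?_⟩
        rw [tan, tan, h1, h2]
        ext k
        fin_cases k <;> simp [turn]
    rw [normal_eq, normal_eq, hs]
    set c := Real.sign (cross (𝒯.tan e) (𝒯.apx e)) * (𝒯.edgeLength e)⁻¹ with hc
    have hc0 : c ≠ 0 := by
      refine mul_ne_zero ?_ (inv_ne_zero (𝒯.edgeLength_pos e).ne')
      exact abs_ne_zero.mp (by rw [abs_sign (𝒯.cross_ne_zero e)]; exact one_ne_zero)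
    refine ⟨Real.sign (cross (𝒯.tan e') (𝒯.apx e')) * (𝒯.edgeLength e')⁻¹ * s * c⁻¹, ?_⟩
    rw [smul_smul, smul_smul, inv_mul_cancel_right₀ hc0]
  obtain ⟨r, hr⟩ := hr
  have h1 := congrArg norm hr
  rw [norm_smul, norm_normal, norm_normal, mul_one, Real.norm_eq_abs] at h1
  rcases (abs_eq zero_le_one).mp h1.symm with h2 | h2
  · left; rw [hr, h2, one_smul]
  · right; rw [hr, h2, neg_one_smul]

/-- If the normals agreed, both triangles would lie on the same side of the edge and share a point
slightly off its midpoint. By conformity this point belongs to the convex hull of the common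
vertices, which is the edge itself, although it is off the line through that edge. -/
lemma normal_neg_of_adjacent {e e' : 𝒯.Side} (h : (e, e') ∈ 𝒯.adjacentSides) :
    𝒯.normal e' = -𝒯.normal e := by
  obtain ⟨hne, hset⟩ := 𝒯.mem_adjacentSides.mp h
  refine (𝒯.normal_eq_or_neg hset).resolve_left fun hn => ?_
  have hmid : 𝒯.sideChart e' (1 / 2, 0) = 𝒯.sideChart e (1 / 2, 0) := by
    simp only [sideChart_eq, tan, zero_smul]
    rcases 𝒯.endpoints_eq hset with ⟨h1, h2⟩ | ⟨h1, h2⟩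
    · rw [h1, h2]
    · rw [h1, h2]; module
  have hev := 𝒯.eventually_sub_normal_mem_elem e'
  rw [hmid, hn] at hev
  obtain ⟨ε, ⟨hx, hx'⟩, hε⟩ :=
    (((𝒯.eventually_sub_normal_mem_elem e).and hev).and self_mem_nhdsWithin).exists
  set x := 𝒯.sideChart e (1 / 2, 0) - ε • 𝒯.normal e with hxdef
  have hinter : x ∈ convexHull ℝ (range (𝒯.vert e.1) ∩ range (𝒯.vert e'.1)) := by
    rw [← 𝒯.conforming _ _ hne]
    exact ⟨hx, hx'⟩
  -- A common vertex off the edge would be opposite to it in both triangles, which would then have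
  -- the same vertices and coincide.
  have hsub : range (𝒯.vert e.1) ∩ range (𝒯.vert e'.1) ⊆ {𝒯.fst e, 𝒯.snd e} := by
    rintro y ⟨hy, hy'⟩
    rw [range_vert] at hy hy'
    rcases hy with hy | hy | hy
    · exact Or.inl hy
    · exact Or.inr hy
    · by_contra hcon
      have hy2 : y = 𝒯.vert e'.1 e'.2 := by
        rcases hy' with h' | h' | h'
        · exact absurd (hset ▸ Or.inl h' : y ∈ ({𝒯.fst e, 𝒯.snd e} : Set Plane)) hcon
        · exact absurd (hset ▸ Or.inr h' : y ∈ ({𝒯.fst e, 𝒯.snd e} : Set Plane)) hcon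
        · exact h'
      refine hne (𝒯.distinct _ _ ?_)
      have hy1 : y = 𝒯.vert e.1 e.2 := hy
      rw [range_vert, range_vert, ← hy1, ← hy2]
      ext z
      have := Set.ext_iff.mp hset z
      simp only [mem_insert_iff, mem_singleton_iff] at this ⊢
      tauto
  have hseg : x ∈ segment ℝ (𝒯.fst e) (𝒯.snd e) := by
    rw [← convexHull_pair]
    exact convexHull_mono hsub hinter
  rw [segment_eq_image'] at hseg
  obtain ⟨θ, -, hθ⟩ := hseg
  have h1 : inner ℝ (𝒯.normal e) (x - 𝒯.fst e) = 0 := by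
    have : x - 𝒯.fst e = θ • 𝒯.tan e := by rw [← hθ, tan]; simp
    rw [this, real_inner_smul_right, inner_normal_tan, mul_zero]
  have h2 : x - 𝒯.fst e = (1 / 2 : ℝ) • 𝒯.tan e - ε • 𝒯.normal e := by
    rw [hxdef, sideChart_eq, zero_smul]; abel
  rw [h2, inner_sub_right, real_inner_smul_right, real_inner_smul_right, inner_normal_tan,
    real_inner_self_eq_norm_sq, norm_normal] at h1
  have hε' : (0 : ℝ) < ε := hε
  linarith

lemma normal_ne_zero (e : 𝒯.Side) : 𝒯.normal e ≠ 0 := by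
  intro h
  have := 𝒯.norm_normal e
  rw [h, norm_zero] at this
  exact zero_ne_one this

/-- Within one triangle a side is determined by its end points. Three different triangles on one
edge would need pairwise opposite nonzero normals, which is impossible. -/
lemma adjacent_unique {e e' e'' : 𝒯.Side} (h' : (e, e') ∈ 𝒯.adjacentSides)
    (h'' : (e, e'') ∈ 𝒯.adjacentSides) : e' = e'' := by
  have hset : ({𝒯.fst e', 𝒯.snd e'} : Set Plane) = {𝒯.fst e'', 𝒯.snd e''} :=
    (𝒯.mem_adjacentSides.mp h').2.symm.trans (𝒯.mem_adjacentSides.mp h'').2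
  by_cases hK : e'.1 = e''.1
  · obtain ⟨K, i⟩ := e'
    obtain ⟨K', j⟩ := e''
    obtain rfl : K = K' := hK
    have hinj := 𝒯.vert_injective K
    have hij : (i + 1 = j + 1 ∧ i + 2 = j + 2) ∨ (i + 1 = j + 2 ∧ i + 2 = j + 1) := by
      rcases 𝒯.endpoints_eq hset with ⟨h1, h2⟩ | ⟨h1, h2⟩
      · exact Or.inl ⟨hinj h1, hinj h2⟩
      · exact Or.inr ⟨hinj h1, hinj h2⟩
    have : i = j := by
      revert hij
      fin_cases i <;> fin_cases j <;> decide
    rw [this]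
  · exfalso
    have h1 := 𝒯.normal_neg_of_adjacent (𝒯.mem_adjacentSides.mpr ⟨hK, hset⟩)
    rw [𝒯.normal_neg_of_adjacent h', 𝒯.normal_neg_of_adjacent h'', neg_neg] at h1
    have h2 : (2 : ℝ) • 𝒯.normal e = 0 := by
      rw [two_smul]
      exact add_eq_zero_iff_eq_neg.mpr h1.symm
    exact 𝒯.normal_ne_zero e ((smul_eq_zero.mp h2).resolve_left two_ne_zero)

lemma interiorEdges_subset : 𝒯.interiorEdges ⊆ 𝒯.adjacentSides := Finset.filter_subset _ _

lemma sum_adjacentSides (F : 𝒯.Side × 𝒯.Side → ℝ) :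
    ∑ p ∈ 𝒯.adjacentSides, F p = ∑ p ∈ 𝒯.interiorEdges, (F p + F p.swap) := by
  rw [Finset.sum_add_distrib,
    ← Finset.sum_filter_add_sum_filter_not 𝒯.adjacentSides (fun p => p.1.1 < p.2.1) F]
  congr 1
  refine Finset.sum_bij' (fun p _ => p.swap) (fun p _ => p.swap) ?_ ?_ ?_ ?_ ?_
  · rintro ⟨e, e'⟩ hp
    rw [Finset.mem_filter] at hp
    refine Finset.mem_filter.mpr ⟨𝒯.swap_mem_adjacentSides hp.1, ?_⟩
    exact lt_of_le_of_ne (not_lt.mp hp.2) (𝒯.mem_adjacentSides.mp hp.1).1.symm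
  · rintro ⟨e, e'⟩ hp
    have hp := Finset.mem_filter.mp hp
    exact Finset.mem_filter.mpr ⟨𝒯.swap_mem_adjacentSides hp.1, not_lt.mpr hp.2.le⟩
  · intros; simp
  · intros; simp
  · intros; simp

lemma mem_boundaryEdges {e : 𝒯.Side} : e ∈ 𝒯.boundaryEdges ↔
    ∀ e', (e, e') ∉ 𝒯.adjacentSides := by
  simp only [boundaryEdges, Finset.mem_filter, Finset.mem_univ, true_and, mem_adjacentSides,
    not_and]
  refine forall_congr' fun e' => ?_
  rw [ne_comm, ne_comm (a := ({𝒯.fst e', 𝒯.snd e'} : Set Plane))]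

/-- A side that is not a boundary edge has exactly one partner, so the remaining sides group into
the two faces of each interior edge. -/
lemma sum_sides (g : 𝒯.Side → ℝ) :
    ∑ e, g e = ∑ p ∈ 𝒯.interiorEdges, (g p.1 + g p.2) + ∑ e ∈ 𝒯.boundaryEdges, g e := by
  classical
  rw [← Finset.sum_compl_add_sum 𝒯.boundaryEdges g]
  congr 1
  refine Eq.trans ?_ (𝒯.sum_adjacentSides fun p => g p.1)
  symm
  refine Finset.sum_bij (fun p _ => p.1) ?_ ?_ ?_ ?_
  · rintro ⟨e, e'⟩ hp
    rw [Finset.mem_compl, mem_boundaryEdges]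
    exact fun h => h e' hp
  · rintro ⟨e, e'⟩ hp ⟨e₂, e₂'⟩ hp₂ (rfl : e = e₂)
    rw [𝒯.adjacent_unique hp hp₂]
  · intro e he
    rw [Finset.mem_compl, mem_boundaryEdges] at he
    push Not at he
    obtain ⟨e', he'⟩ := he
    exact ⟨(e, e'), he', rfl⟩
  · intros; rfl

/-! ### The convective part of the form -/

lemma edgeIntegral_def (e : 𝒯.Side) (g : Plane → ℝ) :
    𝒯.edgeIntegral e g = ∫ x, g x ∂𝒯.edgeMeasure e := rfl

lemma edgeMeasure_eq_of_adjacent {e e' : 𝒯.Side} (h : (e, e') ∈ 𝒯.adjacentSides) :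
    𝒯.edgeMeasure e = 𝒯.edgeMeasure e' := by
  rw [edgeMeasure, edgeMeasure, 𝒯.edge_eq_of_adjacent h]

lemma ae_edgeMeasure_mem (e : 𝒯.Side) : ∀ᵐ x ∂𝒯.edgeMeasure e, x ∈ 𝒯.edge e :=
  ae_restrict_mem (𝒯.measurableSet_edge e)

lemma integrable_edgeMeasure {e : 𝒯.Side} {g : Plane → ℝ} (hg : ContinuousOn g (𝒯.edge e)) :
    Integrable g (𝒯.edgeMeasure e) := by
  obtain ⟨C, hC⟩ := (𝒯.isCompact_edge e).exists_bound_of_continuousOn hg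
  refine Integrable.of_bound (hg.aestronglyMeasurable (𝒯.measurableSet_edge e)) C ?_
  filter_upwards [𝒯.ae_edgeMeasure_mem e] with x hx using hC x hx

/-- The part of the plane on which the field `β` flows into the triangle of the side `e`. -/
def inflowRegion (β : Plane → Plane) (e : 𝒯.Side) : Set Plane :=
  {x | inner ℝ (β x) (𝒯.normal e) < 0}

lemma measurableSet_inflowRegion {β : Plane → Plane} (hβ : Measurable β) (e : 𝒯.Side) :
    MeasurableSet (𝒯.inflowRegion β e) :=
  measurableSet_lt hβ.inner_const measurable_const

/-- With an indicator, the inflow terms from both sides of an edge become integrals over the whole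
edge and can be compared pointwise. -/
lemma inflowIntegral_eq {β : Plane → Plane} (hβ : Measurable β) (e : 𝒯.Side) (g : Plane → ℝ) :
    𝒯.inflowIntegral β e g = ∫ x, (𝒯.inflowRegion β e).indicator g x ∂𝒯.edgeMeasure e := by
  rw [integral_indicator (𝒯.measurableSet_inflowRegion hβ e), edgeMeasure,
    Measure.restrict_restrict (𝒯.measurableSet_inflowRegion hβ e), inter_comm]
  rfl

/-- The identity holds pointwise. With `s` the normal velocity seen from the first triangle and
traces `u₁`, `u₂`, the divergence theorem contributes `s * (u₁ ^ 2 - u₂ ^ 2) / 2`, and only the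
downwind triangle contributes an upwind term; either sign of `s` completes the square. -/
lemma convection_interior {β : Plane → Plane} (hβm : Measurable β)
    (hβc : ContinuousOn β (closure D)) {u : 𝒯.PwFun} (hu : ∀ K, ContDiff ℝ ∞ (u K))
    {p : 𝒯.Side × 𝒯.Side} (hp : p ∈ 𝒯.adjacentSides) :
    (1 / 2 * 𝒯.edgeIntegral p.1 fun x => inner ℝ (β x) (𝒯.normal p.1) * u p.1.1 x ^ 2)
      + (1 / 2 * 𝒯.edgeIntegral p.2 fun x => inner ℝ (β x) (𝒯.normal p.2) * u p.2.1 x ^ 2)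
      + ((𝒯.inflowIntegral β p.1 fun x =>
          inner ℝ (β x) (𝒯.normal p.1) * (u p.2.1 x - u p.1.1 x) * u p.1.1 x)
        + 𝒯.inflowIntegral β p.2 fun x =>
          inner ℝ (β x) (𝒯.normal p.2) * (u p.1.1 x - u p.2.1 x) * u p.2.1 x) =
    1 / 2 * 𝒯.edgeIntegral p.1 fun x =>
          |inner ℝ (β x) (𝒯.normal p.1)| * (u p.2.1 x - u p.1.1 x) ^ 2 := by
  have hβe : ContinuousOn β (𝒯.edge p.1) :=
    hβc.mono ((𝒯.edge_subset_elem _).trans (𝒯.elem_subset_closure _))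
  have hc : ∀ K, ContinuousOn (u K) (𝒯.edge p.1) := fun K => (hu K).continuous.continuousOn
  have hn := 𝒯.normal_neg_of_adjacent hp
  have hbn : ∀ e : 𝒯.Side, ContinuousOn (fun x => (inner ℝ (β x) (𝒯.normal e) : ℝ)) (𝒯.edge p.1) :=
    fun e => hβe.inner continuousOn_const
  rw [inflowIntegral_eq 𝒯 hβm, inflowIntegral_eq 𝒯 hβm]
  simp only [edgeIntegral_def]
  rw [← 𝒯.edgeMeasure_eq_of_adjacent hp, ← integral_const_mul, ← integral_const_mul,
    ← integral_const_mul, ← integral_add, ← integral_add, ← integral_add]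
  · congr 1
    ext x
    have hr : x ∈ 𝒯.inflowRegion β p.1 ↔ inner ℝ (β x) (𝒯.normal p.1) < 0 := Iff.rfl
    have hr' : x ∈ 𝒯.inflowRegion β p.2 ↔ 0 < inner ℝ (β x) (𝒯.normal p.1) := by
      change inner ℝ (β x) (𝒯.normal p.2) < 0 ↔ _
      rw [hn, inner_neg_right, neg_lt_zero]
    rcases lt_trichotomy (inner ℝ (β x) (𝒯.normal p.1) : ℝ) 0 with h | h | h
    · rw [indicator_of_mem (hr.mpr h), indicator_of_notMem (mt hr'.mp h.le.not_gt), abs_of_neg h,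
        hn, inner_neg_right]
      ring
    · rw [indicator_of_notMem (mt hr.mp h.ge.not_gt), indicator_of_notMem (mt hr'.mp h.le.not_gt),
        hn, inner_neg_right, h]
      simp
    · rw [indicator_of_notMem (mt hr.mp h.le.not_gt), indicator_of_mem (hr'.mpr h), abs_of_pos h,
        hn, inner_neg_right]
      ring
  · exact (𝒯.integrable_edgeMeasure ((hbn _).mul ((hc _).pow 2))).const_mul _ |>.add
      ((𝒯.integrable_edgeMeasure ((hbn _).mul ((hc _).pow 2))).const_mul _)
  · exact ((𝒯.integrable_edgeMeasure (((hbn _).mul ((hc _).sub (hc _))).mul (hc _))).indicator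
      (𝒯.measurableSet_inflowRegion hβm _)).add
      ((𝒯.integrable_edgeMeasure (((hbn _).mul ((hc _).sub (hc _))).mul (hc _))).indicator
      (𝒯.measurableSet_inflowRegion hβm _))
  · exact (𝒯.integrable_edgeMeasure (((hbn _).mul ((hc _).sub (hc _))).mul (hc _))).indicator
      (𝒯.measurableSet_inflowRegion hβm _)
  · exact (𝒯.integrable_edgeMeasure (((hbn _).mul ((hc _).sub (hc _))).mul (hc _))).indicator
      (𝒯.measurableSet_inflowRegion hβm _)
  · exact (𝒯.integrable_edgeMeasure ((hbn _).mul ((hc _).pow 2))).const_mul _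
  · exact (𝒯.integrable_edgeMeasure ((hbn _).mul ((hc _).pow 2))).const_mul _

lemma convection_boundary {β : Plane → Plane} (hβm : Measurable β)
    (hβc : ContinuousOn β (closure D)) {u : 𝒯.PwFun} (hu : ∀ K, ContDiff ℝ ∞ (u K))
    (e : 𝒯.Side) :
    (1 / 2 * 𝒯.edgeIntegral e fun x => inner ℝ (β x) (𝒯.normal e) * u e.1 x ^ 2)
      - (𝒯.inflowIntegral β e fun x => inner ℝ (β x) (𝒯.normal e) * u e.1 x * u e.1 x) =
    1 / 2 * 𝒯.edgeIntegral e fun x => |inner ℝ (β x) (𝒯.normal e)| * u e.1 x ^ 2 := by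
  have hβe : ContinuousOn β (𝒯.edge e) :=
    hβc.mono ((𝒯.edge_subset_elem _).trans (𝒯.elem_subset_closure _))
  have hc : ∀ K, ContinuousOn (u K) (𝒯.edge e) := fun K => (hu K).continuous.continuousOn
  have hbn : ContinuousOn (fun x => (inner ℝ (β x) (𝒯.normal e) : ℝ)) (𝒯.edge e) :=
    hβe.inner continuousOn_const
  rw [inflowIntegral_eq 𝒯 hβm]
  simp only [edgeIntegral_def]
  rw [← integral_const_mul, ← integral_const_mul, ← integral_sub]
  · congr 1
    ext x
    have hr : x ∈ 𝒯.inflowRegion β e ↔ inner ℝ (β x) (𝒯.normal e) < 0 := Iff.rfl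
    rcases lt_or_ge (inner ℝ (β x) (𝒯.normal e) : ℝ) 0 with h | h
    · rw [indicator_of_mem (hr.mpr h), abs_of_neg h]; ring
    · rw [indicator_of_notMem (mt hr.mp h.not_gt), abs_of_nonneg h]; ring
  · exact (𝒯.integrable_edgeMeasure (hbn.mul ((hc _).pow 2))).const_mul _
  · exact (𝒯.integrable_edgeMeasure ((hbn.mul (hc _)).mul (hc _))).indicator
      (𝒯.measurableSet_inflowRegion hβm _)

/-- For a divergence free field the convective part of the form, with upwinding, is the convective
part of the energy norm. -/
lemma convection_eq (hD : interior (closure D) = D) {β : Plane → Plane}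
    (hβm : Measurable β) (hβc : ContinuousOn β (closure D)) (hdiv : IsDivFree D β)
    {u : 𝒯.PwFun} (hu : ∀ K, ContDiff ℝ ∞ (u K)) :
    (∑ K, ∫ x in 𝒯.elem K, inner ℝ (β x) (∇ (u K) x) * u K x)
      + (∑ p ∈ 𝒯.adjacentSides, 𝒯.inflowIntegral β p.1 fun x =>
          inner ℝ (β x) (𝒯.normal p.1) * (u p.2.1 x - u p.1.1 x) * u p.1.1 x)
      - (∑ e ∈ 𝒯.boundaryEdges, 𝒯.inflowIntegral β e fun x =>
          inner ℝ (β x) (𝒯.normal e) * u e.1 x * u e.1 x) =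
    (1 / 2) * (∑ e ∈ 𝒯.boundaryEdges, 𝒯.edgeIntegral e fun x =>
          |inner ℝ (β x) (𝒯.normal e)| * u e.1 x ^ 2)
      + (1 / 2) * ∑ p ∈ 𝒯.interiorEdges, 𝒯.edgeIntegral p.1 fun x =>
          |inner ℝ (β x) (𝒯.normal p.1)| * (u p.2.1 x - u p.1.1 x) ^ 2 := by
  set g : 𝒯.Side → ℝ := fun e =>
    1 / 2 * 𝒯.edgeIntegral e fun x => inner ℝ (β x) (𝒯.normal e) * u e.1 x ^ 2 with hg
  -- The convective integrand is half of the velocity times the gradient of `u ^ 2`, so the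
  -- divergence theorem applies with `w = u ^ 2`.
  have h1 : ∑ K, ∫ x in 𝒯.elem K, inner ℝ (β x) (∇ (u K) x) * u K x = ∑ e, g e := by
    rw [Fintype.sum_prod_type]
    refine Finset.sum_congr rfl fun K _ => ?_
    simp only [hg]
    rw [← Finset.mul_sum,
      ← 𝒯.integral_inner_gradient hD hβm hβc hdiv ((hu K).pow 2), ← integral_const_mul]
    congr 1
    ext x
    have hd : HasFDerivAt (fun y => u K y ^ 2) ((2 * u K x) • fderiv ℝ (u K) x) x := by
      have := ((hu K).differentiable (by simp) x).hasFDerivAt.pow 2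
      simpa using this
    rw [inner_gradient_right, inner_gradient_right, hd.fderiv]
    simp only [smul_apply, smul_eq_mul]
    ring
  rw [h1, sum_sides, sum_adjacentSides, Finset.mul_sum, Finset.mul_sum]
  rw [← Finset.sum_congr rfl fun e (_ : e ∈ 𝒯.boundaryEdges) =>
      𝒯.convection_boundary hβm hβc hu e,
    ← Finset.sum_congr rfl fun p (hp : p ∈ 𝒯.interiorEdges) =>
      𝒯.convection_interior hβm hβc hu (𝒯.interiorEdges_subset hp)]
  simp only [Finset.sum_add_distrib, Finset.sum_sub_distrib, hg, Prod.fst_swap, Prod.snd_swap]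
  ring

/-! ### Coercivity -/

/-- The square of the energy norm. -/
def energySq (σ : ℝ) (α : Plane → ℝ) (β : Plane → Plane) (u : 𝒯.PwFun) : ℝ :=
  (∑ K, ∫ x in 𝒯.elem K, α x * ‖∇ (u K) x‖ ^ 2)
  + ((∑ p ∈ 𝒯.interiorEdges, σ / 𝒯.edgeLength p.1 * 𝒯.edgeIntegral p.1 fun x =>
        ‖𝒯.jump u p x‖ ^ 2)
      + ∑ e ∈ 𝒯.boundaryEdges, σ / 𝒯.edgeLength e * 𝒯.edgeIntegral e fun x =>
        ‖𝒯.bdryJump u e x‖ ^ 2)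
  + (1 / 2) * (∑ e ∈ 𝒯.boundaryEdges, 𝒯.edgeIntegral e fun x =>
        |inner ℝ (β x) (𝒯.normal e)| * u e.1 x ^ 2)
  + (1 / 2) * ∑ p ∈ 𝒯.interiorEdges, 𝒯.edgeIntegral p.1 fun x =>
        |inner ℝ (β x) (𝒯.normal p.1)| * (u p.2.1 x - u p.1.1 x) ^ 2

lemma edgeIntegral_nonneg (e : 𝒯.Side) {g : Plane → ℝ} (hg : ∀ x, 0 ≤ g x) :
    0 ≤ 𝒯.edgeIntegral e g := integral_nonneg hg

lemma energySq_nonneg {σ : ℝ} (hσ : 0 ≤ σ) {α : Plane → ℝ} (hα : ∀ x ∈ closure D, 0 ≤ α x)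
    (β : Plane → Plane) (u : 𝒯.PwFun) : 0 ≤ 𝒯.energySq σ α β u := by
  have h : ∀ e : 𝒯.Side, 0 ≤ σ / 𝒯.edgeLength e := fun e =>
    div_nonneg hσ (𝒯.edgeLength_pos e).le
  unfold energySq
  refine add_nonneg (add_nonneg (add_nonneg ?_ (add_nonneg ?_ ?_)) (mul_nonneg (by norm_num) ?_))
    (mul_nonneg (by norm_num) ?_)
  · refine Finset.sum_nonneg fun K _ => setIntegral_nonneg (𝒯.measurableSet_elem K) fun x hx => ?_
    exact mul_nonneg (hα x (𝒯.elem_subset_closure K hx)) (sq_nonneg _)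
  · exact Finset.sum_nonneg fun p _ => mul_nonneg (h _) (𝒯.edgeIntegral_nonneg _ fun x => by positivity)
  · exact Finset.sum_nonneg fun p _ => mul_nonneg (h _) (𝒯.edgeIntegral_nonneg _ fun x => by positivity)
  · exact Finset.sum_nonneg fun p _ => 𝒯.edgeIntegral_nonneg _ fun x => by positivity
  · exact Finset.sum_nonneg fun p _ => 𝒯.edgeIntegral_nonneg _ fun x => by positivity

lemma energyNorm_sq {σ : ℝ} (hσ : 0 ≤ σ) {α : Plane → ℝ} (hα : ∀ x ∈ closure D, 0 ≤ α x)
    (β : Plane → Plane) (u : 𝒯.PwFun) : 𝒯.energyNorm σ α β u ^ 2 = 𝒯.energySq σ α β u :=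
  Real.sq_sqrt (𝒯.energySq_nonneg hσ hα β u)

lemma two_mul_inner_le {η : ℝ} (hη : 0 < η) (x y : Plane) :
    2 * |inner ℝ x y| ≤ η * ‖x‖ ^ 2 + η⁻¹ * ‖y‖ ^ 2 := by
  have h1 := abs_real_inner_le_norm x y
  have h2 : 0 ≤ η⁻¹ * (η * ‖x‖ - ‖y‖) ^ 2 := by positivity
  have h3 : η⁻¹ * (η * ‖x‖ - ‖y‖) ^ 2 = η * ‖x‖ ^ 2 + η⁻¹ * ‖y‖ ^ 2 - 2 * (‖x‖ * ‖y‖) := by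
    field_simp
    ring
  linarith

/-- The Young weight `ε * h`, with `h` the edge length, matches the scaling of the inverse trace
inequality on one side and of the penalty on the other. Taking `e' = e` covers boundary edges. -/
lemma integral_flux_le {κ : ℝ} (hκ : 𝒯.IsShapeRegular κ) {ℓ : ℕ} {M ε : ℝ} (hε : 0 < ε)
    {u : 𝒯.PwFun} (hu : ∀ K, IsPolyLike ℓ (u K)) (e e' : 𝒯.Side)
    (he : 𝒯.edgeMeasure e = 𝒯.edgeMeasure e') (hl : 𝒯.edgeLength e = 𝒯.edgeLength e')
    {F j : Plane → Plane} (hj : Continuous j)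
    (hF : ∀ x ∈ 𝒯.edge e,
      ‖F x‖ ^ 2 ≤ M * (1 / 2 * (‖∇ (u e.1) x‖ ^ 2 + ‖∇ (u e'.1) x‖ ^ 2))) (hM : 0 ≤ M) :
    2 * 𝒯.edgeIntegral e (fun x => inner ℝ (F x) (j x)) ≤
      ε * M * (2 * traceConst ℓ * κ ^ 2) *
        (1 / 2 * ((∫ x in 𝒯.elem e.1, ‖∇ (u e.1) x‖ ^ 2) +
          ∫ x in 𝒯.elem e'.1, ‖∇ (u e'.1) x‖ ^ 2)) +
      ε⁻¹ / 𝒯.edgeLength e * 𝒯.edgeIntegral e fun x => ‖j x‖ ^ 2 := by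
  have hh := 𝒯.edgeLength_pos e
  set h := 𝒯.edgeLength e with hhdef
  have hgc : ∀ K, Continuous fun x => ‖∇ (u K) x‖ ^ 2 := fun K =>
    (continuous_gradient (hu K).smooth).norm.pow 2
  have hgi : ∀ K, Integrable (fun x => ‖∇ (u K) x‖ ^ 2) (𝒯.edgeMeasure e) := fun K =>
    𝒯.integrable_edgeMeasure (hgc K).continuousOn
  have hji : Integrable (fun x => ‖j x‖ ^ 2) (𝒯.edgeMeasure e) :=
    𝒯.integrable_edgeMeasure (hj.norm.pow 2).continuousOn
  have hgs : Integrable (fun x => 1 / 2 * (‖∇ (u e.1) x‖ ^ 2 + ‖∇ (u e'.1) x‖ ^ 2))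
      (𝒯.edgeMeasure e) := ((hgi _).add (hgi _)).const_mul _
  have h1 : 2 * 𝒯.edgeIntegral e (fun x => inner ℝ (F x) (j x)) ≤
      ∫ x, (ε * h * (M * (1 / 2 * (‖∇ (u e.1) x‖ ^ 2 + ‖∇ (u e'.1) x‖ ^ 2)))
        + (ε * h)⁻¹ * ‖j x‖ ^ 2) ∂𝒯.edgeMeasure e := by
    rw [edgeIntegral_def, ← integral_const_mul]
    -- Bounding through the norm requires integrability of the majorant only; `F` is not assumed
    -- measurable.
    refine (Real.le_norm_self _).trans (norm_integral_le_of_norm_le ?_ ?_)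
    · exact ((hgs.const_mul _).const_mul _).add (hji.const_mul _)
    · filter_upwards [𝒯.ae_edgeMeasure_mem e] with x hx
      rw [norm_mul, Real.norm_eq_abs, Real.norm_eq_abs, abs_two]
      refine (two_mul_inner_le (mul_pos hε hh) _ _).trans ?_
      have := mul_le_mul_of_nonneg_left (hF x hx) (mul_pos hε hh).le
      linarith
  rw [integral_add ((hgs.const_mul _).const_mul _)
    (hji.const_mul _), integral_const_mul, integral_const_mul, integral_const_mul,
    integral_const_mul, integral_add (hgi _) (hgi _)] at h1
  have t1 := 𝒯.edgeIntegral_sq_norm_gradient_le hκ e (hu e.1)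
  have t2 := 𝒯.edgeIntegral_sq_norm_gradient_le hκ e' (hu e'.1)
  rw [edgeIntegral_def] at t1 t2
  rw [← he, ← hl] at t2
  refine h1.trans ?_
  rw [edgeIntegral_def, mul_inv, div_eq_mul_inv]
  refine add_le_add ?_ le_rfl
  have hεM : 0 ≤ ε * M * (1 / 2) := by positivity
  have := mul_le_mul_of_nonneg_left (add_le_add t1 t2) hεM
  linarith

/-- The inverse of the smallest penalty parameter, up to a factor `2`. -/
def penaltyScale (amin amax : ℝ) (ℓ : ℕ) (κ : ℝ) : ℝ :=
  amin / (6 * (amax ^ 2 + 1) * (2 * traceConst ℓ * κ ^ 2 + 1))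

lemma penaltyScale_pos {amin : ℝ} (h : 0 < amin) (amax : ℝ) (ℓ : ℕ) (κ : ℝ) :
    0 < penaltyScale amin amax ℓ κ := by
  have := traceConst_pos ℓ
  unfold penaltyScale
  positivity

/-- Half of the diffusion and half of the penalty pay for the two equal consistency terms, and the
convective part is kept in full. The bound on `σ` is what makes half of the penalty dominate `ε⁻¹`
times the jumps. -/
lemma sipgForm_coercive (hD : interior (closure D) = D) {κ : ℝ} (hκ : 𝒯.IsShapeRegular κ)
    {ℓ : ℕ} {amin amax : ℝ} (hamin : 0 < amin) {σ : ℝ}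
    (hσ : 2 / penaltyScale amin amax ℓ κ ≤ σ)
    {α : Plane → ℝ} (hαm : Measurable α) (hα : ∀ x ∈ closure D, amin ≤ α x ∧ α x ≤ amax)
    {β : Plane → Plane} (hβm : Measurable β) (hβc : ContinuousOn β (closure D))
    (hdiv : IsDivFree D β) {u : 𝒯.PwFun} (hu : ∀ K, IsPolyLike ℓ (u K)) :
    1 / 2 * 𝒯.energySq σ α β u ≤ 𝒯.sipgForm σ α β u u := by
  set ε := penaltyScale amin amax ℓ κ with hε
  have hε0 : 0 < ε := penaltyScale_pos hamin _ _ _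
  have hσ0 : 0 ≤ σ := (by positivity : (0 : ℝ) ≤ 2 / ε).trans hσ
  have hgc : ∀ K, Continuous fun x => ‖∇ (u K) x‖ ^ 2 := fun K =>
    (continuous_gradient (hu K).smooth).norm.pow 2
  have huc : ∀ K, Continuous (u K) := fun K => (hu K).smooth.continuous
  set G : Fin 𝒯.card → ℝ := fun K => ∫ x in 𝒯.elem K, ‖∇ (u K) x‖ ^ 2 with hG
  have hG0 : ∀ K, 0 ≤ G K := fun K => integral_nonneg fun x => by positivity
  have hGA : ∀ K, amin * G K ≤ ∫ x in 𝒯.elem K, α x * ‖∇ (u K) x‖ ^ 2 := by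
    intro K
    simp only [hG]
    rw [← integral_const_mul]
    have hi : IntegrableOn (fun x => ‖∇ (u K) x‖ ^ 2) (𝒯.elem K) :=
      (hgc K).continuousOn.integrableOn_compact (𝒯.isCompact_elem K)
    refine setIntegral_mono_on (hi.const_mul _) ?_ (𝒯.measurableSet_elem K) fun x hx => ?_
    · refine hi.bdd_mul (c := amax) hαm.aestronglyMeasurable ?_
      filter_upwards [ae_restrict_mem (𝒯.measurableSet_elem K)] with x hx
      have := hα x (𝒯.elem_subset_closure K hx)
      rw [Real.norm_of_nonneg (hamin.le.trans this.1)]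
      exact this.2
    · exact mul_le_mul_of_nonneg_right (hα x (𝒯.elem_subset_closure K hx)).1 (by positivity)
  set c := ε * amax ^ 2 * (2 * traceConst ℓ * κ ^ 2) with hc
  have hαe : ∀ (e : 𝒯.Side), ∀ x ∈ 𝒯.edge e, α x ^ 2 ≤ amax ^ 2 := fun e x hx => by
    have := hα x (𝒯.elem_subset_closure _ (𝒯.edge_subset_elem e hx))
    exact pow_le_pow_left₀ (hamin.le.trans this.1) this.2 2
  have hint : ∀ p ∈ 𝒯.interiorEdges,
      2 * 𝒯.edgeIntegral p.1 (fun x => inner ℝ (𝒯.avgFlux α u p x) (𝒯.jump u p x)) ≤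
        c * (1 / 2 * (G p.1.1 + G p.2.1)) +
        ε⁻¹ / 𝒯.edgeLength p.1 * 𝒯.edgeIntegral p.1 fun x => ‖𝒯.jump u p x‖ ^ 2 := by
    intro p hp
    have hp' := 𝒯.interiorEdges_subset hp
    refine 𝒯.integral_flux_le hκ hε0 hu p.1 p.2 (𝒯.edgeMeasure_eq_of_adjacent hp')
      (𝒯.edgeLength_eq_of_adjacent hp') ?_ ?_ (sq_nonneg amax)
    · unfold jump
      exact ((huc _).smul continuous_const).add ((huc _).smul continuous_const)
    · intro x hx
      rw [avgFlux, ← smul_add, norm_smul, norm_smul, mul_pow, mul_pow, Real.norm_eq_abs,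
        Real.norm_eq_abs, sq_abs, sq_abs]
      have h1 : ‖∇ (u p.1.1) x + ∇ (u p.2.1) x‖ ^ 2 ≤
          2 * (‖∇ (u p.1.1) x‖ ^ 2 + ‖∇ (u p.2.1) x‖ ^ 2) := by
        have := pow_le_pow_left₀ (norm_nonneg _) (norm_add_le (∇ (u p.1.1) x) (∇ (u p.2.1) x)) 2
        nlinarith [sq_nonneg (‖∇ (u p.1.1) x‖ - ‖∇ (u p.2.1) x‖)]
      have h2 := mul_le_mul (hαe p.1 x hx) h1 (by positivity) (sq_nonneg _)
      linarith
  have hbdry : ∀ e ∈ 𝒯.boundaryEdges,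
      2 * 𝒯.edgeIntegral e (fun x => inner ℝ (𝒯.bdryFlux α u e x) (𝒯.bdryJump u e x)) ≤
        c * G e.1 +
        ε⁻¹ / 𝒯.edgeLength e * 𝒯.edgeIntegral e fun x => ‖𝒯.bdryJump u e x‖ ^ 2 := by
    intro e _
    have := 𝒯.integral_flux_le hκ hε0 hu e e rfl rfl (F := 𝒯.bdryFlux α u e)
      (j := 𝒯.bdryJump u e) (M := amax ^ 2) ?_ ?_ (sq_nonneg amax)
    · refine this.trans (le_of_eq ?_)
      rw [← two_mul, ← mul_assoc (1 / 2 : ℝ), one_div_mul_cancel two_ne_zero, one_mul]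
    · exact (huc _).smul continuous_const
    · intro x hx
      rw [bdryFlux, norm_smul, mul_pow, Real.norm_eq_abs, sq_abs]
      have := mul_le_mul_of_nonneg_right (hαe e x hx) (sq_nonneg ‖∇ (u e.1) x‖)
      linarith
  have hs1 := Finset.sum_le_sum hint
  have hs2 := Finset.sum_le_sum hbdry
  rw [← Finset.mul_sum, Finset.sum_add_distrib, ← Finset.mul_sum, ← Finset.mul_sum] at hs1
  rw [← Finset.mul_sum, Finset.sum_add_distrib, ← Finset.mul_sum] at hs2
  -- Every triangle is counted once for each of its three sides.
  have hsides : ∑ p ∈ 𝒯.interiorEdges, (G p.1.1 + G p.2.1) + ∑ e ∈ 𝒯.boundaryEdges, G e.1 =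
      3 * ∑ K, G K := by
    rw [← 𝒯.sum_sides fun e => G e.1, Fintype.sum_prod_type, Finset.mul_sum]
    simp
  have hsA := Finset.sum_le_sum fun K (_ : K ∈ Finset.univ) => hGA K
  rw [← Finset.mul_sum] at hsA
  have hpen : ∀ e : 𝒯.Side, ε⁻¹ / 𝒯.edgeLength e ≤ 1 / 2 * (σ / 𝒯.edgeLength e) := by
    intro e
    rw [← mul_div_assoc]
    refine div_le_div_of_nonneg_right ?_ (𝒯.edgeLength_pos e).le
    rw [div_eq_mul_inv] at hσ
    linarith
  have hs3 : ∑ p ∈ 𝒯.interiorEdges, ε⁻¹ / 𝒯.edgeLength p.1 * 𝒯.edgeIntegral p.1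
        (fun x => ‖𝒯.jump u p x‖ ^ 2) ≤ 1 / 2 * ∑ p ∈ 𝒯.interiorEdges, σ / 𝒯.edgeLength p.1 *
        𝒯.edgeIntegral p.1 fun x => ‖𝒯.jump u p x‖ ^ 2 := by
    rw [Finset.mul_sum]
    refine Finset.sum_le_sum fun p _ => ?_
    rw [← mul_assoc]
    exact mul_le_mul_of_nonneg_right (hpen _) (𝒯.edgeIntegral_nonneg _ fun x => by positivity)
  have hs4 : ∑ e ∈ 𝒯.boundaryEdges, ε⁻¹ / 𝒯.edgeLength e * 𝒯.edgeIntegral e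
        (fun x => ‖𝒯.bdryJump u e x‖ ^ 2) ≤ 1 / 2 * ∑ e ∈ 𝒯.boundaryEdges, σ / 𝒯.edgeLength e *
        𝒯.edgeIntegral e fun x => ‖𝒯.bdryJump u e x‖ ^ 2 := by
    rw [Finset.mul_sum]
    refine Finset.sum_le_sum fun p _ => ?_
    rw [← mul_assoc]
    exact mul_le_mul_of_nonneg_right (hpen _) (𝒯.edgeIntegral_nonneg _ fun x => by positivity)
  have hconv := 𝒯.convection_eq hD hβm hβc hdiv fun K => (hu K).smooth
  have hb0 : 0 ≤ ∑ e ∈ 𝒯.boundaryEdges, 𝒯.edgeIntegral e fun x =>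
        |inner ℝ (β x) (𝒯.normal e)| * u e.1 x ^ 2 :=
    Finset.sum_nonneg fun p _ => 𝒯.edgeIntegral_nonneg _ fun x => by positivity
  have hi0 : 0 ≤ ∑ p ∈ 𝒯.interiorEdges, 𝒯.edgeIntegral p.1 fun x =>
        |inner ℝ (β x) (𝒯.normal p.1)| * (u p.2.1 x - u p.1.1 x) ^ 2 :=
    Finset.sum_nonneg fun p _ => 𝒯.edgeIntegral_nonneg _ fun x => by positivity
  have hGs0 : 0 ≤ ∑ K, G K := Finset.sum_nonneg fun K _ => hG0 K
  have hc0 : 0 ≤ c := by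
    have := traceConst_pos ℓ
    positivity
  -- The `6` in `penaltyScale` is three sides times two, as only half of the diffusion may be spent;
  -- the summands `+ 1` there keep the denominator positive.
  have hc6 : 6 * c ≤ amin := by
    have ht := traceConst_pos ℓ
    have h1 : ε * (6 * (amax ^ 2 + 1) * (2 * traceConst ℓ * κ ^ 2 + 1)) = amin := by
      rw [hε, penaltyScale]
      field_simp
    have h2 : 0 ≤ 2 * traceConst ℓ * κ ^ 2 := by positivity
    have h3 : amax ^ 2 * (2 * traceConst ℓ * κ ^ 2) ≤
        (amax ^ 2 + 1) * (2 * traceConst ℓ * κ ^ 2 + 1) := by nlinarith [sq_nonneg amax]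
    have h4 := mul_le_mul_of_nonneg_left h3 hε0.le
    rw [hc]
    linarith
  have hGi : 0 ≤ ∑ p ∈ 𝒯.interiorEdges, (G p.1.1 + G p.2.1) :=
    Finset.sum_nonneg fun p _ => add_nonneg (hG0 _) (hG0 _)
  have hcG : c * (1 / 2 * ∑ p ∈ 𝒯.interiorEdges, (G p.1.1 + G p.2.1)) +
      c * ∑ e ∈ 𝒯.boundaryEdges, G e.1 ≤
      1 / 2 * ∑ K, ∫ x in 𝒯.elem K, α x * ‖∇ (u K) x‖ ^ 2 := by
    have h1 : c * (1 / 2 * ∑ p ∈ 𝒯.interiorEdges, (G p.1.1 + G p.2.1)) +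
      c * ∑ e ∈ 𝒯.boundaryEdges, G e.1 ≤ c * (3 * ∑ K, G K) := by
      rw [← hsides]
      nlinarith [mul_nonneg hc0 hGi]
    have h2 := mul_le_mul_of_nonneg_right hc6 hGs0
    linarith
  unfold sipgForm energySq
  simp only [real_inner_self_eq_norm_sq]
  linarith

end Triangulation

/-! ### The law of the noise -/

lemma measurableSet_box {N : ℕ} {Γ : Fin N → Set ℝ} {ρ : Noise N → ℝ} (h : IsNoiseDensity Γ ρ) :
    MeasurableSet (univ.pi Γ) :=
  MeasurableSet.univ_pi fun i => (h.interval i).measurableSet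

lemma isProbabilityMeasure_noiseLaw {N : ℕ} {Γ : Fin N → Set ℝ} {ρ : Noise N → ℝ}
    (h : IsNoiseDensity Γ ρ) : IsProbabilityMeasure (noiseLaw Γ ρ) := by
  constructor
  -- A nonintegrable density would have Bochner integral `0` by convention, not `1`.
  have hi : Integrable ρ (volume.restrict (univ.pi Γ)) := by
    by_contra hn
    have := h.integral_eq_one
    rw [integral_undef hn] at this
    exact zero_ne_one this
  have h0 : 0 ≤ᵐ[volume.restrict (univ.pi Γ)] ρ := by
    filter_upwards [ae_restrict_mem (measurableSet_box h)] with ξ hξ using h.nonneg ξ hξ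
  rw [noiseLaw, withDensity_apply _ MeasurableSet.univ, Measure.restrict_univ,
    ← ofReal_integral_eq_lintegral_ofReal hi h0, h.integral_eq_one, ENNReal.ofReal_one]

/-- Bounded parameters make every continuous function of position and noise almost surely bounded on
a compact set of positions. -/
lemma exists_isCompact_ae_mem {N : ℕ} {Γ : Fin N → Set ℝ} {ρ : Noise N → ℝ}
    (h : IsNoiseDensity Γ ρ) : ∃ S : Set (Noise N), IsCompact S ∧ ∀ᵐ ξ ∂noiseLaw Γ ρ, ξ ∈ S := by
  refine ⟨closure (univ.pi Γ), (Bornology.IsBounded.pi h.bounded).isCompact_closure, ?_⟩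
  have h1 : ∀ᵐ ξ ∂volume.restrict (univ.pi Γ), ξ ∈ univ.pi Γ :=
    ae_restrict_mem (measurableSet_box h)
  have h2 : ∀ᵐ ξ ∂noiseLaw Γ ρ, ξ ∈ univ.pi Γ := (withDensity_absolutelyContinuous _ _).ae_le h1
  exact h2.mono fun ξ hξ => subset_closure hξ

/-! ### Bounded random fields -/

/-- A random field is measurable, and almost surely bounded on the set `A`. -/
structure IsBddField {N : ℕ} (A : Set Plane) (ν : Measure (Noise N)) {E : Type*}
    [NormedAddCommGroup E] [MeasurableSpace E] (F : Plane → Noise N → E) : Prop where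
  measurable : Measurable fun z : Plane × Noise N => F z.1 z.2
  bounded : ∃ C : ℝ, ∀ᵐ ξ ∂ν, ∀ x ∈ A, ‖F x ξ‖ ≤ C

namespace IsBddField

variable {N : ℕ} {A : Set Plane} {ν : Measure (Noise N)}

lemma of_continuous {E : Type*} [NormedAddCommGroup E] [MeasurableSpace E] [BorelSpace E]
    {F : Plane → Noise N → E} {S : Set (Noise N)} (hA : IsCompact A)
    (hS : IsCompact S) (hν : ∀ᵐ ξ ∂ν, ξ ∈ S)
    (hF : Continuous fun z : Plane × Noise N => F z.1 z.2) : IsBddField A ν F where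
  measurable := hF.measurable
  bounded := by
    obtain ⟨C, hC⟩ := (hA.prod hS).exists_bound_of_continuousOn hF.continuousOn
    exact ⟨C, hν.mono fun ξ hξ x hx => hC (x, ξ) ⟨hx, hξ⟩⟩

lemma add {F G : Plane → Noise N → ℝ} (hF : IsBddField A ν F) (hG : IsBddField A ν G) :
    IsBddField A ν fun x ξ => F x ξ + G x ξ where
  measurable := hF.measurable.add hG.measurable
  bounded := by
    obtain ⟨C, hC⟩ := hF.bounded
    obtain ⟨C', hC'⟩ := hG.bounded
    refine ⟨C + C', ?_⟩
    filter_upwards [hC, hC'] with ξ h h' x hx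
    exact (norm_add_le _ _).trans (add_le_add (h x hx) (h' x hx))

lemma add_vec {F G : Plane → Noise N → Plane} (hF : IsBddField A ν F) (hG : IsBddField A ν G) :
    IsBddField A ν fun x ξ => F x ξ + G x ξ where
  measurable := hF.measurable.add hG.measurable
  bounded := by
    obtain ⟨C, hC⟩ := hF.bounded
    obtain ⟨C', hC'⟩ := hG.bounded
    refine ⟨C + C', ?_⟩
    filter_upwards [hC, hC'] with ξ h h' x hx
    exact (norm_add_le _ _).trans (add_le_add (h x hx) (h' x hx))

lemma mul {F G : Plane → Noise N → ℝ} (hF : IsBddField A ν F) (hG : IsBddField A ν G) :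
    IsBddField A ν fun x ξ => F x ξ * G x ξ where
  measurable := hF.measurable.mul hG.measurable
  bounded := by
    obtain ⟨C, hC⟩ := hF.bounded
    obtain ⟨C', hC'⟩ := hG.bounded
    refine ⟨C * C', ?_⟩
    filter_upwards [hC, hC'] with ξ h h' x hx
    rw [norm_mul]
    exact mul_le_mul (h x hx) (h' x hx) (norm_nonneg _) ((norm_nonneg _).trans (h x hx))

lemma smul {F : Plane → Noise N → ℝ} {G : Plane → Noise N → Plane} (hF : IsBddField A ν F)
    (hG : IsBddField A ν G) : IsBddField A ν fun x ξ => F x ξ • G x ξ where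
  measurable := hF.measurable.smul hG.measurable
  bounded := by
    obtain ⟨C, hC⟩ := hF.bounded
    obtain ⟨C', hC'⟩ := hG.bounded
    refine ⟨C * C', ?_⟩
    filter_upwards [hC, hC'] with ξ h h' x hx
    rw [norm_smul]
    exact mul_le_mul (h x hx) (h' x hx) (norm_nonneg _) ((norm_nonneg _).trans (h x hx))

lemma inner {F G : Plane → Noise N → Plane} (hF : IsBddField A ν F) (hG : IsBddField A ν G) :
    IsBddField A ν fun x ξ => (inner ℝ (F x ξ) (G x ξ) : ℝ) where
  measurable := hF.measurable.inner hG.measurable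
  bounded := by
    obtain ⟨C, hC⟩ := hF.bounded
    obtain ⟨C', hC'⟩ := hG.bounded
    refine ⟨C * C', ?_⟩
    filter_upwards [hC, hC'] with ξ h h' x hx
    exact (norm_inner_le_norm _ _).trans
      (mul_le_mul (h x hx) (h' x hx) (norm_nonneg _) ((norm_nonneg _).trans (h x hx)))

lemma const {E : Type*} [NormedAddCommGroup E] [MeasurableSpace E] (c : E) :
    IsBddField A ν fun _ _ => c where
  measurable := measurable_const
  bounded := ⟨‖c‖, Filter.Eventually.of_forall fun _ _ _ => le_rfl⟩

lemma norm {F : Plane → Noise N → Plane} (hF : IsBddField A ν F) :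
    IsBddField A ν fun x ξ => ‖F x ξ‖ where
  measurable := hF.measurable.norm
  bounded := by
    obtain ⟨C, hC⟩ := hF.bounded
    exact ⟨C, by simpa using hC⟩

lemma abs {F : Plane → Noise N → ℝ} (hF : IsBddField A ν F) :
    IsBddField A ν fun x ξ => |F x ξ| where
  measurable := hF.measurable.abs
  bounded := by
    obtain ⟨C, hC⟩ := hF.bounded
    exact ⟨C, by simpa using hC⟩

lemma sq {F : Plane → Noise N → ℝ} (hF : IsBddField A ν F) :
    IsBddField A ν fun x ξ => F x ξ ^ 2 := by
  simpa only [pow_two] using hF.mul hF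

lemma sub {F G : Plane → Noise N → ℝ} (hF : IsBddField A ν F) (hG : IsBddField A ν G) :
    IsBddField A ν fun x ξ => F x ξ - G x ξ := by
  have := hF.add ((const (-1 : ℝ)).mul hG)
  simpa only [neg_one_mul, ← sub_eq_add_neg] using this

/-- The region may vary with the noise, as the inflow part of an edge does; only its joint
measurability matters. -/
lemma indicator {F : Plane → Noise N → ℝ} (hF : IsBddField A ν F) {R : Noise N → Set Plane}
    (hR : MeasurableSet {z : Plane × Noise N | z.1 ∈ R z.2}) :
    IsBddField A ν fun x ξ => (R ξ).indicator (fun y => F y ξ) x where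
  measurable := hF.measurable.indicator hR
  bounded := by
    obtain ⟨C, hC⟩ := hF.bounded
    refine ⟨C, hC.mono fun ξ h x hx => ?_⟩
    exact (norm_indicator_le_norm_self _ _).trans (h x hx)

/-- Joint measurability makes the partial integral measurable in the noise, and the uniform bound on
a finite measure makes it bounded. -/
lemma integrable [IsFiniteMeasure ν] {F : Plane → Noise N → ℝ} (hF : IsBddField A ν F)
    {μ : Measure Plane} [IsFiniteMeasure μ] (hμ : ∀ᵐ x ∂μ, x ∈ A) :
    Integrable (fun ξ => ∫ x, F x ξ ∂μ) ν := by
  obtain ⟨C, hC⟩ := hF.bounded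
  have hm : StronglyMeasurable fun ξ => ∫ x, F x ξ ∂μ :=
    hF.measurable.stronglyMeasurable.integral_prod_left (f := F)
  refine Integrable.of_bound hm.aestronglyMeasurable (C * μ.real univ) ?_
  filter_upwards [hC] with ξ hξ
  exact norm_integral_le_of_norm_le_const (hμ.mono fun x hx => hξ x hx)

end IsBddField

/-! ### Functions of the tensor product space -/

namespace IsPolyLike

lemma zero (ℓ : ℕ) : IsPolyLike ℓ fun _ => 0 :=
  ⟨contDiff_const, fun x d => by simp⟩

lemma add {ℓ : ℕ} {f g : Plane → ℝ} (hf : IsPolyLike ℓ f) (hg : IsPolyLike ℓ g) :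
    IsPolyLike ℓ fun x => f x + g x :=
  ⟨hf.smooth.add hg.smooth, fun x d => by
    simp only [mul_add, Finset.sum_add_distrib, hf.fwdDiff, hg.fwdDiff, add_zero]⟩

lemma const_mul {ℓ : ℕ} {f : Plane → ℝ} (hf : IsPolyLike ℓ f) (c : ℝ) :
    IsPolyLike ℓ fun x => c * f x :=
  ⟨contDiff_const.mul hf.smooth, fun x d => by
    simp only [mul_left_comm _ c, ← Finset.mul_sum, hf.fwdDiff, mul_zero]⟩

end IsPolyLike

lemma contDiff_of_mem_chaosSpace {N Q : ℕ} {ψ : ℕ → MvPolynomial (Fin N) ℝ} {y : Noise N → ℝ}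
    (hy : y ∈ chaosSpace Q ψ) : ContDiff ℝ ∞ y := by
  induction hy using Submodule.span_induction with
  | mem y h =>
    obtain ⟨i, -, rfl⟩ := h
    exact contDiff_eval (ψ i) fun j => contDiff_apply ℝ ℝ j
  | zero => exact contDiff_const
  | add y z _ _ hy hz => exact hy.add hz
  | smul c y _ hy => exact hy.const_smul c

namespace Triangulation

variable {D : Set Plane} (𝒯 : Triangulation D)

/-- A random piecewise given function that is jointly smooth, and polynomial on each triangle. -/
structure IsRandomDG {N : ℕ} (ℓ : ℕ) (u : 𝒯.RandomPwFun N) : Prop where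
  polyLike : ∀ K ξ, IsPolyLike ℓ fun x => u K x ξ
  smooth : ∀ K, ContDiff ℝ ∞ fun z : Plane × Noise N => u K z.1 z.2

lemma isPolyLike_of_mem_dgSpace {ℓ : ℕ} {v : 𝒯.PwFun} (hv : v ∈ 𝒯.dgSpace ℓ) (K : Fin 𝒯.card) :
    IsPolyLike ℓ (v K) := by
  obtain ⟨p, hp, h⟩ := hv K
  rw [funext h]
  exact isPolyLike_eval p hp

lemma isRandomDG_of_mem_tensorSpace {N ℓ Q : ℕ} {ψ : ℕ → MvPolynomial (Fin N) ℝ}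
    {u : 𝒯.RandomPwFun N} (hu : u ∈ 𝒯.tensorSpace ℓ (chaosSpace Q ψ)) : 𝒯.IsRandomDG ℓ u := by
  induction hu using Submodule.span_induction with
  | mem u h =>
    obtain ⟨v, hv, y, hy, rfl⟩ := h
    have hp := 𝒯.isPolyLike_of_mem_dgSpace hv
    refine ⟨fun K ξ => ?_, fun K => ?_⟩
    · simpa only [mul_comm] using (hp K).const_mul (y ξ)
    · exact ((hp K).smooth.comp contDiff_fst).mul
        ((contDiff_of_mem_chaosSpace hy).comp contDiff_snd)
  | zero => exact ⟨fun _ _ => IsPolyLike.zero ℓ, fun _ => contDiff_const⟩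
  | add u v _ _ hu hv =>
    exact ⟨fun K ξ => (hu.polyLike K ξ).add (hv.polyLike K ξ),
      fun K => (hu.smooth K).add (hv.smooth K)⟩
  | smul c u _ hu =>
    exact ⟨fun K ξ => (hu.polyLike K ξ).const_mul c, fun K => (hu.smooth K).const_smul c⟩

namespace IsRandomDG

variable {𝒯} {N ℓ : ℕ} {u : 𝒯.RandomPwFun N}

lemma continuous_gradient (hu : 𝒯.IsRandomDG ℓ u) (K : Fin 𝒯.card) :
    Continuous fun z : Plane × Noise N => ∇ (fun x => u K x z.2) z.1 := by
  have h : ContDiff ℝ 0 fun z : Plane × Noise N => fderiv ℝ (fun x => u K x z.2) z.1 := by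
    refine ContDiff.fderiv (m := ∞) (n := 0) (f := fun (z : Plane × Noise N) x => u K x z.2)
      (g := fun z => z.1) ?_ contDiff_fst (by simp)
    exact (hu.smooth K).comp (contDiff_snd.prodMk (contDiff_snd.comp contDiff_fst))
  unfold gradient
  exact (LinearIsometryEquiv.continuous _).comp h.continuous

variable {S : Set (Noise N)} {ν : Measure (Noise N)}

lemma isBddField (hu : 𝒯.IsRandomDG ℓ u) (hD : Bornology.IsBounded D) (hS : IsCompact S)
    (hν : ∀ᵐ ξ ∂ν, ξ ∈ S) (K : Fin 𝒯.card) : IsBddField (closure D) ν (u K) :=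
  .of_continuous hD.isCompact_closure hS hν (hu.smooth K).continuous

lemma isBddField_gradient (hu : 𝒯.IsRandomDG ℓ u) (hD : Bornology.IsBounded D) (hS : IsCompact S)
    (hν : ∀ᵐ ξ ∂ν, ξ ∈ S) (K : Fin 𝒯.card) :
    IsBddField (closure D) ν fun x ξ => ∇ (fun x => u K x ξ) x :=
  .of_continuous hD.isCompact_closure hS hν (hu.continuous_gradient K)

end IsRandomDG

/-! ### Integrability of the form and of the energy over the noise. -/

section Integrability

variable {N : ℕ} {ν : Measure (Noise N)}

lemma integrable_elem [IsFiniteMeasure ν] {F : Plane → Noise N → ℝ} (hF : IsBddField (closure D) ν F)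
    (K : Fin 𝒯.card) : Integrable (fun ξ => ∫ x in 𝒯.elem K, F x ξ) ν := by
  refine hF.integrable ?_
  filter_upwards [ae_restrict_mem (𝒯.measurableSet_elem K)] with x hx
  exact 𝒯.elem_subset_closure K hx

lemma ae_edgeMeasure_mem_closure (e : 𝒯.Side) : ∀ᵐ x ∂𝒯.edgeMeasure e, x ∈ closure D := by
  filter_upwards [𝒯.ae_edgeMeasure_mem e] with x hx
  exact 𝒯.elem_subset_closure _ (𝒯.edge_subset_elem e hx)

lemma integrable_edgeIntegral [IsFiniteMeasure ν] {F : Plane → Noise N → ℝ} (hF : IsBddField (closure D) ν F)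
    (e : 𝒯.Side) : Integrable (fun ξ => 𝒯.edgeIntegral e fun x => F x ξ) ν :=
  hF.integrable (μ := 𝒯.edgeMeasure e) (𝒯.ae_edgeMeasure_mem_closure e)

lemma integrable_inflowIntegral [IsFiniteMeasure ν] {F : Plane → Noise N → ℝ} (hF : IsBddField (closure D) ν F)
    {b : Plane → Noise N → Plane} (hb : Measurable fun z : Plane × Noise N => b z.1 z.2)
    (e : 𝒯.Side) :
    Integrable (fun ξ => 𝒯.inflowIntegral (fun x => b x ξ) e fun x => F x ξ) ν := by
  have h : ∀ ξ, Measurable fun x => b x ξ := fun ξ => hb.comp measurable_prodMk_right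
  simp only [fun ξ => 𝒯.inflowIntegral_eq (h ξ) e]
  refine (hF.indicator (R := fun ξ => 𝒯.inflowRegion (fun x => b x ξ) e) ?_).integrable
    (𝒯.ae_edgeMeasure_mem_closure e)
  have hm : Measurable fun z : Plane × Noise N => (inner ℝ (b z.1 z.2) (𝒯.normal e) : ℝ) :=
    hb.inner_const
  exact measurableSet_lt hm measurable_const

variable {a : Plane → Noise N → ℝ} {b : Plane → Noise N → Plane} {ℓ : ℕ} {u : 𝒯.RandomPwFun N}
  {S : Set (Noise N)}

lemma isBddField_jump (hu : 𝒯.IsRandomDG ℓ u) (hD : Bornology.IsBounded D) (hS : IsCompact S)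
    (hν : ∀ᵐ ξ ∂ν, ξ ∈ S) (p : 𝒯.Side × 𝒯.Side) :
    IsBddField (closure D) ν fun x ξ => 𝒯.jump (fun K x => u K x ξ) p x :=
  ((hu.isBddField hD hS hν _).smul (.const _)).add_vec
    ((hu.isBddField hD hS hν _).smul (.const _))

lemma isBddField_bdryJump (hu : 𝒯.IsRandomDG ℓ u) (hD : Bornology.IsBounded D) (hS : IsCompact S)
    (hν : ∀ᵐ ξ ∂ν, ξ ∈ S) (e : 𝒯.Side) :
    IsBddField (closure D) ν fun x ξ => 𝒯.bdryJump (fun K x => u K x ξ) e x :=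
  (hu.isBddField hD hS hν _).smul (.const _)

lemma isBddField_bdryFlux (ha : IsBddField (closure D) ν a) (hu : 𝒯.IsRandomDG ℓ u)
    (hD : Bornology.IsBounded D) (hS : IsCompact S) (hν : ∀ᵐ ξ ∂ν, ξ ∈ S) (e : 𝒯.Side) :
    IsBddField (closure D) ν fun x ξ => 𝒯.bdryFlux (fun x => a x ξ) (fun K x => u K x ξ) e x :=
  ha.smul (hu.isBddField_gradient hD hS hν _)

lemma isBddField_avgFlux (ha : IsBddField (closure D) ν a) (hu : 𝒯.IsRandomDG ℓ u)
    (hD : Bornology.IsBounded D) (hS : IsCompact S) (hν : ∀ᵐ ξ ∂ν, ξ ∈ S)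
    (p : 𝒯.Side × 𝒯.Side) :
    IsBddField (closure D) ν fun x ξ => 𝒯.avgFlux (fun x => a x ξ) (fun K x => u K x ξ) p x :=
  (IsBddField.const (1 / 2 : ℝ)).smul
    ((ha.smul (hu.isBddField_gradient hD hS hν _)).add_vec
      (ha.smul (hu.isBddField_gradient hD hS hν _)))

lemma integrable_energySq [IsFiniteMeasure ν] (ha : IsBddField (closure D) ν a) (hb : IsBddField (closure D) ν b)
    (hu : 𝒯.IsRandomDG ℓ u) (hD : Bornology.IsBounded D) (hS : IsCompact S)
    (hν : ∀ᵐ ξ ∂ν, ξ ∈ S) (σ : ℝ) :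
    Integrable (fun ξ => 𝒯.energySq σ (fun x => a x ξ) (fun x => b x ξ) fun K x => u K x ξ) ν := by
  have hub := hu.isBddField hD hS hν
  have hgb := hu.isBddField_gradient hD hS hν
  have hn : ∀ e, IsBddField (closure D) ν fun x ξ => |inner ℝ (b x ξ) (𝒯.normal e)| :=
    fun e => (hb.inner (.const (𝒯.normal e))).abs
  unfold energySq
  refine (((integrable_finsetSum _ fun K _ => ?_).add
    ((integrable_finsetSum _ fun p _ => ?_).add (integrable_finsetSum _ fun e _ => ?_))).add
    ((integrable_finsetSum _ fun e _ => ?_).const_mul _)).add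
    ((integrable_finsetSum _ fun p _ => ?_).const_mul _)
  · exact 𝒯.integrable_elem (ha.mul (hgb K).norm.sq) K
  · exact (𝒯.integrable_edgeIntegral (𝒯.isBddField_jump hu hD hS hν p).norm.sq _).const_mul _
  · exact (𝒯.integrable_edgeIntegral (𝒯.isBddField_bdryJump hu hD hS hν e).norm.sq _).const_mul _
  · exact 𝒯.integrable_edgeIntegral ((hn e).mul (hub _).sq) _
  · exact 𝒯.integrable_edgeIntegral ((hn p.1).mul ((hub _).sub (hub _)).sq) _

lemma integrable_sipgForm [IsFiniteMeasure ν] (ha : IsBddField (closure D) ν a) (hb : IsBddField (closure D) ν b)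
    (hu : 𝒯.IsRandomDG ℓ u) (hD : Bornology.IsBounded D) (hS : IsCompact S)
    (hν : ∀ᵐ ξ ∂ν, ξ ∈ S) (σ : ℝ) :
    Integrable (fun ξ => 𝒯.sipgForm σ (fun x => a x ξ) (fun x => b x ξ) (fun K x => u K x ξ)
      fun K x => u K x ξ) ν := by
  have hub := hu.isBddField hD hS hν
  have hgb := hu.isBddField_gradient hD hS hν
  have hj := 𝒯.isBddField_jump hu hD hS hν
  have hbj := 𝒯.isBddField_bdryJump hu hD hS hν
  have hf := 𝒯.isBddField_avgFlux ha hu hD hS hν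
  have hbf := 𝒯.isBddField_bdryFlux ha hu hD hS hν
  have hn : ∀ e, IsBddField (closure D) ν fun x ξ => (inner ℝ (b x ξ) (𝒯.normal e) : ℝ) :=
    fun e => hb.inner (.const (𝒯.normal e))
  have hflux : Integrable (fun ξ => (∑ p ∈ 𝒯.interiorEdges, 𝒯.edgeIntegral p.1 fun x =>
        inner ℝ (𝒯.avgFlux (fun x => a x ξ) (fun K x => u K x ξ) p x)
          (𝒯.jump (fun K x => u K x ξ) p x))
      + ∑ e ∈ 𝒯.boundaryEdges, 𝒯.edgeIntegral e fun x =>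
        inner ℝ (𝒯.bdryFlux (fun x => a x ξ) (fun K x => u K x ξ) e x)
          (𝒯.bdryJump (fun K x => u K x ξ) e x)) ν :=
    (integrable_finsetSum _ fun p _ => 𝒯.integrable_edgeIntegral ((hf p).inner (hj p)) _).add
      (integrable_finsetSum _ fun e _ => 𝒯.integrable_edgeIntegral ((hbf e).inner (hbj e)) _)
  unfold sipgForm
  refine ((((((integrable_finsetSum _ fun K _ => ?_).sub hflux).sub hflux).add
    ((integrable_finsetSum _ fun p _ => ?_).add (integrable_finsetSum _ fun e _ => ?_))).add
    (integrable_finsetSum _ fun K _ => ?_)).add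
    (integrable_finsetSum _ fun p _ => ?_)).sub (integrable_finsetSum _ fun e _ => ?_)
  · exact 𝒯.integrable_elem (ha.mul ((hgb K).inner (hgb K))) K
  · exact (𝒯.integrable_edgeIntegral ((hj p).inner (hj p)) _).const_mul _
  · exact (𝒯.integrable_edgeIntegral ((hbj e).inner (hbj e)) _).const_mul _
  · exact 𝒯.integrable_elem ((hb.inner (hgb K)).mul (hub K)) K
  · exact 𝒯.integrable_inflowIntegral (((hn _).mul ((hub _).sub (hub _))).mul (hub _))
      hb.measurable _
  · exact 𝒯.integrable_inflowIntegral (((hn _).mul (hub _)).mul (hub _)) hb.measurable _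

end Integrability

/-! ### The norm of `L²(L²(D); Γ)` -/

section L2

variable {N : ℕ} {ν : Measure (Noise N)}

/-- The measure on a triangle times the noise. -/
abbrev elemProd (ν : Measure (Noise N)) (K : Fin 𝒯.card) : Measure (Plane × Noise N) :=
  (volume.restrict (𝒯.elem K)).prod ν

/-- Fubini; on the product space the estimates below reduce to pointwise inequalities. -/
lemma integral_sum_elem [IsFiniteMeasure ν] {G : 𝒯.RandomPwFun N}
    (hG : ∀ K, Integrable (fun z : Plane × Noise N => G K z.1 z.2) (𝒯.elemProd ν K)) :
    ∫ ξ, (∑ K, ∫ x in 𝒯.elem K, G K x ξ) ∂ν = ∑ K, ∫ z, G K z.1 z.2 ∂𝒯.elemProd ν K := by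
  rw [integral_finsetSum _ fun K _ => (hG K).integral_prod_right]
  exact Finset.sum_congr rfl fun K _ => (integral_prod_symm _ (hG K)).symm

/-- The square of the norm of `L²(L²(D); Γ)`. -/
def l2Sq (ν : Measure (Noise N)) (u : 𝒯.RandomPwFun N) : ℝ :=
  ∫ ξ, (∑ K, ∫ x in 𝒯.elem K, u K x ξ ^ 2) ∂ν

lemma l2Sq_nonneg (u : 𝒯.RandomPwFun N) : 0 ≤ 𝒯.l2Sq ν u :=
  integral_nonneg fun _ => Finset.sum_nonneg fun _ _ => integral_nonneg fun _ => sq_nonneg _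

lemma l2Norm_sq (u : 𝒯.RandomPwFun N) : 𝒯.l2Norm ν u ^ 2 = 𝒯.l2Sq ν u :=
  Real.sq_sqrt (𝒯.l2Sq_nonneg u)

lemma l2Sq_eq [IsFiniteMeasure ν] {u : 𝒯.RandomPwFun N} (hu : 𝒯.IsL2 ν u) :
    𝒯.l2Sq ν u = ∑ K, ∫ z, u K z.1 z.2 ^ 2 ∂𝒯.elemProd ν K :=
  𝒯.integral_sum_elem (G := fun K x ξ => u K x ξ ^ 2) fun K => (hu K).integrable_sq

lemma l2Inner_eq [IsFiniteMeasure ν] {u v : 𝒯.RandomPwFun N} (hu : 𝒯.IsL2 ν u) (hv : 𝒯.IsL2 ν v) :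
    𝒯.l2Inner ν u v = ∑ K, ∫ z, u K z.1 z.2 * v K z.1 z.2 ∂𝒯.elemProd ν K :=
  𝒯.integral_sum_elem (G := fun K x ξ => u K x ξ * v K x ξ) fun K => (hu K).integrable_mul (hv K)

/-- The discrete counterpart of the chain rule for the squared norm; the discarded term is half the
square of `u - w`, the dissipation of backward Euler. -/
lemma l2Inner_sub_self_ge [IsFiniteMeasure ν] {u w : 𝒯.RandomPwFun N} (hu : 𝒯.IsL2 ν u) (hw : 𝒯.IsL2 ν w) :
    1 / 2 * 𝒯.l2Sq ν u - 1 / 2 * 𝒯.l2Sq ν w ≤ 𝒯.l2Inner ν (u - w) u := by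
  have huw : 𝒯.IsL2 ν (u - w) := fun K => (hu K).sub (hw K)
  rw [l2Sq_eq 𝒯 hu, l2Sq_eq 𝒯 hw, l2Inner_eq 𝒯 huw hu, Finset.mul_sum, Finset.mul_sum,
    ← Finset.sum_sub_distrib]
  refine Finset.sum_le_sum fun K _ => ?_
  rw [← integral_const_mul, ← integral_const_mul,
    ← integral_sub ((hu K).integrable_sq.const_mul _) ((hw K).integrable_sq.const_mul _)]
  refine integral_mono
    (((hu K).integrable_sq.const_mul _).sub ((hw K).integrable_sq.const_mul _))
    ((huw K).integrable_mul (hu K)) fun z => ?_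
  simp only [Pi.sub_apply]
  nlinarith [sq_nonneg (u K z.1 z.2 - w K z.1 z.2)]

lemma l2Inner_le [IsFiniteMeasure ν] {u w : 𝒯.RandomPwFun N} (hu : 𝒯.IsL2 ν u) (hw : 𝒯.IsL2 ν w) {η : ℝ}
    (hη : 0 < η) :
    𝒯.l2Inner ν w u ≤ 1 / 2 * (η⁻¹ * 𝒯.l2Sq ν w + η * 𝒯.l2Sq ν u) := by
  rw [l2Sq_eq 𝒯 hu, l2Sq_eq 𝒯 hw, l2Inner_eq 𝒯 hw hu, Finset.mul_sum, Finset.mul_sum,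
    ← Finset.sum_add_distrib, Finset.mul_sum]
  refine Finset.sum_le_sum fun K _ => ?_
  rw [← integral_const_mul, ← integral_const_mul,
    ← integral_add ((hw K).integrable_sq.const_mul _) ((hu K).integrable_sq.const_mul _),
    ← integral_const_mul]
  refine integral_mono ((hw K).integrable_mul (hu K))
    ((((hw K).integrable_sq.const_mul _).add ((hu K).integrable_sq.const_mul _)).const_mul _)
    fun z => ?_
  have h1 : 0 ≤ η⁻¹ * (w K z.1 z.2 - η * u K z.1 z.2) ^ 2 := by positivity
  have h2 : η⁻¹ * (w K z.1 z.2 - η * u K z.1 z.2) ^ 2 =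
      η⁻¹ * w K z.1 z.2 ^ 2 + η * u K z.1 z.2 ^ 2 - 2 * (w K z.1 z.2 * u K z.1 z.2) := by
    field_simp
    ring
  dsimp only
  linarith

lemma IsRandomDG.isL2 [IsFiniteMeasure ν] {𝒯 : Triangulation D} {ℓ : ℕ} {u : 𝒯.RandomPwFun N}
    (hu : 𝒯.IsRandomDG ℓ u) {S : Set (Noise N)} (hS : IsCompact S) (hν : ∀ᵐ ξ ∂ν, ξ ∈ S) :
    𝒯.IsL2 ν u := by
  intro K
  have hc := (hu.smooth K).continuous
  obtain ⟨C, hC⟩ := ((𝒯.isCompact_elem K).prod hS).exists_bound_of_continuousOn hc.continuousOn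
  refine MemLp.of_bound hc.aestronglyMeasurable C ?_
  have h1 : ∀ᵐ z ∂𝒯.elemProd ν K, z.1 ∈ 𝒯.elem K :=
    Measure.quasiMeasurePreserving_fst.ae (ae_restrict_mem (𝒯.measurableSet_elem K))
  have h2 : ∀ᵐ z ∂𝒯.elemProd ν K, z.2 ∈ S := Measure.quasiMeasurePreserving_snd.ae hν
  filter_upwards [h1, h2] with z hz1 hz2 using hC z ⟨hz1, hz2⟩

/-- Closed triangles may leave `D`, but only by a null set, since their interiors lie in `D`. -/
lemma isL2_deterministic [IsFiniteMeasure ν] (hD : interior (closure D) = D) {g : Plane → ℝ}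
    (hg : MemLp g 2 (volume.restrict D)) : 𝒯.IsL2 ν fun _ x _ => g x := by
  intro K
  have h : MemLp g 2 (volume.restrict (𝒯.elem K)) := by
    rw [← Measure.restrict_congr_set (𝒯.elem_ae_eq_interior K)]
    exact hg.mono_measure (Measure.restrict_mono (𝒯.interior_elem_subset hD K) le_rfl)
  exact h.comp_fst ν

end L2

/-! ### Stability of the backward Euler scheme -/

/-- The diffusivity is nonnegative only almost surely, so the inner square root is removed almost
everywhere. -/
lemma stochEnergyNorm_sq {N : ℕ} {ν : Measure (Noise N)} {σ : ℝ} (hσ : 0 ≤ σ)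
    {a : Plane → Noise N → ℝ} (ha : ∀ᵐ ξ ∂ν, ∀ x ∈ closure D, 0 ≤ a x ξ)
    (b : Plane → Noise N → Plane) (u : 𝒯.RandomPwFun N) :
    𝒯.stochEnergyNorm ν σ a b u ^ 2 =
      ∫ ξ, 𝒯.energySq σ (fun x => a x ξ) (fun x => b x ξ) (fun K x => u K x ξ) ∂ν := by
  rw [stochEnergyNorm, Real.sq_sqrt (integral_nonneg fun _ => sq_nonneg _)]
  exact integral_congr_ae (ha.mono fun ξ h => 𝒯.energyNorm_sq hσ h _ _)

lemma isBddField_diffusivity {N : ℕ} {ν : Measure (Noise N)} {amin amax : ℝ} (hamin : 0 < amin)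
    {a : Plane → Noise N → ℝ} (ha : IsDiffusivity D ν amin amax a) :
    IsBddField (closure D) ν a where
  measurable := ha.measurable
  bounded := by
    refine ⟨amax, ha.bounds.mono fun ξ h x hx => ?_⟩
    rw [Real.norm_of_nonneg (hamin.le.trans (h x hx).1)]
    exact (h x hx).2

/-- Coercivity of the form of the stochastic discontinuous Galerkin method. -/
lemma stochForm_coercive (hD : interior (closure D) = D) (hDb : Bornology.IsBounded D) {κ : ℝ}
    (hκ : 𝒯.IsShapeRegular κ) {N : ℕ} {ν : Measure (Noise N)} [IsFiniteMeasure ν]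
    {S : Set (Noise N)} (hS : IsCompact S) (hν : ∀ᵐ ξ ∂ν, ξ ∈ S) {amin amax : ℝ}
    (hamin : 0 < amin) {a : Plane → Noise N → ℝ} (ha : IsDiffusivity D ν amin amax a)
    {b : Plane → Noise N → Plane} (hb : IsVelocity D ν b) {ℓ : ℕ} {σ : ℝ}
    (hσ : 2 / penaltyScale amin amax ℓ κ ≤ σ) {u : 𝒯.RandomPwFun N} (hu : 𝒯.IsRandomDG ℓ u) :
    1 / 2 * 𝒯.stochEnergyNorm ν σ a b u ^ 2 ≤ 𝒯.stochForm ν σ a b u u := by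
  have hσ0 : 0 ≤ σ := by
    have := penaltyScale_pos hamin amax ℓ κ
    exact (by positivity : (0 : ℝ) ≤ 2 / penaltyScale amin amax ℓ κ).trans hσ
  have hab := isBddField_diffusivity hamin ha
  have hbb : IsBddField (closure D) ν b := ⟨hb.measurable, hb.bounded⟩
  rw [𝒯.stochEnergyNorm_sq hσ0
      (ha.bounds.mono fun ξ h x hx => hamin.le.trans (h x hx).1) b u, stochForm,
    ← integral_const_mul]
  refine integral_mono_ae ((𝒯.integrable_energySq hab hbb hu hDb hS hν σ).const_mul _)
    (𝒯.integrable_sipgForm hab hbb hu hDb hS hν σ) ?_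
  filter_upwards [ha.bounds, hb.continuous, hb.divFree] with ξ h1 h2 h3
  exact 𝒯.sipgForm_coercive hD hκ hamin hσ (ha.measurable.comp measurable_prodMk_right) h1
    (hb.measurable.comp measurable_prodMk_right) h2 h3 fun K => hu.polyLike K ξ

end Triangulation

/-- A discrete stability estimate, without restriction on the step size `τ`. -/
lemma discrete_stability {T τ : ℝ} (hT : 0 < T) (hτ : 0 ≤ τ) {m : ℕ} (hm : m * τ ≤ T)
    {A E F : ℕ → ℝ} (hA : ∀ n, 0 ≤ A n) (hE : ∀ n, 0 ≤ E n) (hF : ∀ n, 0 ≤ F n)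
    (hstep : ∀ n < m, A (n + 1) - A n + τ * E (n + 1) ≤
      τ * (2 * T * F (n + 1) + (2 * T)⁻¹ * A (n + 1))) :
    A m + τ * ∑ n ∈ Finset.Icc 1 m, E n ≤
      2 * A 0 + 4 * T * (τ * ∑ n ∈ Finset.Icc 1 m, F n) := by
  have hsum : ∀ k ≤ m, A k + τ * ∑ n ∈ Finset.Icc 1 k, E n ≤
      A 0 + 2 * T * (τ * ∑ n ∈ Finset.Icc 1 k, F n) +
        (2 * T)⁻¹ * (τ * ∑ n ∈ Finset.Icc 1 k, A n) := by
    intro k hk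
    induction k with
    | zero => simp
    | succ k ih =>
      have h1 := ih (by omega)
      have h2 := hstep k (by omega)
      rw [Finset.sum_Icc_succ_top (by omega), Finset.sum_Icc_succ_top (by omega),
        Finset.sum_Icc_succ_top (by omega)]
      linarith
  -- The index of the largest `A` replaces Gronwall's lemma: the summed estimate is used at this
  -- index and at `m`.
  obtain ⟨k, hk, hmax⟩ := Finset.exists_max_image (Finset.range (m + 1)) A ⟨0, by simp⟩
  have hkm : k ≤ m := by simpa [Nat.lt_succ_iff] using hk
  set R := A 0 + 2 * T * (τ * ∑ n ∈ Finset.Icc 1 m, F n) with hR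
  have hsumA : ∀ j ≤ m, (2 * T)⁻¹ * (τ * ∑ n ∈ Finset.Icc 1 j, A n) ≤ 1 / 2 * A k := by
    intro j hj
    have h1 : ∑ n ∈ Finset.Icc 1 j, A n ≤ j * A k := by
      refine (Finset.sum_le_card_nsmul _ _ (A k) fun n hn => hmax n ?_).trans (le_of_eq ?_)
      · simp only [Finset.mem_Icc] at hn
        simp only [Finset.mem_range]
        omega
      · simp
    have h2 : (j : ℝ) * τ ≤ T :=
      (mul_le_mul_of_nonneg_right (by exact_mod_cast hj) hτ).trans hm
    have h3 : τ * ∑ n ∈ Finset.Icc 1 j, A n ≤ T * A k :=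
      calc τ * ∑ n ∈ Finset.Icc 1 j, A n ≤ τ * (j * A k) := mul_le_mul_of_nonneg_left h1 hτ
        _ = (j * τ) * A k := by ring
        _ ≤ T * A k := mul_le_mul_of_nonneg_right h2 (hA k)
    calc (2 * T)⁻¹ * (τ * ∑ n ∈ Finset.Icc 1 j, A n) ≤ (2 * T)⁻¹ * (T * A k) :=
          mul_le_mul_of_nonneg_left h3 (by positivity)
      _ = 1 / 2 * A k := by field_simp
  have hFk : τ * ∑ n ∈ Finset.Icc 1 k, F n ≤ τ * ∑ n ∈ Finset.Icc 1 m, F n :=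
    mul_le_mul_of_nonneg_left (Finset.sum_le_sum_of_subset_of_nonneg
      (Finset.Icc_subset_Icc_right hkm) fun n _ _ => hF n) hτ
  have hEk : 0 ≤ τ * ∑ n ∈ Finset.Icc 1 k, E n :=
    mul_nonneg hτ (Finset.sum_nonneg fun n _ => hE n)
  have h1 := hsum k hkm
  have h2 := hsumA k hkm
  have h3 := hsum m le_rfl
  have h4 := hsumA m le_rfl
  have h5 : 2 * T * (τ * ∑ n ∈ Finset.Icc 1 k, F n) ≤ 2 * T * (τ * ∑ n ∈ Finset.Icc 1 m, F n) :=
    mul_le_mul_of_nonneg_left hFk (by positivity)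
  -- At the index `k` half of `A k` is absorbed, so `1 / 2 * A k ≤ R`; at `m` the same half is then
  -- bounded by `R`, for a total of `2 * R`.
  linarith

end SDG

end

/-! ### The stability theorem. -/

theorem theorem4
    {D : Set SDG.Plane} (hDopen : IsOpen D) (hDbdd : Bornology.IsBounded D)
    (hDreg : interior (closure D) = D)
    {N : ℕ} (Γ : Fin N → Set ℝ) (ρ : SDG.Noise N → ℝ) (hρ : SDG.IsNoiseDensity Γ ρ)
    (Q : ℕ) (ψ : ℕ → MvPolynomial (Fin N) ℝ)
    (hψ : SDG.IsChaosBasis (SDG.noiseLaw Γ ρ) Q ψ)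
    (amin amax : ℝ) (hamin : 0 < amin) (a : SDG.Plane → SDG.Noise N → ℝ)
    (ha : SDG.IsDiffusivity D (SDG.noiseLaw Γ ρ) amin amax a)
    (b : SDG.Plane → SDG.Noise N → SDG.Plane)
    (hb : SDG.IsVelocity D (SDG.noiseLaw Γ ρ) b)
    (ℓ : ℕ) (κ : ℝ) (T : ℝ) (hT : 0 < T) :
    ∃ σ₀ : ℝ, 0 < σ₀ ∧ ∀ σ : ℝ, σ₀ ≤ σ →
      ∃ C : ℝ, 0 < C ∧
        ∀ 𝒯 : SDG.Triangulation D, 𝒯.IsShapeRegular κ →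
        ∀ Nt : ℕ, 0 < Nt →
        ∀ f : ℝ → SDG.Plane → ℝ,
          (∀ n : ℕ, 1 ≤ n → n ≤ Nt →
            MeasureTheory.MemLp (f (n * (T / Nt))) 2 (MeasureTheory.volume.restrict D)) →
        ∀ u : ℕ → 𝒯.RandomPwFun N,
          𝒯.IsBackwardEulerSolution (SDG.noiseLaw Γ ρ) σ a b ℓ (SDG.chaosSpace Q ψ) T Nt f u →
        ∀ m : ℕ, 0 < m → m ≤ Nt →
          𝒯.l2Norm (SDG.noiseLaw Γ ρ) (u m) ^ 2
            + T / Nt * ∑ n ∈ Finset.Icc 1 m,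
                𝒯.stochEnergyNorm (SDG.noiseLaw Γ ρ) σ a b (u n) ^ 2
          ≤ C * (𝒯.l2Norm (SDG.noiseLaw Γ ρ) (u 0) ^ 2
              + T / Nt * ∑ n ∈ Finset.Icc 1 m,
                  𝒯.l2Norm (SDG.noiseLaw Γ ρ) (fun _ x _ => f (n * (T / Nt)) x) ^ 2) := by
  have hε := SDG.Triangulation.penaltyScale_pos hamin amax ℓ κ
  -- The threshold is the one required for coercivity; `2 + 4 * T` dominates both constants of
  -- `discrete_stability` and does not depend on `σ`.
  refine ⟨2 / SDG.Triangulation.penaltyScale amin amax ℓ κ, by positivity, fun σ hσ =>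
    ⟨2 + 4 * T, by positivity, ?_⟩⟩
  intro 𝒯 hκ Nt hNt f hf u ⟨hu0, hu, hsol⟩ m hm hmN
  have := SDG.isProbabilityMeasure_noiseLaw hρ
  obtain ⟨S, hS, hν⟩ := SDG.exists_isCompact_ae_mem hρ
  set ν := SDG.noiseLaw Γ ρ with hνdef
  set τ := T / Nt with hτdef
  have hNt' : (0 : ℝ) < Nt := by exact_mod_cast hNt
  have hτ : 0 < τ := div_pos hT hNt'
  have hdg : ∀ n, 1 ≤ n → n ≤ Nt → 𝒯.IsRandomDG ℓ (u n) := fun n h1 h2 =>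
    𝒯.isRandomDG_of_mem_tensorSpace (hu n h1 h2)
  have hL2 : ∀ n ≤ Nt, 𝒯.IsL2 ν (u n) := by
    intro n hn
    rcases Nat.eq_zero_or_pos n with rfl | h
    · exact hu0
    · exact (hdg n h hn).isL2 hS hν
  have hmτ : m * τ ≤ T := by
    rw [hτdef, mul_div_assoc', div_le_iff₀ hNt', mul_comm]
    exact mul_le_mul_of_nonneg_left (by exact_mod_cast hmN) hT.le
  have hstab := SDG.discrete_stability hT hτ.le hmτ
    (A := fun n => 𝒯.l2Sq ν (u n)) (E := fun n => 𝒯.stochEnergyNorm ν σ a b (u n) ^ 2)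
    (F := fun n => 𝒯.l2Sq ν fun _ x _ => f (n * τ) x)
    (fun n => 𝒯.l2Sq_nonneg _) (fun n => sq_nonneg _) (fun n => 𝒯.l2Sq_nonneg _) ?_
  · simp only [SDG.Triangulation.l2Norm_sq]
    have h1 := 𝒯.l2Sq_nonneg (ν := ν) (u 0)
    have h2 : 0 ≤ τ * ∑ n ∈ Finset.Icc 1 m, 𝒯.l2Sq ν fun _ x _ => f (n * τ) x :=
      mul_nonneg hτ.le (Finset.sum_nonneg fun n _ => 𝒯.l2Sq_nonneg _)
    have h3 := mul_nonneg hT.le h1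
    linarith
  · intro n hn
    have hnN : n + 1 ≤ Nt := by omega
    -- The new iterate is an admissible test function even for `n = 0`, where the old iterate is
    -- only square integrable.
    have heq := hsol n (by omega) (u (n + 1)) (hu (n + 1) (by omega) hnN)
    have hcoer := 𝒯.stochForm_coercive hDreg hDbdd hκ hS hν hamin ha hb hσ
      (hdg (n + 1) (by omega) hnN)
    have hsub := 𝒯.l2Inner_sub_self_ge (hL2 (n + 1) hnN) (hL2 n (by omega))
    -- The weight `(2 * T)⁻¹` makes the contribution of the solution, summed over the time interval,
    -- at most half of its maximum.
    have hload := 𝒯.l2Inner_le (hL2 (n + 1) hnN)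
      (𝒯.isL2_deterministic (ν := ν) hDreg (hf (n + 1) (by omega) hnN))
      (η := (2 * T)⁻¹) (by positivity)
    rw [inv_inv] at hload
    -- The load is by definition the inner product with a field that does not depend on the noise.
    have hload' : 𝒯.stochLoad ν (f ((n + 1 : ℕ) * τ)) (u (n + 1)) ≤
        1 / 2 * (2 * T * 𝒯.l2Sq ν (fun _ x _ => f ((n + 1 : ℕ) * τ) x) +
          (2 * T)⁻¹ * 𝒯.l2Sq ν (u (n + 1))) := hload
    rw [← heq] at hload'
    have h1 := mul_le_mul_of_nonneg_left hload' hτ.le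
    rw [mul_add, ← mul_assoc, mul_one_div_cancel hτ.ne', one_mul] at h1
    have h2 := mul_le_mul_of_nonneg_left hcoer hτ.le
    linarith
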